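/- Consider the network creation game of Fabrikant et al. on a finite vertex set $V$ with $|V| = n \ge 1$ and edge price $\alpha \in \mathbb{R}$. A strategy of a vertex $v$ is a set $E_v$ of edges (unordered pairs of distinct vertices) incident to $v$, the edges that $v$ buys. A strategy profile $\mathcal{E} = (E_v)_{v \in V}$ induces the undirected graph $G = \left(V, \bigcup_{v \in V} E_v\right)$, and the cost of $v$ is $$c_v(\mathcal{E}) = \alpha\,|E_v| + \sum_{u \ne v} d_G(u,v),$$ where $d_G(u,v)$ is the distance between $u$ and $v$ in $G$, equal to $\infty$ if no path joins them. The profile $\mathcal{E}$ is a Nash equilibrium if no vertex $v$ can reduce its cost $c_v$ by replacing $E_v$ with another set of edges incident to $v$ while all $E_u$ with $u \ne v$ remain fixed. Theorem. If $\alpha > 3(n-1)$, then for every Nash equilibrium $\mathcal{E}$ the induced graph $G$ is a tree (that is, connected and without cycles, hence a spanning tree on $V$). -/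

import Mathlib

namespace NetworkCreation

/-- A strategy of the agent `v`: a set of edges (unordered pairs of distinct vertices) incident
to `v`, namely the edges that `v` buys. -/
abbrev Strategy {V : Type*} (v : V) : Type _ :=
  {E : Finset (Sym2 V) // ∀ e ∈ E, v ∈ e ∧ ¬ e.IsDiag}

/-- A strategy profile: one strategy for every agent. -/
abbrev Profile (V : Type*) : Type _ := (v : V) → Strategy v

/-- The undirected network induced by a profile: its edge set is the union of the sets of edges
bought by the agents. -/
def graph {V : Type*} (S : Profile V) : SimpleGraph V :=
  SimpleGraph.fromEdgeSet (⋃ v, ((S v).1 : Set (Sym2 V)))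

/-- The connection cost of `v` in `G`: the sum of the distances from `v` to all other vertices,
where the distance is `⊤` between vertices that are not joined by a path. -/
noncomputable def connectionCost {V : Type*} [Fintype V] [DecidableEq V]
    (G : SimpleGraph V) (v : V) : ℕ∞ :=
  ∑ u ∈ Finset.univ.erase v, G.edist u v

/-- The total cost of `v` for edge price `α`: the building cost `α * |S v|` plus the connection
cost, as an extended real number. -/
noncomputable def cost {V : Type*} [Fintype V] [DecidableEq V]
    (α : ℝ) (S : Profile V) (v : V) : EReal :=
  ((α * ((S v).1.card : ℝ) : ℝ) : EReal) + ((connectionCost (graph S) v : ENNReal) : EReal)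

/-- A profile is a Nash equilibrium if no agent can reduce its total cost by buying a different
set of edges while the strategies of all other agents stay fixed. -/
def IsNash {V : Type*} [Fintype V] [DecidableEq V] (α : ℝ) (S : Profile V) : Prop :=
  ∀ (v : V) (T : Strategy v), cost α S v ≤ cost α (Function.update S v T) v

end NetworkCreation

namespace CyclicWalk

open Finset

section Weights

variable {L : ℕ} [NeZero L]

/-- The triangular weight of the ordered pair `(i, j)` of points of a cycle of length `L`: it
decreases linearly in the forward distance from `i` to `j`. -/
noncomputable def weight (i j : ZMod L) : ℝ := if i = j then 0 else (L : ℝ) - ((j - i).val : ℝ)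

omit [NeZero L] in
lemma weight_self (i : ZMod L) : weight i i = 0 := by simp [weight]

omit [NeZero L] in
lemma weight_of_ne {i j : ZMod L} (h : i ≠ j) : weight i j = (L : ℝ) - ((j - i).val : ℝ) := by
  simp [weight, h]

lemma weight_nonneg (i j : ZMod L) : 0 ≤ weight i j := by
  unfold weight
  split_ifs
  · exact le_rfl
  · have := (ZMod.val_lt (j - i)).le
    have : ((j - i).val : ℝ) ≤ L := by exact_mod_cast this
    linarith

lemma weight_add_weight (i j : ZMod L) : weight i j + weight j i = if i = j then 0 else (L : ℝ) := by
  by_cases h : i = j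
  · simp [weight, h]
  · rw [weight_of_ne h, weight_of_ne (Ne.symm h), if_neg h]
    have hne : NeZero (j - i) := ⟨sub_ne_zero.2 (Ne.symm h)⟩
    have h1 : (i - j).val = L - (j - i).val := by
      rw [← neg_sub j i, ZMod.val_neg_of_ne_zero]
    have h2 := (ZMod.val_lt (j - i)).le
    rw [h1, Nat.cast_sub h2]
    ring

lemma sum_val {M : Type*} [AddCommMonoid M] (g : ℕ → M) :
    ∑ d : ZMod L, g d.val = ∑ k ∈ range L, g k := by
  obtain ⟨n, rfl⟩ : ∃ n, L = n + 1 := ⟨L - 1, (Nat.succ_pred_eq_of_ne_zero (NeZero.ne L)).symm⟩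
  exact Fin.sum_univ_eq_sum_range g (n + 1)

lemma sum_weight (i : ZMod L) : ∑ j, weight i j = (L : ℝ) * (L - 1) / 2 := by
  rw [← Equiv.sum_comp (Equiv.addLeft i)]
  have h : ∀ d : ZMod L, weight i (Equiv.addLeft i d)
      = (fun k : ℕ => if k = 0 then (0 : ℝ) else (L : ℝ) - k) d.val := by
    intro d
    by_cases hd : d = 0
    · simp [hd, weight]
    · simp [weight, hd]
  rw [Finset.sum_congr rfl (fun d _ => h d),
    sum_val (L := L) (fun k : ℕ => if k = 0 then (0 : ℝ) else (L : ℝ) - k)]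
  obtain ⟨n, hn⟩ : ∃ n, L = n + 1 := ⟨L - 1, (Nat.succ_pred_eq_of_ne_zero (NeZero.ne L)).symm⟩
  rw [hn, Finset.sum_range_succ']
  simp only [Nat.add_eq_zero_iff, one_ne_zero, and_false, if_false, if_true, add_zero]
  have : ∀ (m : ℕ) (c : ℝ), ∑ k ∈ range m, (c - ((k + 1 : ℕ) : ℝ)) = m * c - m * (m + 1) / 2 := by
    intro m c
    induction m with
    | zero => simp
    | succ m ih => rw [Finset.sum_range_succ, ih]; push_cast; ring
  rw [this]
  push_cast
  ring

lemma weight_succ_sub (hL : 2 ≤ L) (i j : ZMod L) :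
    weight (i + 1) j - weight i j = 1 - if j = i + 1 then (L : ℝ) else 0 := by
  have : Fact (1 < L) := ⟨hL⟩
  have hLr : (1 : ℝ) ≤ L := by exact_mod_cast (by omega : 1 ≤ L)
  by_cases h1 : j = i + 1
  · subst h1
    have : i ≠ i + 1 := by simp
    rw [weight_self, weight_of_ne this]
    simp [ZMod.val_one]
  · by_cases h0 : j = i
    · subst h0
      rw [weight_self, weight_of_ne (Ne.symm h1), if_neg h1]
      have : (j - (j + 1)) = -1 := by ring
      rw [this, ZMod.val_neg_of_ne_zero, ZMod.val_one, Nat.cast_sub (by omega)]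
      push_cast
      ring
    · rw [weight_of_ne (Ne.symm h1), weight_of_ne (Ne.symm h0), if_neg h1]
      have h2 : (j - (i + 1)).val + 1 = (j - i).val := by
        have e : j - i = (j - (i + 1)) + 1 := by ring
        have hlt : (j - (i + 1)).val + (1 : ZMod L).val < L := by
          rw [ZMod.val_one]
          have := ZMod.val_lt (j - (i + 1))
          by_contra hcon
          have hv : (j - (i + 1)).val = L - 1 := by omega
          apply h0
          have : j - (i + 1) = -1 := by
            rw [← ZMod.natCast_zmod_val (j - (i + 1)), hv, Nat.cast_sub (by omega)]
            simp
          have := congrArg (· + (i + 1)) this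
          simpa using this
        conv_rhs => rw [e, ZMod.val_add_of_lt hlt, ZMod.val_one]
      rw [← h2]
      push_cast
      ring

lemma sum_weight_succ (hL : 2 ≤ L) (a : ZMod L → ℝ) (i : ZMod L) :
    ∑ j, weight (i + 1) j * a j = ∑ j, weight i j * a j + ∑ j, a j - L * a (i + 1) := by
  have h : ∀ j, weight (i + 1) j * a j
      = weight i j * a j + a j - (if j = i + 1 then (L : ℝ) * a j else 0) := by
    intro j
    have := weight_succ_sub hL i j
    have : weight (i + 1) j = weight i j + 1 - if j = i + 1 then (L : ℝ) else 0 := by linarith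
    rw [this]
    split_ifs <;> ring
  rw [Finset.sum_congr rfl (fun j _ => h j), Finset.sum_sub_distrib, Finset.sum_add_distrib]
  simp

/-- Summation by parts around the cycle against the indicator of a set that carries `a`. -/
lemma sum_weight_indicator (hL : 2 ≤ L) (a χ : ZMod L → ℝ) (hχ : ∀ j, χ j * a j = a j) :
    ∑ i, (∑ j, weight i j * a j) * (χ (i + 1) - χ i) = ((L : ℝ) - ∑ i, χ i) * ∑ j, a j := by
  set W : ZMod L → ℝ := fun i => ∑ j, weight i j * a j with hW
  have h1 : ∑ i, W i * χ i = ∑ i, W (i + 1) * χ (i + 1) :=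
    (Equiv.sum_comp (Equiv.addRight (1 : ZMod L)) (fun i => W i * χ i)).symm
  have h2 : ∀ g : ZMod L → ℝ, ∑ i, g (i + 1) = ∑ i, g i := fun g =>
    Equiv.sum_comp (Equiv.addRight (1 : ZMod L)) g
  calc ∑ i, W i * (χ (i + 1) - χ i) = ∑ i, W i * χ (i + 1) - ∑ i, W i * χ i := by
        rw [← Finset.sum_sub_distrib]; exact Finset.sum_congr rfl (fun i _ => by ring)
    _ = ∑ i, (L * a (i + 1) - (∑ j, a j) * χ (i + 1)) := by
        rw [h1, ← Finset.sum_sub_distrib]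
        refine Finset.sum_congr rfl (fun i _ => ?_)
        have := sum_weight_succ hL a i
        have e : W (i + 1) = W i + ∑ j, a j - L * a (i + 1) := this
        rw [e]
        have := hχ (i + 1)
        linear_combination (L : ℝ) * this
    _ = ((L : ℝ) - ∑ i, χ i) * ∑ j, a j := by
        rw [Finset.sum_sub_distrib, h2 (fun i => (L : ℝ) * a i), ← Finset.mul_sum,
          h2 (fun i => (∑ j, a j) * χ i), ← Finset.mul_sum]
        ring

/-- The cyclic orientation of a triple of points. -/
def orient (i j y : ZMod L) : ℤ :=
  ((j.val : ℤ) - i.val).sign * ((y.val : ℤ) - j.val).sign * ((y.val : ℤ) - i.val).sign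

omit [NeZero L] in
lemma orient_swap_left (i j y : ZMod L) : orient y j i = -orient i j y := by
  unfold orient
  rw [← neg_sub (y.val : ℤ) j.val, ← neg_sub (j.val : ℤ) i.val, ← neg_sub (y.val : ℤ) i.val,
    Int.sign_neg, Int.sign_neg, Int.sign_neg]
  ring

omit [NeZero L] in
lemma orient_swap_right (i j y : ZMod L) : orient i y j = -orient i j y := by
  unfold orient
  rw [← neg_sub (y.val : ℤ) j.val, Int.sign_neg]
  ring

omit [NeZero L] in
lemma orient_swap (i j y : ZMod L) : orient j i y = -orient i j y := by
  unfold orient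
  rw [← neg_sub (j.val : ℤ) i.val, Int.sign_neg]
  ring

omit [NeZero L] in
lemma orient_le_one (i j y : ZMod L) : orient i j y ≤ 1 := by
  unfold orient
  rcases Int.sign_trichotomy ((j.val : ℤ) - i.val) with h | h | h <;>
  rcases Int.sign_trichotomy ((y.val : ℤ) - j.val) with h' | h' | h' <;>
  rcases Int.sign_trichotomy ((y.val : ℤ) - i.val) with h'' | h'' | h'' <;>
  simp [h, h', h'']

lemma sum_range_sign_mul_sign (a b n : ℕ) (hab : a < b) :
    ∑ y ∈ range n, (((y : ℤ) - b).sign * ((y : ℤ) - a).sign)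
      = (min n a : ℤ) - (min n b - min n (a + 1)) + (n - min n (b + 1)) := by
  induction n with
  | zero => simp
  | succ n ih =>
    rw [Finset.sum_range_succ, ih]
    have s : ∀ c : ℕ, ((n : ℤ) - c).sign = if n < c then -1 else if n = c then 0 else 1 := by
      intro c
      split_ifs with h1 h2
      · exact Int.sign_eq_neg_one_of_neg (by omega)
      · simp [h2]
      · exact Int.sign_eq_one_of_pos (by omega)
    rw [s a, s b]
    push_cast
    split_ifs <;> omega

lemma sum_orient (i j : ZMod L) : ((∑ y, orient i j y : ℤ) : ℝ) = weight i j - weight j i := by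
  wlog hij : i.val ≤ j.val generalizing i j with H
  · have h := H j i (by omega)
    have e : ∑ y, orient i j y = -∑ y, orient j i y := by
      rw [← Finset.sum_neg_distrib]
      exact Finset.sum_congr rfl (fun y _ => orient_swap j i y)
    rw [e]
    push_cast
    push_cast at h
    rw [h]
    ring
  · rcases hij.eq_or_lt with h | h
    · have : i = j := ZMod.val_injective L h
      subst this
      simp [orient]
    · have hne : i ≠ j := fun e => by simp [e] at h
      have h1 : ∑ y, orient i j y = (L : ℤ) - 2 * (j.val - i.val) := by
        have e : ∀ y : ZMod L, orient i j y
            = (fun k : ℕ => ((k : ℤ) - j.val).sign * ((k : ℤ) - i.val).sign) y.val := by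
          intro y
          unfold orient
          rw [Int.sign_eq_one_of_pos (by omega : (0 : ℤ) < (j.val : ℤ) - i.val), one_mul]
        rw [Finset.sum_congr rfl (fun y _ => e y),
          sum_val (L := L) (fun k : ℕ => ((k : ℤ) - j.val).sign * ((k : ℤ) - i.val).sign),
          sum_range_sign_mul_sign _ _ _ h]
        have := ZMod.val_lt j
        have := ZMod.val_lt i
        omega
      have h2 := weight_add_weight i j
      rw [if_neg hne] at h2
      have h3 : weight i j = (L : ℝ) - (j.val - i.val) := by
        rw [weight_of_ne hne, ZMod.val_sub hij, Nat.cast_sub hij]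
      rw [h1]
      push_cast
      linarith

omit [NeZero L] in
lemma sum_antisymm_eq_zero (X : Finset (ZMod L)) (o : ZMod L → ZMod L → ℤ)
    (h : ∀ a b, o b a = -o a b) : ∑ a ∈ X, ∑ b ∈ X, o a b = 0 := by
  have e : ∑ a ∈ X, ∑ b ∈ X, o a b = -∑ a ∈ X, ∑ b ∈ X, o a b := by
    conv_lhs => rw [Finset.sum_comm]
    rw [← Finset.sum_neg_distrib]
    refine Finset.sum_congr rfl (fun a _ => ?_)
    rw [← Finset.sum_neg_distrib]
    exact Finset.sum_congr rfl (fun b _ => h a b)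
  omega

/-- The asymmetry of the weights between two disjoint sets is bounded by the number of points that
lie in neither of them. -/
lemma weight_drift (X Y : Finset (ZMod L)) (hXY : Disjoint X Y) :
    ∑ i ∈ X, ∑ j ∈ Y, (weight i j - weight j i)
      ≤ (#X : ℝ) * #Y * ((L : ℝ) - #X - #Y) := by
  have h1 : ∑ i ∈ X, ∑ j ∈ Y, (weight i j - weight j i)
      = ((∑ i ∈ X, ∑ j ∈ Y, ∑ y, orient i j y : ℤ) : ℝ) := by
    push_cast
    refine Finset.sum_congr rfl (fun i _ => Finset.sum_congr rfl (fun j _ => ?_))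
    rw [← sum_orient]
    push_cast
    rfl
  have hX : ∑ i ∈ X, ∑ j ∈ Y, ∑ y ∈ X, orient i j y = 0 := by
    rw [Finset.sum_comm]
    exact Finset.sum_eq_zero (fun j _ => sum_antisymm_eq_zero X (fun i y => orient i j y)
      (fun a b => orient_swap_left a j b))
  have hY : ∑ i ∈ X, ∑ j ∈ Y, ∑ y ∈ Y, orient i j y = 0 :=
    Finset.sum_eq_zero (fun i _ => sum_antisymm_eq_zero Y (fun j y => orient i j y)
      (fun a b => orient_swap_right i a b))
  have h2 : ∑ i ∈ X, ∑ j ∈ Y, ∑ y, orient i j y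
      = ∑ i ∈ X, ∑ j ∈ Y, ∑ y ∈ (X ∪ Y)ᶜ, orient i j y := by
    have e : ∀ i j : ZMod L, ∑ y, orient i j y = ∑ y ∈ X, orient i j y + ∑ y ∈ Y, orient i j y
        + ∑ y ∈ (X ∪ Y)ᶜ, orient i j y := by
      intro i j
      rw [← Finset.sum_union hXY, Finset.sum_add_sum_compl]
    simp only [e, Finset.sum_add_distrib]
    rw [hX, hY]
    ring
  have hc : (#(X ∪ Y)ᶜ : ℝ) = (L : ℝ) - #X - #Y := by
    rw [Finset.card_compl, Nat.cast_sub (Finset.card_le_univ _), Finset.card_union_of_disjoint hXY,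
      ZMod.card]
    push_cast
    ring
  rw [h1, h2, ← hc]
  have h3 : ∑ i ∈ X, ∑ j ∈ Y, ∑ y ∈ (X ∪ Y)ᶜ, orient i j y
      ≤ ∑ i ∈ X, ∑ j ∈ Y, ∑ y ∈ (X ∪ Y)ᶜ, (1 : ℤ) :=
    Finset.sum_le_sum (fun i _ => Finset.sum_le_sum (fun j _ => Finset.sum_le_sum
      (fun y _ => orient_le_one i j y)))
  have h4 : ((∑ i ∈ X, ∑ j ∈ Y, ∑ y ∈ (X ∪ Y)ᶜ, orient i j y : ℤ) : ℝ)
      ≤ ((∑ i ∈ X, ∑ j ∈ Y, ∑ y ∈ (X ∪ Y)ᶜ, (1 : ℤ) : ℤ) : ℝ) := by exact_mod_cast h3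
  refine h4.trans (le_of_eq ?_)
  simp
  ring

/-- The total weight from `X` to `Y`, for disjoint `X` and `Y`. -/
lemma sum_weight_le (X Y : Finset (ZMod L)) (hXY : Disjoint X Y) :
    ∑ i ∈ X, ∑ j ∈ Y, weight i j ≤ (#X : ℝ) * #Y * (2 * (L : ℝ) - #X - #Y) / 2 := by
  have h := weight_drift X Y hXY
  have h2 : ∑ i ∈ X, ∑ j ∈ Y, (weight i j + weight j i) = (#X : ℝ) * #Y * L := by
    have : ∀ i ∈ X, ∀ j ∈ Y, weight i j + weight j i = (L : ℝ) := by
      intro i hi j hj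
      rw [weight_add_weight, if_neg (Finset.disjoint_iff_ne.1 hXY i hi j hj)]
    rw [Finset.sum_congr rfl (fun i hi => Finset.sum_congr rfl (fun j hj => this i hi j hj))]
    simp
    ring
  simp only [Finset.sum_sub_distrib, Finset.sum_add_distrib] at h h2
  nlinarith

lemma sum_weight_sub_le (X Y : Finset (ZMod L)) (hXY : Disjoint X Y) :
    (#X : ℝ) * #Y * (#X + #Y) / 2 ≤ ∑ i ∈ X, ∑ j ∈ Y, weight i j := by
  have h := sum_weight_le Y X hXY.symm
  have h2 : ∑ i ∈ X, ∑ j ∈ Y, (weight i j + weight j i) = (#X : ℝ) * #Y * L := by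
    have : ∀ i ∈ X, ∀ j ∈ Y, weight i j + weight j i = (L : ℝ) := by
      intro i hi j hj
      rw [weight_add_weight, if_neg (Finset.disjoint_iff_ne.1 hXY i hi j hj)]
    rw [Finset.sum_congr rfl (fun i hi => Finset.sum_congr rfl (fun j hj => this i hi j hj))]
    simp
    ring
  rw [Finset.sum_comm] at h
  simp only [Finset.sum_add_distrib] at h2
  nlinarith

lemma sum_weight_within (X : Finset (ZMod L)) :
    ∑ i ∈ X, ∑ j ∈ X, weight i j = (L : ℝ) * #X * (#X - 1) / 2 := by
  have h2 : ∑ i ∈ X, ∑ j ∈ X, (weight i j + weight j i) = (L : ℝ) * #X * (#X - 1) := by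
    simp only [weight_add_weight]
    have : ∀ i ∈ X, ∑ j ∈ X, (if i = j then (0 : ℝ) else L) = L * (#X - 1) := by
      intro i hi
      have e : ∀ j, (if i = j then (0 : ℝ) else L) = L - (if i = j then (L : ℝ) else 0) := by
        intro j; split_ifs <;> simp
      rw [Finset.sum_congr rfl (fun j _ => e j), Finset.sum_sub_distrib]
      simp [hi]
      ring
    rw [Finset.sum_congr rfl this]
    simp
    ring
  have h3 : ∑ i ∈ X, ∑ j ∈ X, weight j i = ∑ i ∈ X, ∑ j ∈ X, weight i j := Finset.sum_comm
  simp only [Finset.sum_add_distrib] at h2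
  linarith

end Weights

end CyclicWalk

namespace CyclicWalk

open Finset

section Runs

variable {L : ℕ} [NeZero L] (f : ZMod L → ℕ)

/-- Consecutive values of `f` differ by at most one. -/
def UnitSteps : Prop := ∀ i, f (i + 1) ≤ f i + 1 ∧ f i ≤ f (i + 1) + 1

lemma exists_not_drop_backward (i : ZMod L) : ∃ t : ℕ, ¬ f (i - t) < f (i - t - 1) := by
  by_contra! h
  have key : ∀ t : ℕ, f i + t ≤ f (i - t) := by
    intro t
    induction t with
    | zero => simp
    | succ t ih =>
      have := h t
      have e : i - ((t + 1 : ℕ) : ZMod L) = i - t - 1 := by push_cast; ring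
      rw [e]
      omega
  have := key L
  have := NeZero.pos L
  simp at *
  omega

lemma exists_not_drop_forward (i : ZMod L) : ∃ h : ℕ, ¬ f (i + h + 1) < f (i + h) := by
  by_contra! h
  have key : ∀ t : ℕ, f (i + t) + t ≤ f i := by
    intro t
    induction t with
    | zero => simp
    | succ t ih =>
      have := h t
      have e : i + ((t + 1 : ℕ) : ZMod L) = i + t + 1 := by push_cast; ring
      rw [e]
      omega
  have := key L
  have := NeZero.pos L
  simp at *
  omega

/-- The number of consecutive drops of `f` immediately before `i`. -/
def depth (i : ZMod L) : ℕ := Nat.find (exists_not_drop_backward f i)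

/-- The number of consecutive drops of `f` starting at `i`. -/
def height (i : ZMod L) : ℕ := Nat.find (exists_not_drop_forward f i)

/-- Whether the maximal run of drops through `i` is not preceded by a rise. -/
def plat (i : ZMod L) : ℕ := if f (i - depth f i - 1) < f (i - depth f i) then 0 else 1

/-- The increase in distance when the drop at `i` is made unavailable. -/
def cap (i : ZMod L) : ℕ := 2 * depth f i + plat f i

/-- The beginnings of the maximal runs of drops. -/
def starts : Finset (ZMod L) := {i | f (i + 1) < f i ∧ ¬ f i < f (i - 1)}

variable {f}

lemma plat_le_one (i : ZMod L) : plat f i ≤ 1 := by unfold plat; split_ifs <;> omega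

lemma depth_spec (i : ZMod L) : ¬ f (i - depth f i) < f (i - depth f i - 1) :=
  Nat.find_spec (exists_not_drop_backward f i)

lemma depth_min {i : ZMod L} {t : ℕ} (h : t < depth f i) : f (i - t) < f (i - t - 1) :=
  not_not.1 (Nat.find_min (exists_not_drop_backward f i) h)

lemma height_spec (i : ZMod L) : ¬ f (i + height f i + 1) < f (i + height f i) :=
  Nat.find_spec (exists_not_drop_forward f i)

lemma height_min {i : ZMod L} {t : ℕ} (h : t < height f i) : f (i + t + 1) < f (i + t) :=
  not_not.1 (Nat.find_min (exists_not_drop_forward f i) h)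

lemma apply_sub_of_le_depth (hf : UnitSteps f) {i : ZMod L} {t : ℕ} (h : t ≤ depth f i) :
    f (i - t) = f i + t := by
  induction t with
  | zero => simp
  | succ t ih =>
    have h1 := ih (by omega)
    have h2 := depth_min (f := f) (i := i) (t := t) (by omega)
    have h3 := (hf (i - t - 1)).2
    have e : i - ((t + 1 : ℕ) : ZMod L) = i - t - 1 := by push_cast; ring
    have e' : i - (t : ZMod L) - 1 + 1 = i - t := by ring
    rw [e'] at h3
    rw [e]
    omega

lemma apply_add_of_le_height (hf : UnitSteps f) {i : ZMod L} {t : ℕ} (h : t ≤ height f i) :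
    f (i + t) + t = f i := by
  induction t with
  | zero => simp
  | succ t ih =>
    have h1 := ih (by omega)
    have h2 := height_min (f := f) (i := i) (t := t) (by omega)
    have h3 := (hf (i + t)).2
    have e : i + ((t + 1 : ℕ) : ZMod L) = i + t + 1 := by push_cast; ring
    rw [e]
    omega

lemma depth_lt (hf : UnitSteps f) (i : ZMod L) : depth f i < L := by
  by_contra! h
  have := apply_sub_of_le_depth hf h
  have := NeZero.pos L
  simp at *
  omega

lemma height_pos {i : ZMod L} (h : f (i + 1) < f i) : 0 < height f i := by
  by_contra! h0
  have h1 := height_spec (f := f) i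
  have : height f i = 0 := by omega
  rw [this] at h1
  simp at h1
  omega

lemma height_le (hf : UnitSteps f) (i : ZMod L) : height f i ≤ f i := by
  have := apply_add_of_le_height hf (le_refl (height f i))
  omega

omit [NeZero L] in
lemma cast_add_sub (i : ZMod L) {s t : ℕ} (h : s ≤ t) :
    i + (t : ZMod L) - s = i + ((t - s : ℕ) : ZMod L) := by
  rw [Nat.cast_sub h]; ring

lemma mem_starts {i : ZMod L} : i ∈ starts f ↔ f (i + 1) < f i ∧ ¬ f i < f (i - 1) := by
  simp [starts]

lemma depth_of_mem_starts {i : ZMod L} (hi : i ∈ starts f) {t : ℕ} (ht : t < height f i) :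
    depth f (i + t) = t := by
  unfold depth
  rw [Nat.find_eq_iff]
  refine ⟨?_, fun s hs => not_not.2 ?_⟩
  · rw [cast_add_sub i le_rfl]
    simpa using (mem_starts.1 hi).2
  · obtain ⟨r, rfl⟩ : ∃ r, t = s + r + 1 := ⟨t - s - 1, by omega⟩
    have h := height_min (f := f) (i := i) (t := r) (by omega)
    have e1 : i + ((s + r + 1 : ℕ) : ZMod L) - s = i + r + 1 := by push_cast; ring
    have e2 : i + ((s + r + 1 : ℕ) : ZMod L) - s - 1 = i + r := by push_cast; ring
    rw [e2, e1]
    exact h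

lemma plat_of_mem_starts {i : ZMod L} (hi : i ∈ starts f) {t : ℕ} (ht : t < height f i) :
    plat f (i + t) = plat f i := by
  have h0 : depth f i = 0 := by
    have := depth_of_mem_starts hi (height_pos (mem_starts.1 hi).1)
    simpa using this
  unfold plat
  rw [depth_of_mem_starts hi ht, h0]
  simp

lemma plat_start {i : ZMod L} (hi : i ∈ starts f) :
    plat f i = if f (i - 1) < f i then 0 else 1 := by
  have h0 : depth f i = 0 := by
    have := depth_of_mem_starts hi (height_pos (mem_starts.1 hi).1)
    simpa using this
  unfold plat
  rw [h0]
  simp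

lemma sub_depth_mem_starts {i : ZMod L} (hi : f (i + 1) < f i) : i - depth f i ∈ starts f := by
  rw [mem_starts]
  refine ⟨?_, depth_spec i⟩
  rcases Nat.eq_zero_or_pos (depth f i) with h | h
  · simpa [h] using hi
  · obtain ⟨d, hd⟩ : ∃ d, depth f i = d + 1 := ⟨depth f i - 1, by omega⟩
    have := depth_min (f := f) (i := i) (t := d) (by omega)
    rw [hd]
    have e1 : i - ((d + 1 : ℕ) : ZMod L) + 1 = i - d := by push_cast; ring
    have e2 : i - ((d + 1 : ℕ) : ZMod L) = i - d - 1 := by push_cast; ring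
    rw [e1, e2]
    exact this

lemma depth_lt_height {i : ZMod L} (hi : f (i + 1) < f i) :
    depth f i < height f (i - depth f i) := by
  by_contra! hcon
  have h1 := height_spec (f := f) (i - depth f i)
  set d := depth f i with hd
  set h := height f (i - d) with hh
  apply h1
  rcases hcon.eq_or_lt with he | hlt
  · rw [he]; simpa using hi
  · have := depth_min (f := f) (i := i) (t := d - h - 1) (by omega)
    have e1 : i - (d : ZMod L) + h + 1 = i - ((d - h - 1 : ℕ) : ZMod L) := by
      rw [Nat.sub_sub, Nat.cast_sub (by omega)]; push_cast; ring
    have e2 : i - (d : ZMod L) + h = i - ((d - h - 1 : ℕ) : ZMod L) - 1 := by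
      rw [Nat.sub_sub, Nat.cast_sub (by omega)]; push_cast; ring
    rw [e1, e2]
    exact this

variable (f) in
/-- Every drop lies in exactly one maximal run of drops. -/
lemma sum_drops {M : Type*} [AddCommMonoid M] (φ : ZMod L → M) :
    ∑ j with f (j + 1) < f j, φ j = ∑ i ∈ starts f, ∑ t ∈ range (height f i), φ (i + t) := by
  rw [Finset.sum_sigma']
  refine Finset.sum_bij' (fun j _ => ⟨j - depth f j, depth f j⟩) (fun p _ => p.1 + p.2)
    ?_ ?_ ?_ ?_ ?_
  · intro j hj
    have hj' := (Finset.mem_filter.1 hj).2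
    simp only [Finset.mem_sigma, Finset.mem_range]
    exact ⟨sub_depth_mem_starts hj', depth_lt_height hj'⟩
  · rintro ⟨i, t⟩ hp
    simp only [Finset.mem_sigma, Finset.mem_range] at hp
    simpa using height_min hp.2
  · intro j _
    simp
  · rintro ⟨i, t⟩ hp
    simp only [Finset.mem_sigma, Finset.mem_range] at hp
    have := depth_of_mem_starts hp.1 hp.2
    simp [this]
  · intro j _
    simp

lemma sum_shift {M : Type*} [AddCommMonoid M] (g : ZMod L → M) : ∑ i, g (i + 1) = ∑ i, g i :=
  Equiv.sum_comp (Equiv.addRight (1 : ZMod L)) g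

/-- There are as many rises from a level as there are drops to it. -/
lemma sum_rises (hf : UnitSteps f) (g : ℕ → ℝ) :
    ∑ i with f i < f (i + 1), g (f i) = ∑ i with f (i + 1) < f i, g (f i - 1) := by
  rw [Finset.sum_filter, Finset.sum_filter, ← sub_eq_zero, ← Finset.sum_sub_distrib]
  have h : ∀ i, ((if f i < f (i + 1) then g (f i) else 0)
      - if f (i + 1) < f i then g (f i - 1) else 0)
      = (fun x => ∑ s ∈ range x, g s) (f (i + 1)) - (fun x => ∑ s ∈ range x, g s) (f i) := by
    intro i
    have h1 := hf i
    rcases lt_trichotomy (f i) (f (i + 1)) with h | h | h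
    · have e : f (i + 1) = f i + 1 := by omega
      simp [e, Finset.sum_range_succ]
    · simp [h]
    · have e : f i = f (i + 1) + 1 := by omega
      simp [e, Finset.sum_range_succ]
  rw [Finset.sum_congr rfl (fun i _ => h i), Finset.sum_sub_distrib,
    sum_shift (fun i => (fun x => ∑ s ∈ range x, g s) (f i)), sub_self]

lemma sum_plateaus (hf : UnitSteps f) (g : ℕ → ℝ) (hg : ∀ i, 0 ≤ g (f i)) :
    ∑ i ∈ starts f, (plat f i : ℝ) * g (f i) ≤ ∑ i with f (i + 1) = f i, g (f i) := by
  have h1 : ∑ i ∈ starts f, (plat f i : ℝ) * g (f i)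
      = ∑ i ∈ starts f with plat f i = 1, g (f (i - 1)) := by
    rw [Finset.sum_filter]
    refine Finset.sum_congr rfl (fun i hi => ?_)
    have h2 := plat_start hi
    have h3 := (mem_starts.1 hi).2
    have h4 := hf (i - 1)
    split_ifs at h2 with h5
    · simp [h2]
    · have : f (i - 1) = f i := by omega
      simp [h2, this]
  rw [h1]
  have h2 : ∑ i ∈ starts f with plat f i = 1, g (f (i - 1))
      = ∑ j ∈ (({i ∈ starts f | plat f i = 1} : Finset (ZMod L)).image (fun i => i - 1)),
        g (f j) := by
    rw [Finset.sum_image]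
    intro a _ b _ hab
    simpa using hab
  rw [h2]
  refine Finset.sum_le_sum_of_subset_of_nonneg ?_ (fun i _ _ => hg i)
  intro j hj
  obtain ⟨i, hi, rfl⟩ := Finset.mem_image.1 hj
  obtain ⟨hi, hp⟩ := Finset.mem_filter.1 hi
  have h2 := plat_start hi
  have h3 := (mem_starts.1 hi).2
  rw [hp] at h2
  split_ifs at h2 with h5
  simp only [Finset.mem_filter, Finset.mem_univ, true_and, sub_add_cancel]
  omega

lemma sum_by_steps (φ : ZMod L → ℝ) :
    ∑ i, φ i = ∑ i with f (i + 1) < f i, φ i + ∑ i with f i < f (i + 1), φ i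
      + ∑ i with f (i + 1) = f i, φ i := by
  rw [Finset.sum_filter, Finset.sum_filter, Finset.sum_filter, ← Finset.sum_add_distrib,
    ← Finset.sum_add_distrib]
  refine Finset.sum_congr rfl (fun i _ => ?_)
  rcases lt_trichotomy (f i) (f (i + 1)) with h | h | h
  · simp [h, h.ne', h.not_gt]
  · simp [h]
  · simp [h, h.ne, h.not_gt]

/-- Distribution of a sum over the maximal runs of drops, each of them together with the rises
that undo it and, if present, the plateau in front of it. -/
lemma sum_runs_le (hf : UnitSteps f) (gD gM gP : ℕ → ℝ) (hP : ∀ i, 0 ≤ gP (f i)) :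
    ∑ i ∈ starts f, (∑ t ∈ range (height f i), (gD (f i - t) + gM (f i - t - 1))
        + (plat f i : ℝ) * gP (f i))
      ≤ ∑ i with f (i + 1) < f i, gD (f i) + ∑ i with f i < f (i + 1), gM (f i)
        + ∑ i with f (i + 1) = f i, gP (f i) := by
  rw [Finset.sum_add_distrib, sum_rises hf]
  refine add_le_add (le_of_eq ?_) (sum_plateaus hf gP hP)
  rw [← Finset.sum_add_distrib, sum_drops f]
  refine Finset.sum_congr rfl (fun i _ => Finset.sum_congr rfl (fun t ht => ?_))
  have h1 := apply_add_of_le_height hf (Finset.mem_range.1 ht).le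
  have : f (i + t) = f i - t := by omega
  rw [this]

end Runs

end CyclicWalk

namespace CyclicWalk

open Finset

section Losses

variable {L : ℕ} [NeZero L] {f : ZMod L → ℕ}

variable (f) in
/-- The number of points below level `s`. -/
noncomputable def below (s : ℕ) : ℝ := #{i | f i < s}

lemma below_nonneg (s : ℕ) : 0 ≤ below f s := Nat.cast_nonneg _

lemma below_eq_sum (s : ℕ) : below f s = ∑ i, if f i < s then (1 : ℝ) else 0 := by
  simp [below]

lemma sub_below_eq_sum (s : ℕ) : (L : ℝ) - below f s = ∑ i, if s ≤ f i then (1 : ℝ) else 0 := by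
  have h : ∑ i : ZMod L, (1 : ℝ) = L := by simp
  rw [below_eq_sum, ← h, ← Finset.sum_sub_distrib]
  refine Finset.sum_congr rfl (fun i _ => ?_)
  by_cases hi : f i < s
  · simp [hi]
  · simp [hi, not_lt.1 hi]

lemma weight_sub_nat (i : ZMod L) {e : ℕ} (h1 : 1 ≤ e) (h2 : e < L) :
    weight i (i - e) = e := by
  have hv : (e : ZMod L).val = e := ZMod.val_natCast_of_lt h2
  have h0 : (e : ZMod L) ≠ 0 := by
    intro h
    rw [h, ZMod.val_zero] at hv
    omega
  have hne : i ≠ i - e := by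
    intro h
    exact h0 (sub_eq_self.1 h.symm)
  have : NeZero (e : ZMod L) := ⟨h0⟩
  have e1 : i - e - i = -(e : ZMod L) := by ring
  rw [weight_of_ne hne, e1, ZMod.val_neg_of_ne_zero, hv, Nat.cast_sub h2.le]
  ring

/-- Passing from drops to rises in a weighted sum. -/
lemma sum_drops_weight (hL : 2 ≤ L) (hf : UnitSteps f) (a : ℕ → ZMod L → ℝ)
    (ha : ∀ s j, f j < s → a s j = 0) {K : ℕ} (hK : ∀ i, f i + 1 < K) :
    ∑ i with f (i + 1) < f i, ∑ j, weight i j * a (f i) j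
      + ∑ s ∈ range K, below f s * ∑ j, a s j
      = ∑ i with f i < f (i + 1), ∑ j, weight i j * a (f i + 1) j := by
  set χ : ℕ → ZMod L → ℝ := fun s i => if s ≤ f i then 1 else 0 with hχ
  set W : ℕ → ZMod L → ℝ := fun s i => ∑ j, weight i j * a s j with hW
  have h1 : ∀ s, ∑ i, W s i * (χ s (i + 1) - χ s i) = below f s * ∑ j, a s j := by
    intro s
    rw [sum_weight_indicator hL (a s) (χ s), ← sub_below_eq_sum, sub_sub_cancel]
    intro j
    by_cases hj : s ≤ f j
    · simp [hχ, hj]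
    · simp [ha s j (not_le.1 hj)]
  have h2 : ∑ s ∈ range K, ∑ i, W s i * (χ s (i + 1) - χ s i)
      = ∑ i, ((if f i < f (i + 1) then W (f i + 1) i else 0)
        - if f (i + 1) < f i then W (f i) i else 0) := by
    rw [Finset.sum_comm]
    refine Finset.sum_congr rfl (fun i _ => ?_)
    have hi := hf i
    have key : ∀ s, W s i * (χ s (i + 1) - χ s i)
        = (if s = f i + 1 then (if f i < f (i + 1) then W s i else 0) else 0)
          - (if s = f i then (if f (i + 1) < f i then W s i else 0) else 0) := by
      intro s
      simp only [hχ]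
      split_ifs <;> first | omega | simp
    rw [Finset.sum_congr rfl (fun s _ => key s), Finset.sum_sub_distrib, Finset.sum_ite_eq',
      Finset.sum_ite_eq', if_pos (Finset.mem_range.2 (hK i)),
      if_pos (Finset.mem_range.2 (by have := hK i; omega))]
  rw [Finset.sum_congr rfl (fun s _ => h1 s), Finset.sum_sub_distrib, ← Finset.sum_filter,
    ← Finset.sum_filter] at h2
  linarith

variable (f) in
/-- Bounds for the change `ℓ i j` of a distance that is caused by replacing the step at `i` by a
jump from `i` to `j`. -/
structure IsLossBound (ℓ : ZMod L → ZMod L → ℝ) : Prop where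
  nonpos : ∀ i j, f i ≤ f (i + 1) → ℓ i j ≤ 0
  jump : ∀ i j, f i ≤ f (i + 1) → ℓ i j ≤ 1 + f j - f i
  le_cap : ∀ i j, f (i + 1) < f i → ℓ i j ≤ cap f i
  in_run : ∀ i, f (i + 1) < f i → ∀ e : ℕ, 1 ≤ e → e ≤ depth f i → ℓ i (i - e) ≤ cap f i - e + 1
  jump_drop : ∀ i j, f (i + 1) < f i → (∀ e : ℕ, 1 ≤ e → e ≤ depth f i → j ≠ i - e) →
    ℓ i j ≤ 1 + f j - f i

lemma two_mul_depth_le_cap (i : ZMod L) : 2 * depth f i ≤ cap f i := by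
  unfold cap; omega

lemma IsLossBound.le {ℓ : ZMod L → ZMod L → ℝ} (hf : UnitSteps f) (hℓ : IsLossBound f ℓ)
    (i j : ZMod L) :
    ℓ i j ≤ (if f (i + 1) < f i then ((f j + 1 - f i : ℕ) : ℝ) else 0) - ((f i - f j - 1 : ℕ) : ℝ)
      + (if f (i + 1) < f i then ∑ e ∈ range (depth f i),
          (if j = i - ((e + 1 : ℕ) : ZMod L) then (cap f i : ℝ) - 2 * ((e + 1 : ℕ) : ℝ) else 0)
        else 0) := by
  by_cases hd : f (i + 1) < f i
  · rw [if_pos hd, if_pos hd]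
    have hnn : ∀ e ∈ range (depth f i), (0 : ℝ) ≤
        (if j = i - ((e + 1 : ℕ) : ZMod L) then (cap f i : ℝ) - 2 * ((e + 1 : ℕ) : ℝ) else 0) := by
      intro e he
      split_ifs
      · have := two_mul_depth_le_cap (f := f) i
        have h2 : 2 * (e + 1) ≤ cap f i := by have := Finset.mem_range.1 he; omega
        have : (2 * ((e + 1 : ℕ) : ℝ)) ≤ cap f i := by exact_mod_cast h2
        linarith
      · exact le_rfl
    by_cases hr : ∃ e : ℕ, 1 ≤ e ∧ e ≤ depth f i ∧ j = i - e
    · obtain ⟨e, h1, h2, rfl⟩ := hr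
      have h3 := hℓ.in_run i hd e h1 h2
      have h4 := apply_sub_of_le_depth hf h2
      obtain ⟨e, rfl⟩ : ∃ k, e = k + 1 := ⟨e - 1, by omega⟩
      have h5 := Finset.single_le_sum hnn (Finset.mem_range.2 (by omega : e < depth f i))
      rw [if_pos rfl] at h5
      rw [h4]
      have e1 : f i + (e + 1) + 1 - f i = e + 2 := by omega
      have e2 : f i - (f i + (e + 1)) - 1 = 0 := by omega
      rw [e1, e2]
      push_cast at h3 h5 ⊢
      linarith
    · push Not at hr
      have h3 := hℓ.jump_drop i j hd hr
      have h5 := Finset.sum_nonneg hnn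
      have e1 : (1 : ℝ) + f j - f i = ((f j + 1 - f i : ℕ) : ℝ) - ((f i - f j - 1 : ℕ) : ℝ) := by
        rcases le_total (f i) (f j + 1) with h | h
        · rw [Nat.cast_sub h, (by omega : f i - f j - 1 = 0)]
          push_cast; ring
        · rw [(by omega : f j + 1 - f i = 0), Nat.sub_sub, Nat.cast_sub h]
          push_cast; ring
      linarith
  · rw [if_neg hd, if_neg hd]
    have h1 := hℓ.nonpos i j (not_lt.1 hd)
    have h2 := hℓ.jump i j (not_lt.1 hd)
    rcases le_total (f i) (f j + 1) with h | h
    · rw [(by omega : f i - f j - 1 = 0)]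
      simpa using h1
    · rw [Nat.sub_sub, Nat.cast_sub h]
      push_cast
      linarith

lemma sum_range_sub_two_mul (c : ℝ) (n : ℕ) :
    ∑ t ∈ range n, (c - 2 * t) = n * c - n * (n - 1) := by
  induction n with
  | zero => simp
  | succ n ih => rw [Finset.sum_range_succ, ih]; push_cast; ring

lemma sum_excess_le (t : ℕ) (p : ℝ) :
    ∑ e ∈ range t, ((e + 1 : ℕ) : ℝ) * (2 * t + p - 2 * ((e + 1 : ℕ) : ℝ))
      ≤ ∑ r ∈ range t, ((r : ℝ) + 1) * (r + 1 + p) := by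
  have h1 : ∀ (n : ℕ) (c : ℝ), ∑ e ∈ range n, ((e + 1 : ℕ) : ℝ) * (c - 2 * ((e + 1 : ℕ) : ℝ))
      = c * (n * (n + 1) / 2) - n * (n + 1) * (2 * n + 1) / 3 := by
    intro n c
    induction n with
    | zero => simp
    | succ n ih => rw [Finset.sum_range_succ, ih]; push_cast; ring
  have h2 : ∀ n : ℕ, ∑ r ∈ range n, ((r : ℝ) + 1) * (r + 1 + p)
      = n * (n + 1) * (2 * n + 1) / 6 + p * (n * (n + 1) / 2) := by
    intro n
    induction n with
    | zero => simp
    | succ n ih => rw [Finset.sum_range_succ, ih]; push_cast; ring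
  rw [h1, h2]
  have : (0 : ℝ) ≤ t * (t + 1) := by positivity
  nlinarith

lemma sum_range_sum_range (g : ℕ → ℝ) (h : ℕ) :
    ∑ t ∈ range h, ∑ r ∈ range t, g r = ∑ t ∈ range h, ((h : ℝ) - 1 - t) * g t := by
  induction h with
  | zero => simp
  | succ h ih =>
    rw [Finset.sum_range_succ, ih, Finset.sum_range_succ, ← Finset.sum_add_distrib]
    push_cast
    have : ((h : ℝ) + 1 - 1 - h) * g h = 0 := by ring
    rw [this, add_zero]
    exact Finset.sum_congr rfl (fun t _ => by ring)

lemma le_below_of_start (hf : UnitSteps f) {i : ZMod L} (hi : i ∈ starts f) {t : ℕ}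
    (ht : t < height f i) : 2 * ((height f i : ℝ) - 1 - t) ≤ below f (f i - t) := by
  set s := f i - t with hs
  have h := sum_runs_le hf (fun k => if k < s then (1 : ℝ) else 0)
    (fun k => if k < s then (1 : ℝ) else 0) (fun k => if k < s then (1 : ℝ) else 0)
    (fun i => by split_ifs <;> norm_num)
  rw [← sum_by_steps (f := f) (fun i => if f i < s then (1 : ℝ) else 0), ← below_eq_sum] at h
  refine le_trans ?_ (le_trans (Finset.single_le_sum ?_ hi) h)
  · have h1 : ∑ r ∈ range (height f i), (if t < r then (2 : ℝ) else 0)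
        ≤ ∑ r ∈ range (height f i), ((if f i - r < s then (1 : ℝ) else 0)
          + if f i - r - 1 < s then (1 : ℝ) else 0) := by
      refine Finset.sum_le_sum (fun r hr => ?_)
      have hr' := Finset.mem_range.1 hr
      have h2 := height_le hf i
      by_cases htr : t < r
      · rw [if_pos htr, if_pos (by omega), if_pos (by omega)]; norm_num
      · rw [if_neg htr]
        split_ifs <;> norm_num
    have h3 : ∑ r ∈ range (height f i), (if t < r then (2 : ℝ) else 0)
        = 2 * ((height f i : ℝ) - 1 - t) := by
      rw [← Finset.sum_filter, Finset.sum_const]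
      have : #{r ∈ range (height f i) | t < r} = height f i - (t + 1) := by
        have : ({r ∈ range (height f i) | t < r} : Finset ℕ) = Ico (t + 1) (height f i) := by
          ext r; simp; omega
        rw [this, Nat.card_Ico]
      rw [this, nsmul_eq_mul, Nat.cast_sub (by omega)]
      push_cast; ring
    have h4 : (0 : ℝ) ≤ (plat f i : ℝ) * (if f i < s then (1 : ℝ) else 0) := by
      split_ifs <;> simp
    linarith
  · intro j _
    refine add_nonneg (Finset.sum_nonneg (fun r _ => ?_)) ?_
    · split_ifs <;> norm_num
    · split_ifs <;> simp

lemma sum_drops_level_le (hf : UnitSteps f) (s : ℕ) :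
    ∑ i with f (i + 1) < f i, (if f i = s then
        ((depth f i : ℝ) + 1) * (depth f i + 1 + plat f i) else 0)
      ≤ ∑ j, ((f j + 1 - s : ℕ) : ℝ) := by
  have h := sum_runs_le hf (fun k => ((k + 1 - s : ℕ) : ℝ))
    (fun k => ((k + 1 - s : ℕ) : ℝ)) (fun k => ((k + 1 - s : ℕ) : ℝ))
    (fun i => Nat.cast_nonneg _)
  rw [← sum_by_steps (f := f) (fun i => ((f i + 1 - s : ℕ) : ℝ))] at h
  refine le_trans ?_ h
  rw [sum_drops f]
  refine Finset.sum_le_sum (fun i hi => ?_)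
  have hle := height_le hf i
  have e1 : ∑ t ∈ range (height f i), (if f (i + t) = s then
        ((depth f (i + t) : ℝ) + 1) * (depth f (i + t) + 1 + plat f (i + t)) else 0)
      = ∑ t ∈ range (height f i), (if f i - t = s then
        ((t : ℝ) + 1) * (t + 1 + plat f i) else 0) := by
    refine Finset.sum_congr rfl (fun t ht => ?_)
    have ht' := Finset.mem_range.1 ht
    have h1 := apply_add_of_le_height hf ht'.le
    rw [depth_of_mem_starts hi ht', plat_of_mem_starts hi ht', (by omega : f (i + t) = f i - t)]
  rw [e1]
  by_cases hs : ∃ t < height f i, f i - t = s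
  · obtain ⟨t, ht, rfl⟩ := hs
    have e2 : ∑ r ∈ range (height f i), (if f i - r = f i - t then
        ((r : ℝ) + 1) * (r + 1 + plat f i) else 0) = ((t : ℝ) + 1) * (t + 1 + plat f i) := by
      rw [Finset.sum_eq_single t]
      · simp
      · intro r hr hrt
        have := Finset.mem_range.1 hr
        rw [if_neg (by omega)]
      · intro hn
        exact absurd (Finset.mem_range.2 ht) hn
    rw [e2]
    have e3 : ((t : ℝ) + 1) * (t + 1)
        ≤ ∑ r ∈ range (height f i), (((f i - r + 1 - (f i - t) : ℕ) : ℝ)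
          + ((f i - r - 1 + 1 - (f i - t) : ℕ) : ℝ)) := by
      have h1 : ∑ r ∈ range (t + 1), ((2 * t + 1 : ℝ) - 2 * r)
          ≤ ∑ r ∈ range (t + 1), (((f i - r + 1 - (f i - t) : ℕ) : ℝ)
          + ((f i - r - 1 + 1 - (f i - t) : ℕ) : ℝ)) := by
        refine Finset.sum_le_sum (fun r hr => le_of_eq ?_)
        have := Finset.mem_range.1 hr
        rw [(by omega : f i - r + 1 - (f i - t) = t - r + 1),
          (by omega : f i - r - 1 + 1 - (f i - t) = t - r)]
        push_cast [Nat.cast_sub (by omega : r ≤ t)]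
        ring
      have h2 : ∑ r ∈ range (t + 1), (((f i - r + 1 - (f i - t) : ℕ) : ℝ)
          + ((f i - r - 1 + 1 - (f i - t) : ℕ) : ℝ))
          ≤ ∑ r ∈ range (height f i), (((f i - r + 1 - (f i - t) : ℕ) : ℝ)
          + ((f i - r - 1 + 1 - (f i - t) : ℕ) : ℝ)) :=
        Finset.sum_le_sum_of_subset_of_nonneg
          (fun r hr => Finset.mem_range.2 (by have := Finset.mem_range.1 hr; omega))
          (fun _ _ _ => by positivity)
      rw [sum_range_sub_two_mul] at h1
      push_cast at h1
      linarith
    have e4 : (f i + 1 - (f i - t) : ℕ) = t + 1 := by omega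
    rw [e4]
    push_cast
    nlinarith
  · rw [Finset.sum_eq_zero]
    · positivity
    · intro t ht
      rw [if_neg (fun he => hs ⟨t, Finset.mem_range.1 ht, he⟩)]

lemma sum_excess_le_slack (hf : UnitSteps f) {K : ℕ} (hK : ∀ i, f i + 1 < K) :
    2 * ∑ i with f (i + 1) < f i, ∑ e ∈ range (depth f i),
        ((e + 1 : ℕ) : ℝ) * ((cap f i : ℝ) - 2 * ((e + 1 : ℕ) : ℝ))
      ≤ ∑ s ∈ range K, below f s * ∑ j, ((f j + 1 - s : ℕ) : ℝ) := by
  have h1 : 2 * ∑ i with f (i + 1) < f i, ∑ e ∈ range (depth f i),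
        ((e + 1 : ℕ) : ℝ) * ((cap f i : ℝ) - 2 * ((e + 1 : ℕ) : ℝ))
      ≤ ∑ i with f (i + 1) < f i, below f (f i)
        * (((depth f i : ℝ) + 1) * (depth f i + 1 + plat f i)) := by
    rw [sum_drops f, sum_drops f, Finset.mul_sum]
    refine Finset.sum_le_sum (fun i hi => ?_)
    have e1 : ∑ t ∈ range (height f i), ∑ e ∈ range (depth f (i + t)),
          ((e + 1 : ℕ) : ℝ) * ((cap f (i + t) : ℝ) - 2 * ((e + 1 : ℕ) : ℝ))
        ≤ ∑ t ∈ range (height f i), ∑ r ∈ range t, ((r : ℝ) + 1) * (r + 1 + plat f i) := by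
      refine Finset.sum_le_sum (fun t ht => ?_)
      have ht' := Finset.mem_range.1 ht
      unfold cap
      rw [depth_of_mem_starts hi ht', plat_of_mem_starts hi ht']
      push_cast
      have := sum_excess_le t (plat f i)
      push_cast at this
      exact this
    rw [sum_range_sum_range] at e1
    refine (mul_le_mul_of_nonneg_left e1 (by norm_num)).trans ?_
    rw [Finset.mul_sum]
    refine Finset.sum_le_sum (fun t ht => ?_)
    have ht' := Finset.mem_range.1 ht
    have h2 := le_below_of_start hf hi ht'
    have h3 := apply_add_of_le_height hf ht'.le
    rw [depth_of_mem_starts hi ht', plat_of_mem_starts hi ht', (by omega : f (i + t) = f i - t),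
      ← mul_assoc]
    exact mul_le_mul_of_nonneg_right h2 (by positivity)
  refine h1.trans ?_
  have h2 : ∑ i with f (i + 1) < f i, below f (f i)
        * (((depth f i : ℝ) + 1) * (depth f i + 1 + plat f i))
      = ∑ s ∈ range K, below f s * ∑ i with f (i + 1) < f i, (if f i = s then
        ((depth f i : ℝ) + 1) * (depth f i + 1 + plat f i) else 0) := by
    simp only [Finset.mul_sum]
    rw [Finset.sum_comm]
    refine Finset.sum_congr rfl (fun i _ => ?_)
    simp only [mul_ite, mul_zero]
    rw [Finset.sum_ite_eq, if_pos (Finset.mem_range.2 (by have := hK i; omega))]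
  rw [h2]
  exact Finset.sum_le_sum (fun s _ => mul_le_mul_of_nonneg_left (sum_drops_level_le hf s)
    (below_nonneg s))

end Losses

end CyclicWalk

namespace CyclicWalk

open Finset

section Far

variable {L : ℕ} [NeZero L] {f : ZMod L → ℕ}

lemma sum_sum_weight : ∑ i : ZMod L, ∑ j, weight i j = (L : ℝ) * ((L : ℝ) * (L - 1) / 2) := by
  simp [sum_weight]

variable (f) in
lemma sum_weight_sub_comm :
    ∑ i, ∑ j, weight i j * ((f i - f j : ℕ) : ℝ) = ∑ i, ∑ j, weight i j * ((f j - f i : ℕ) : ℝ) := by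
  have h0 : ∀ i j, weight i j * ((f i - f j : ℕ) : ℝ) - weight i j * ((f j - f i : ℕ) : ℝ)
      = weight i j * f i - weight i j * f j := by
    intro i j
    rcases le_total (f i) (f j) with h | h
    · rw [Nat.sub_eq_zero_of_le h, Nat.cast_sub h]; push_cast; ring
    · rw [Nat.sub_eq_zero_of_le h, Nat.cast_sub h]; push_cast; ring
  have h1 : ∑ i, ∑ j, weight i j * (f i : ℝ) = ∑ i, ∑ j, weight i j * (f j : ℝ) := by
    rw [Finset.sum_comm (f := fun i j => weight i j * (f j : ℝ))]
    refine Finset.sum_congr rfl (fun i _ => ?_)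
    rw [← Finset.sum_mul, ← Finset.sum_mul, sum_weight]
    have h2 : ∑ j, weight j i = (L : ℝ) * (L - 1) / 2 := by
      have e : ∑ j, (weight i j + weight j i) = (L : ℝ) * (L - 1) := by
        simp only [weight_add_weight]
        have e : ∀ j, (if i = j then (0 : ℝ) else L) = L - (if i = j then (L : ℝ) else 0) := by
          intro j; split_ifs <;> simp
        rw [Finset.sum_congr rfl (fun j _ => e j), Finset.sum_sub_distrib]
        simp
        ring
      rw [Finset.sum_add_distrib, sum_weight] at e
      linarith
    rw [h2]
  rw [← sub_eq_zero, ← Finset.sum_sub_distrib]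
  simp only [← Finset.sum_sub_distrib, h0]
  simp only [Finset.sum_sub_distrib]
  linarith

lemma sum_sum_sub {K : ℕ} (hK : ∀ i, f i + 1 < K) :
    ∑ i, ∑ j, ((f i - f j : ℕ) : ℝ) = ∑ s ∈ range K, below f s * ((L : ℝ) - below f s) := by
  have h1 : ∀ i j, ((f i - f j : ℕ) : ℝ)
      = ∑ s ∈ range K, (if f j < s then (1 : ℝ) else 0) * (if s ≤ f i then 1 else 0) := by
    intro i j
    have : ∀ s, (if f j < s then (1 : ℝ) else 0) * (if s ≤ f i then 1 else 0)
        = if f j < s ∧ s ≤ f i then 1 else 0 := by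
      intro s
      by_cases h1 : f j < s <;> by_cases h2 : s ≤ f i <;> simp [h1, h2]
    rw [Finset.sum_congr rfl (fun s _ => this s), Finset.sum_boole]
    have : ({s ∈ range K | f j < s ∧ s ≤ f i} : Finset ℕ) = Ioc (f j) (f i) := by
      ext s
      have := hK i
      simp
      omega
    rw [this, Nat.card_Ioc]
  have h2 : ∀ i j, ((f i - f j : ℕ) : ℝ)
      = ∑ s ∈ range K, (if f j < s then (1 : ℝ) else 0) * (if s ≤ f i then 1 else 0) := h1
  calc ∑ i, ∑ j, ((f i - f j : ℕ) : ℝ)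
      = ∑ i, ∑ s ∈ range K, ∑ j, (if f j < s then (1 : ℝ) else 0) * (if s ≤ f i then 1 else 0) := by
        refine Finset.sum_congr rfl (fun i _ => ?_)
        rw [Finset.sum_comm]
        exact Finset.sum_congr rfl (fun j _ => h1 i j)
    _ = ∑ s ∈ range K, ∑ i, below f s * (if s ≤ f i then 1 else 0) := by
        rw [Finset.sum_comm]
        refine Finset.sum_congr rfl (fun s _ => Finset.sum_congr rfl (fun i _ => ?_))
        rw [← Finset.sum_mul, ← below_eq_sum]
    _ = _ := by
        refine Finset.sum_congr rfl (fun s _ => ?_)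
        rw [← Finset.mul_sum, ← sub_below_eq_sum]

lemma two_mul_sum_weight_sub {K : ℕ} (hK : ∀ i, f i + 1 < K) :
    2 * ∑ i, ∑ j, weight i j * ((f j - f i : ℕ) : ℝ)
      = L * ∑ s ∈ range K, below f s * ((L : ℝ) - below f s) := by
  have h1 : ∑ i, ∑ j, weight i j * ((f j - f i : ℕ) : ℝ)
      = ∑ i, ∑ j, weight j i * ((f i - f j : ℕ) : ℝ) := Finset.sum_comm
  have h2 := sum_weight_sub_comm f
  have h3 : ∑ i, ∑ j, (weight i j + weight j i) * ((f i - f j : ℕ) : ℝ)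
      = L * ∑ i, ∑ j, ((f i - f j : ℕ) : ℝ) := by
    simp only [Finset.mul_sum]
    refine Finset.sum_congr rfl (fun i _ => Finset.sum_congr rfl (fun j _ => ?_))
    rw [weight_add_weight]
    by_cases h : i = j
    · simp [h]
    · rw [if_neg h]
  simp only [add_mul, Finset.sum_add_distrib] at h3
  rw [← sum_sum_sub hK, ← h3]
  linarith

variable (f) in
/-- The weight of the pairs along which `f` decreases. -/
noncomputable def descent : ℝ := ∑ i, ∑ j, weight i j * (if f j < f i then 1 else 0)

variable (f) in
/-- The weight of the pairs that start with a rise and stay at the same level. -/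
noncomputable def ties : ℝ :=
  ∑ i with f i < f (i + 1), ∑ j, weight i j * (if f j = f i then 1 else 0)

lemma sum_le_of_filter {g : ZMod L → ℝ} (hg : ∀ i, 0 ≤ g i) :
    ∑ i with f (i + 1) < f i, g i + ∑ i with f i < f (i + 1), g i ≤ ∑ i, g i := by
  rw [sum_by_steps (f := f) g]
  have := Finset.sum_nonneg (fun i (_ : i ∈ ({i | f (i + 1) = f i} : Finset (ZMod L))) => hg i)
  linarith

lemma four_mul_sum_weight_loss_le (hL : 2 ≤ L) (hf : UnitSteps f) {ℓ : ZMod L → ZMod L → ℝ}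
    (hℓ : IsLossBound f ℓ) {K : ℕ} (hK : ∀ i, f i + 1 < K) :
    4 * ∑ i, ∑ j, weight i j * ℓ i j
      ≤ -(L * ∑ s ∈ range K, below f s * ((L : ℝ) - below f s)) + 3 * descent f
        + (L : ℝ) ^ 2 * (L - 1) / 2 - ties f := by
  set T := ∑ i, ∑ j, weight i j * ((f j - f i : ℕ) : ℝ) with hT
  set slack := ∑ s ∈ range K, below f s * ∑ j, ((f j + 1 - s : ℕ) : ℝ) with hslack
  set Q := ∑ i with f (i + 1) < f i, ∑ j, weight i j * ((f j + 1 - f i : ℕ) : ℝ) with hQ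
  set Exc := ∑ i with f (i + 1) < f i, ∑ e ∈ range (depth f i),
        ((e + 1 : ℕ) : ℝ) * ((cap f i : ℝ) - 2 * ((e + 1 : ℕ) : ℝ)) with hExc
  have h2T := two_mul_sum_weight_sub hK
  rw [← hT] at h2T
  have hexc := sum_excess_le_slack hf hK
  rw [← hExc, ← hslack] at hexc
  have hmain : ∑ i, ∑ j, weight i j * ℓ i j ≤ Q - (T - descent f) + Exc := by
    have e1 : ∑ i, ∑ j, weight i j * ℓ i j
        ≤ ∑ i, ∑ j, (weight i j * (if f (i + 1) < f i then ((f j + 1 - f i : ℕ) : ℝ) else 0)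
          - weight i j * ((f i - f j - 1 : ℕ) : ℝ)
          + weight i j * (if f (i + 1) < f i then ∑ e ∈ range (depth f i),
          (if j = i - ((e + 1 : ℕ) : ZMod L) then (cap f i : ℝ) - 2 * ((e + 1 : ℕ) : ℝ) else 0)
        else 0)) := by
      refine Finset.sum_le_sum (fun i _ => Finset.sum_le_sum (fun j _ => ?_))
      have := mul_le_mul_of_nonneg_left (hℓ.le hf i j) (weight_nonneg i j)
      linarith
    refine e1.trans (le_of_eq ?_)
    simp only [Finset.sum_add_distrib, Finset.sum_sub_distrib]
    congr 1
    · congr 1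
      · rw [hQ, Finset.sum_filter]
        refine Finset.sum_congr rfl (fun i _ => ?_)
        split_ifs <;> simp
      · rw [hT, ← sum_weight_sub_comm, descent, ← Finset.sum_sub_distrib]
        refine Finset.sum_congr rfl (fun i _ => ?_)
        rw [← Finset.sum_sub_distrib]
        refine Finset.sum_congr rfl (fun j _ => ?_)
        rw [← mul_sub]
        congr 1
        split_ifs with h
        · rw [Nat.cast_sub (by omega)]; push_cast; ring
        · rw [(by omega : f i - f j - 1 = 0), (by omega : f i - f j = 0)]; simp
    · rw [hExc, Finset.sum_filter]
      refine Finset.sum_congr rfl (fun i _ => ?_)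
      split_ifs with hd
      · simp only [Finset.mul_sum]
        rw [Finset.sum_comm]
        refine Finset.sum_congr rfl (fun e he => ?_)
        have := depth_lt hf i
        have he' := Finset.mem_range.1 he
        simp only [mul_ite, mul_zero]
        rw [Finset.sum_ite_eq', if_pos (Finset.mem_univ _), weight_sub_nat i (by omega) (by omega)]
      · simp
  have hQ1 : Q + slack = ∑ i with f i < f (i + 1), ∑ j, weight i j * ((f j - f i : ℕ) : ℝ) := by
    have := sum_drops_weight hL hf (fun s j => ((f j + 1 - s : ℕ) : ℝ))
      (fun s j h => by simp; omega) hK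
    rw [hQ, hslack, this]
    refine Finset.sum_congr rfl (fun i _ => Finset.sum_congr rfl (fun j _ => ?_))
    rw [Nat.add_sub_add_right]
  set CD := ∑ i with f (i + 1) < f i, ∑ j, weight i j * (if f i ≤ f j then (1 : ℝ) else 0) with hCD
  have hQ2 : Q = CD + ∑ i with f (i + 1) < f i, ∑ j, weight i j * ((f j - f i : ℕ) : ℝ) := by
    rw [hQ, hCD, ← Finset.sum_add_distrib]
    refine Finset.sum_congr rfl (fun i _ => ?_)
    rw [← Finset.sum_add_distrib]
    refine Finset.sum_congr rfl (fun j _ => ?_)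
    rw [← mul_add]
    congr 1
    split_ifs with h
    · rw [Nat.cast_sub (by omega), Nat.cast_sub h]; push_cast; ring
    · rw [(by omega : f j + 1 - f i = 0), (by omega : f j - f i = 0)]; simp
  have hnn : ∀ i, 0 ≤ ∑ j, weight i j * ((f j - f i : ℕ) : ℝ) := fun i =>
    Finset.sum_nonneg (fun j _ => mul_nonneg (weight_nonneg i j) (Nat.cast_nonneg _))
  have hT2 := sum_le_of_filter (f := f) hnn
  rw [← hT] at hT2
  have hCD1 : CD ≤ ∑ i with f i < f (i + 1), ∑ j, weight i j * (if f i < f j then (1 : ℝ) else 0) := by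
    have := sum_drops_weight hL hf (fun s j => if s ≤ f j then (1 : ℝ) else 0)
      (fun s j h => by simp; omega) hK
    have h0 : 0 ≤ ∑ s ∈ range K, below f s * ∑ j, (if s ≤ f j then (1 : ℝ) else 0) := by
      refine Finset.sum_nonneg (fun s _ => mul_nonneg (below_nonneg s) (Finset.sum_nonneg ?_))
      intro j _
      split_ifs <;> norm_num
    have e : ∀ i j, (if f i + 1 ≤ f j then (1 : ℝ) else 0) = if f i < f j then 1 else 0 := by
      intro i j; rfl
    simp only [e] at this
    rw [← hCD] at this
    linarith
  have hCD2 : CD + (∑ i with f i < f (i + 1), ∑ j, weight i j * (if f i < f j then (1 : ℝ) else 0)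
      + ties f) + descent f ≤ (L : ℝ) * ((L : ℝ) * (L - 1) / 2) := by
    have h1 : ∑ i with f i < f (i + 1), ∑ j, weight i j * (if f i < f j then (1 : ℝ) else 0)
        + ties f = ∑ i with f i < f (i + 1), ∑ j, weight i j * (if f i ≤ f j then (1 : ℝ) else 0) := by
      rw [ties, ← Finset.sum_add_distrib]
      refine Finset.sum_congr rfl (fun i _ => ?_)
      rw [← Finset.sum_add_distrib]
      refine Finset.sum_congr rfl (fun j _ => ?_)
      rw [← mul_add]
      congr 1
      split_ifs <;> first | omega | simp
    have hnn : ∀ i, 0 ≤ ∑ j, weight i j * (if f i ≤ f j then (1 : ℝ) else 0) := fun i =>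
      Finset.sum_nonneg (fun j _ => mul_nonneg (weight_nonneg i j) (by split_ifs <;> norm_num))
    have h2 := sum_le_of_filter (f := f) hnn
    have h3 : ∑ i, ∑ j, weight i j * (if f i ≤ f j then (1 : ℝ) else 0) + descent f
        = ∑ i : ZMod L, ∑ j, weight i j := by
      rw [descent, ← Finset.sum_add_distrib]
      refine Finset.sum_congr rfl (fun i _ => ?_)
      rw [← Finset.sum_add_distrib]
      refine Finset.sum_congr rfl (fun j _ => ?_)
      rw [← mul_add]
      split_ifs <;> first | omega | simp
    rw [sum_sum_weight] at h3
    rw [h1]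
    linarith
  have : 2 * CD ≤ (L : ℝ) * ((L : ℝ) * (L - 1) / 2) - descent f - ties f := by linarith
  nlinarith

variable (f) in
/-- The number of points at level `t`. -/
noncomputable def level (t : ℕ) : ℝ := #{i | f i = t}

variable (f) in
/-- The number of rises from level `t`. -/
noncomputable def rises (t : ℕ) : ℝ := #{i | f i = t ∧ f i < f (i + 1)}

lemma below_succ (t : ℕ) : below f (t + 1) = below f t + level f t := by
  unfold below level
  rw [← Nat.cast_add, ← Finset.card_union_of_disjoint]
  · congr 2
    ext i
    simp
    omega
  · rw [Finset.disjoint_filter]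
    intro i _ h1 h2
    omega

lemma sum_level (g : ℕ → ℝ) {K : ℕ} (hK : ∀ i, f i + 1 < K) :
    ∑ i, g (f i) = ∑ t ∈ range K, level f t * g t := by
  have h : ∀ t, level f t * g t = ∑ i, if f i = t then g t else 0 := by
    intro t
    rw [← Finset.sum_filter, Finset.sum_const, nsmul_eq_mul, level]
  rw [Finset.sum_congr rfl (fun t _ => h t), Finset.sum_comm]
  refine Finset.sum_congr rfl (fun i _ => ?_)
  rw [Finset.sum_ite_eq, if_pos (Finset.mem_range.2 (by have := hK i; omega))]

lemma sum_rises_level (g : ℕ → ℝ) {K : ℕ} (hK : ∀ i, f i + 1 < K) :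
    ∑ i with f i < f (i + 1), g (f i) = ∑ t ∈ range K, rises f t * g t := by
  have h : ∀ t, rises f t * g t = ∑ i with f i < f (i + 1), if f i = t then g t else 0 := by
    intro t
    rw [← Finset.sum_filter, Finset.sum_const, nsmul_eq_mul, rises, Finset.filter_filter]
    congr 3
    ext i
    simp [and_comm]
  rw [Finset.sum_congr rfl (fun t _ => h t), Finset.sum_comm]
  refine Finset.sum_congr rfl (fun i _ => ?_)
  rw [Finset.sum_ite_eq, if_pos (Finset.mem_range.2 (by have := hK i; omega))]

lemma descent_le {K : ℕ} (hK : ∀ i, f i + 1 < K) :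
    2 * descent f ≤ ∑ t ∈ range K, level f t * (below f t * (2 * L - below f (t + 1))) := by
  have h1 : descent f = ∑ t ∈ range K, ∑ i with f i = t, ∑ j with f j < t, weight i j := by
    have h2 : ∀ i, ∑ j, weight i j * (if f j < f i then (1 : ℝ) else 0)
        = ∑ t ∈ range K, if f i = t then ∑ j with f j < t, weight i j else 0 := by
      intro i
      rw [Finset.sum_ite_eq, if_pos (Finset.mem_range.2 (by have := hK i; omega)),
        Finset.sum_filter]
      simp
    rw [descent, Finset.sum_congr rfl (fun i _ => h2 i), Finset.sum_comm]
    exact Finset.sum_congr rfl (fun t _ => (Finset.sum_filter _ _).symm)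
  rw [h1, Finset.mul_sum]
  refine Finset.sum_le_sum (fun t _ => ?_)
  have h2 := sum_weight_le ({i | f i = t} : Finset (ZMod L)) ({j | f j < t} : Finset (ZMod L))
    (Finset.disjoint_filter.2 (fun i _ h1 h2 => by omega))
  rw [below_succ]
  simp only [level, below]
  linarith

lemma le_ties {K : ℕ} (hK : ∀ i, f i + 1 < K) :
    ∑ t ∈ range K, rises f t * (level f t * (level f t - 1)) ≤ 2 * ties f := by
  have h1 : ties f = ∑ t ∈ range K, ∑ i with f i = t ∧ f i < f (i + 1), ∑ j with f j = t,
      weight i j := by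
    have h2 : ∀ i, ∑ j, weight i j * (if f j = f i then (1 : ℝ) else 0)
        = ∑ t ∈ range K, if f i = t then ∑ j with f j = t, weight i j else 0 := by
      intro i
      rw [Finset.sum_ite_eq, if_pos (Finset.mem_range.2 (by have := hK i; omega)),
        Finset.sum_filter]
      simp
    rw [ties, Finset.sum_congr rfl (fun i _ => h2 i), Finset.sum_comm]
    refine Finset.sum_congr rfl (fun t _ => ?_)
    rw [← Finset.sum_filter, Finset.filter_filter]
    congr 1
    ext i
    simp [and_comm]
  rw [h1, Finset.mul_sum]
  refine Finset.sum_le_sum (fun t _ => ?_)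
  set R := ({i | f i = t ∧ f i < f (i + 1)} : Finset (ZMod L)) with hR
  set E := ({i | f i = t} : Finset (ZMod L)) with hE
  have hsub : R ⊆ E := fun i hi => by
    simp only [hR, hE, Finset.mem_filter, Finset.mem_univ, true_and] at hi ⊢
    exact hi.1
  have h3 : ∑ i ∈ R, ∑ j ∈ E, weight i j
      = ∑ i ∈ R, ∑ j ∈ R, weight i j + ∑ i ∈ R, ∑ j ∈ E \ R, weight i j := by
    rw [← Finset.sum_add_distrib]
    refine Finset.sum_congr rfl (fun i _ => ?_)
    rw [add_comm, Finset.sum_sdiff hsub]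
  have h4 := sum_weight_sub_le R (E \ R) Finset.disjoint_sdiff
  rw [h3, sum_weight_within]
  have h5 : (#(E \ R) : ℝ) = #E - #R := by
    rw [Finset.card_sdiff_of_subset hsub, Nat.cast_sub (Finset.card_le_card hsub)]
  rw [h5] at h4
  have h6 : (#E : ℝ) ≤ L := by
    have := Finset.card_le_univ E
    rw [ZMod.card] at this
    exact_mod_cast this
  have h7 : rises f t = #R := rfl
  have h8 : level f t = #E := rfl
  rw [h7, h8]
  rcases Nat.eq_zero_or_pos #R with h | h
  · simp [h] at h4 ⊢
    linarith
  · have h9 : (1 : ℝ) ≤ #R := by exact_mod_cast h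
    have : 0 ≤ (#R : ℝ) * ((#R - 1) * (L - #E)) :=
      mul_nonneg (by linarith) (mul_nonneg (by linarith) (by linarith))
    nlinarith

end Far

end CyclicWalk

namespace CyclicWalk

open Finset

section Local

variable {L : ℕ} [NeZero L] {f : ZMod L → ℕ}

omit [NeZero L] in
lemma apply_add_le (hf : UnitSteps f) (i : ZMod L) (n : ℕ) : f (i + n) ≤ f i + n := by
  induction n with
  | zero => simp
  | succ n ih =>
    have := (hf (i + n)).1
    have e : i + ((n + 1 : ℕ) : ZMod L) = i + n + 1 := by push_cast; ring
    rw [e]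
    omega

lemma two_mul_depth_le (hf : UnitSteps f) (i : ZMod L) : 2 * depth f i ≤ L := by
  have h1 := apply_sub_of_le_depth hf (le_refl (depth f i))
  have h2 := apply_add_le hf i (L - depth f i)
  have h3 := depth_lt hf i
  have e : i + ((L - depth f i : ℕ) : ZMod L) = i - depth f i := by
    rw [Nat.cast_sub h3.le]; simp; ring
  rw [e] at h2
  omega

lemma two_mul_height_le (hf : UnitSteps f) {i : ZMod L} (hi : i ∈ starts f) :
    2 * height f i + plat f i ≤ L := by
  have hp := height_pos (mem_starts.1 hi).1
  have h1 := apply_add_of_le_height hf (le_refl (height f i))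
  have h4 : height f i ≤ L := by
    have := depth_lt hf (i + ((height f i - 1 : ℕ) : ZMod L))
    rw [depth_of_mem_starts hi (by omega)] at this
    omega
  have h5 := plat_start hi
  have h3 := (mem_starts.1 hi).2
  rcases h4.eq_or_lt with h | h
  · rw [h] at h1
    simp at h1
    omega
  · have h2 := apply_add_le hf (i + height f i) (L - height f i - 1)
    have e : i + (height f i : ZMod L) + ((L - height f i - 1 : ℕ) : ZMod L) = i - 1 := by
      rw [Nat.sub_sub, Nat.cast_sub (by omega)]; simp; ring
    rw [e] at h2
    split_ifs at h5 with h6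
    · have := (hf (i - 1)).2
      have := (hf (i - 1)).1
      rw [sub_add_cancel] at *
      omega
    · omega

/-- The bound for the local moves along a run of `h` drops. -/
noncomputable def runBound (h p : ℕ) : ℝ :=
  if h = 1 then 5 / 2 * p else (h : ℝ) ^ 2 - 3 * h + 5 + p * (h - 1 / 2)

lemma jump_forward {ℓ : ZMod L → ZMod L → ℝ} (hL : 8 ≤ L) (hf : UnitSteps f)
    (hℓ : IsLossBound f ℓ) {i : ZMod L} (hi : f (i + 1) < f i) {n : ℕ} (h1 : 1 ≤ n) (h3 : n ≤ 3) :
    ℓ i (i + n) ≤ 1 + f (i + n) - f i := by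
  refine hℓ.jump_drop i _ hi (fun e _ he heq => ?_)
  have h2 := two_mul_depth_le hf i
  have h0 : ((n + e : ℕ) : ZMod L) = 0 := by
    push_cast
    have := congrArg (fun x => x - i + e) heq
    simpa using this
  rw [ZMod.natCast_eq_zero_iff] at h0
  have := Nat.le_of_dvd (by omega) h0
  omega

lemma sum_run_local_le {ℓ : ZMod L → ZMod L → ℝ} {c : ZMod L → ℝ} (hL : 8 ≤ L)
    (hf : UnitSteps f) (hℓ : IsLossBound f ℓ) (hc : ∀ i, f (i + 1) < f i → c i ≤ cap f i)
    {i : ZMod L} (hi : i ∈ starts f) :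
    ∑ t ∈ range (height f i), (c (i + t) + ℓ (i + t) (i + t + 2) + 1 / 2 * ℓ (i + t) (i + t + 3))
      ≤ if height f i = 1 then 5 / 2 * (plat f i : ℝ)
        else (height f i : ℝ) ^ 2 - 3 * height f i + 5 + plat f i * height f i := by
  have hcap : ∀ t < height f i, (cap f (i + t) : ℝ) = 2 * t + plat f i := by
    intro t ht
    unfold cap
    rw [depth_of_mem_starts hi ht, plat_of_mem_starts hi ht]
    push_cast
    ring
  have hd : ∀ t < height f i, f (i + t + 1) < f (i + t) := fun t ht => height_min ht
  split_ifs with h1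
  · rw [h1, Finset.sum_range_one]
    have h := hcap 0 (by omega)
    have hd0 := hd 0 (by omega)
    have e1 := hc _ hd0
    have e2 := hℓ.le_cap _ (i + (0 : ℕ) + 2) hd0
    have e3 := hℓ.le_cap _ (i + (0 : ℕ) + 3) hd0
    rw [h] at e1 e2 e3
    push_cast at *
    linarith
  · have hp := height_pos (mem_starts.1 hi).1
    obtain ⟨n, hn⟩ : ∃ n, height f i = n + 2 := ⟨height f i - 2, by omega⟩
    have hval : ∀ t ≤ n + 2, f (i + t) + t = f i := fun t ht =>
      apply_add_of_le_height hf (by omega)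
    have j2 : ∀ t ≤ n + 1, ℓ (i + t) (i + t + 2) ≤ 1 + f (i + t + 2) - f (i + t) := by
      intro t ht
      have := jump_forward hL hf hℓ (hd t (by omega)) (n := 2) (by norm_num) (by norm_num)
      exact_mod_cast this
    have j3 : ∀ t ≤ n + 1, ℓ (i + t) (i + t + 3) ≤ 1 + f (i + t + 3) - f (i + t) := by
      intro t ht
      have := jump_forward hL hf hℓ (hd t (by omega)) (n := 3) (by norm_num) (by norm_num)
      exact_mod_cast this
    have hterm : ∀ t ≤ n + 1, c (i + t) + ℓ (i + t) (i + t + 2) + 1 / 2 * ℓ (i + t) (i + t + 3)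
        ≤ (2 * t + plat f i : ℝ) + (1 / 2) * ((f (i + t + 3) : ℝ) - f (i + t) + 1)
          + ((f (i + t + 2) : ℝ) - f (i + t) + 1) := by
      intro t ht
      have e1 := hc _ (hd t (by omega))
      rw [hcap t (by omega)] at e1
      have := j2 t ht
      have := j3 t ht
      linarith
    have e2 : ∀ t : ℕ, (i + t + 2 : ZMod L) = i + ((t + 2 : ℕ) : ZMod L) := by
      intro t; push_cast; ring
    have e3 : ∀ t : ℕ, (i + t + 3 : ZMod L) = i + ((t + 3 : ℕ) : ZMod L) := by
      intro t; push_cast; ring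
    have hmid : ∀ t < n, c (i + t) + ℓ (i + t) (i + t + 2) + 1 / 2 * ℓ (i + t) (i + t + 3)
        ≤ 2 * t + plat f i - 2 := by
      intro t ht
      have h := hterm t (by omega)
      have a0 := hval t (by omega)
      rw [e2, e3] at h ⊢
      have a2 := hval (t + 2) (by omega)
      have b3 := (hval (t + 3))
      rcases Nat.lt_or_ge (t + 3) (n + 3) with hlt | hge
      · have a3 := b3 (by omega)
        have q0 : (f (i + t) : ℝ) + t = f i := by exact_mod_cast a0
        have q2 : (f (i + (t + 2 : ℕ)) : ℝ) + (t + 2) = f i := by exact_mod_cast a2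
        have q3 : (f (i + (t + 3 : ℕ)) : ℝ) + (t + 3) = f i := by exact_mod_cast a3
        linarith
      · omega
    have hn0 : c (i + n) + ℓ (i + n) (i + n + 2) + 1 / 2 * ℓ (i + n) (i + n + 3)
        ≤ 2 * n + plat f i - 1 := by
      have h := hterm n (by omega)
      have a0 := hval n (by omega)
      have a2 := hval (n + 2) (by omega)
      have a3 := (hf (i + ((n + 2 : ℕ) : ZMod L))).1
      have e4 : i + ((n + 2 : ℕ) : ZMod L) + 1 = i + ((n + 3 : ℕ) : ZMod L) := by push_cast; ring
      rw [e4] at a3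
      rw [e2, e3] at h ⊢
      have q0 : (f (i + n) : ℝ) + n = f i := by exact_mod_cast a0
      have q2 : (f (i + (n + 2 : ℕ)) : ℝ) + (n + 2) = f i := by exact_mod_cast a2
      have q3 : (f (i + (n + 3 : ℕ)) : ℝ) ≤ f (i + (n + 2 : ℕ)) + 1 := by exact_mod_cast a3
      linarith
    have hn1 : c (i + (n + 1 : ℕ)) + ℓ (i + (n + 1 : ℕ)) (i + (n + 1 : ℕ) + 2)
        + 1 / 2 * ℓ (i + (n + 1 : ℕ)) (i + (n + 1 : ℕ) + 3) ≤ 2 * (n + 1) + plat f i + 2 := by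
      have h := hterm (n + 1) (by omega)
      have a0 := hval (n + 1) (by omega)
      have a2 := hval (n + 2) (by omega)
      have a3 := apply_add_le hf (i + ((n + 2 : ℕ) : ZMod L)) 1
      have a4 := apply_add_le hf (i + ((n + 2 : ℕ) : ZMod L)) 2
      have e4 : i + ((n + 2 : ℕ) : ZMod L) + (1 : ℕ) = i + ((n + 1 + 2 : ℕ) : ZMod L) := by
        push_cast; ring
      have e5 : i + ((n + 2 : ℕ) : ZMod L) + (2 : ℕ) = i + ((n + 1 + 3 : ℕ) : ZMod L) := by
        push_cast; ring
      rw [e4] at a3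
      rw [e5] at a4
      rw [e2, e3] at h
      have q0 : (f (i + (n + 1 : ℕ)) : ℝ) + (n + 1) = f i := by exact_mod_cast a0
      have q2 : (f (i + (n + 2 : ℕ)) : ℝ) + (n + 2) = f i := by exact_mod_cast a2
      have q3 : (f (i + (n + 1 + 2 : ℕ)) : ℝ) ≤ f (i + (n + 2 : ℕ)) + 1 := by exact_mod_cast a3
      have q4 : (f (i + (n + 1 + 3 : ℕ)) : ℝ) ≤ f (i + (n + 2 : ℕ)) + 2 := by exact_mod_cast a4
      rw [e2, e3]
      push_cast at h ⊢
      push_cast at q0 q2 q3 q4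
      linarith
    rw [hn, Finset.sum_range_succ, Finset.sum_range_succ]
    have hs : ∑ t ∈ range n, (c (i + t) + ℓ (i + t) (i + t + 2) + 1 / 2 * ℓ (i + t) (i + t + 3))
        ≤ ∑ t ∈ range n, ((plat f i : ℝ) - 2 + 2 * t) :=
      Finset.sum_le_sum (fun t ht => by
        have := hmid t (Finset.mem_range.1 ht)
        linarith)
    have hs2 : ∀ (m : ℕ) (q : ℝ), ∑ t ∈ range m, (q + 2 * (t : ℝ)) = m * q + m * (m - 1) := by
      intro m q
      induction m with
      | zero => simp
      | succ m ih => rw [Finset.sum_range_succ, ih]; push_cast; ring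
    rw [hs2] at hs
    push_cast at hn1 ⊢
    nlinarith

/-- The total of all local moves is bounded by a sum over the maximal runs of drops. -/
lemma sum_local_le {ℓ : ZMod L → ZMod L → ℝ} {c : ZMod L → ℝ} (hL : 8 ≤ L)
    (hf : UnitSteps f) (hℓ : IsLossBound f ℓ) (hc : ∀ i, f (i + 1) < f i → c i ≤ cap f i)
    (hc0 : ∀ i, f i ≤ f (i + 1) → c i ≤ 0) :
    ∑ i, (c i + ℓ i (i + 2) + 1 / 2 * ℓ i (i + 3))
      ≤ ∑ i ∈ starts f, runBound (height f i) (plat f i) := by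
  set ψ : ZMod L → ℝ := fun i => c i + ℓ i (i + 2) + 1 / 2 * ℓ i (i + 3) with hψ
  have hneg : ∀ i, f i ≤ f (i + 1) → ψ i ≤ 0 := by
    intro i hi
    have := hc0 i hi
    have := hℓ.nonpos i (i + 2) hi
    have := hℓ.nonpos i (i + 3) hi
    simp only [hψ]
    linarith
  rw [← Finset.sum_filter_add_sum_filter_not univ (fun i => f (i + 1) < f i), sum_drops f]
  have h1 : ∑ i with ¬ f (i + 1) < f i, ψ i ≤ ∑ i ∈ starts f, ψ (i - 1) := by
    have h2 : ∑ i ∈ starts f, ψ (i - 1) = ∑ j ∈ (starts f).image (fun i => i - 1), ψ j := by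
      rw [Finset.sum_image]
      intro a _ b _ hab
      simpa using hab
    rw [h2]
    have hsub : (starts f).image (fun i => i - 1) ⊆ ({i | ¬ f (i + 1) < f i} : Finset (ZMod L)) := by
      intro j hj
      obtain ⟨i, hi, rfl⟩ := Finset.mem_image.1 hj
      simpa using (mem_starts.1 hi).2
    rw [← Finset.sum_sdiff hsub]
    have : ∑ i ∈ ({i | ¬ f (i + 1) < f i} : Finset (ZMod L)) \ (starts f).image (fun i => i - 1), ψ i
        ≤ 0 := by
      refine Finset.sum_nonpos (fun i hi => hneg i ?_)
      have := (Finset.mem_sdiff.1 hi).1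
      simpa using this
    linarith
  refine (add_le_add_right h1 _).trans ?_
  rw [← Finset.sum_add_distrib]
  refine Finset.sum_le_sum (fun i hi => ?_)
  have h2 := sum_run_local_le hL hf hℓ hc hi
  have h3 := (mem_starts.1 hi)
  have h4 : ψ (i - 1) ≤ 0 := hneg _ (by simpa using h3.2)
  have hp1 := plat_le_one (f := f) i
  unfold runBound
  split_ifs at h2 ⊢ with h5
  · simp only [hψ] at h4 ⊢
    linarith
  · rcases (by omega : plat f i = 0 ∨ plat f i = 1) with hp | hp
    · rw [hp] at h2 ⊢
      simp only [hψ] at h4 ⊢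
      push_cast at h2 ⊢
      linarith
    · have hpos := height_pos h3.1
      have h6 := plat_start hi
      rw [hp] at h6
      split_ifs at h6 with h7
      have h8 : f (i - 1) = f i := by
        have := h3.2
        omega
      have h9 := apply_add_of_le_height hf (i := i) (t := 2) (by omega)
      have h10 : ψ (i - 1) ≤ -(1 / 2) := by
        have hle : f (i - 1) ≤ f (i - 1 + 1) := by simp [h8]
        have q1 := hc0 _ hle
        have q2 := hℓ.nonpos (i - 1) (i - 1 + 2) hle
        have q3 := hℓ.jump (i - 1) (i - 1 + 3) hle
        have e : i - 1 + 3 = i + (2 : ℕ) := by push_cast; ring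
        rw [h8, e] at q3
        simp only [hψ]
        rw [e]
        generalize i + ((2 : ℕ) : ZMod L) = j at *
        have h11 : (f j : ℝ) + 2 = f i := by exact_mod_cast h9
        linarith
      rw [hp] at h2 ⊢
      simp only [hψ] at h10 ⊢
      push_cast at h2 ⊢
      linarith

/-- The total cost of deleting single steps. -/
lemma sum_cap_le {c : ZMod L → ℝ} (hf : UnitSteps f)
    (hc : ∀ i, f (i + 1) < f i → c i ≤ cap f i) (hc0 : ∀ i, f i ≤ f (i + 1) → c i ≤ 0) :
    4 * ∑ i, c i ≤ ((L : ℝ) - 1) ^ 2 := by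
  have hpos : (0 : ℝ) < L := by exact_mod_cast NeZero.pos L
  have h1 : ∑ i, c i ≤ ∑ i ∈ starts f, (height f i : ℝ) * (height f i - 1 + plat f i) := by
    rw [← Finset.sum_filter_add_sum_filter_not univ (fun i => f (i + 1) < f i)]
    have e : ∑ i with ¬ f (i + 1) < f i, c i ≤ 0 :=
      Finset.sum_nonpos (fun i hi => hc0 i (by simpa using hi))
    have e2 : ∑ i with f (i + 1) < f i, c i ≤ ∑ i with f (i + 1) < f i, (cap f i : ℝ) :=
      Finset.sum_le_sum (fun i hi => hc i (by simpa using hi))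
    rw [sum_drops f (fun i => (cap f i : ℝ))] at e2
    have e3 : ∑ i ∈ starts f, ∑ t ∈ range (height f i), (cap f (i + t) : ℝ)
        = ∑ i ∈ starts f, (height f i : ℝ) * (height f i - 1 + plat f i) := by
      refine Finset.sum_congr rfl (fun i hi => ?_)
      have : ∀ t ∈ range (height f i), (cap f (i + t) : ℝ) = 2 * t + plat f i := by
        intro t ht
        have ht' := Finset.mem_range.1 ht
        unfold cap
        rw [depth_of_mem_starts hi ht', plat_of_mem_starts hi ht']
        push_cast
        ring
      rw [Finset.sum_congr rfl this]
      have hs2 : ∀ (m : ℕ) (q : ℝ), ∑ t ∈ range m, (2 * (t : ℝ) + q) = m * (m - 1 + q) := by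
        intro m q
        induction m with
        | zero => simp
        | succ m ih => rw [Finset.sum_range_succ, ih]; push_cast; ring
      rw [hs2]
    linarith
  have h2 := sum_runs_le hf (fun _ => 1) (fun _ => 1) (fun _ => 1) (fun _ => zero_le_one)
  rw [← sum_by_steps (f := f) (fun _ => (1 : ℝ))] at h2
  simp only [Finset.sum_const, Finset.card_univ, ZMod.card, nsmul_eq_mul, mul_one,
    Finset.card_range] at h2
  have h3 : ∀ i ∈ starts f, 4 * L * ((height f i : ℝ) * (height f i - 1 + plat f i))
      ≤ ((L : ℝ) - 1) ^ 2 * ((height f i : ℝ) * (1 + 1) + plat f i) := by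
    intro i hi
    have h4 : (2 * (height f i : ℝ) + plat f i) ≤ L := by
      exact_mod_cast two_mul_height_le hf hi
    have h5 : (1 : ℝ) ≤ height f i := by exact_mod_cast height_pos (mem_starts.1 hi).1
    rcases (by have := plat_le_one (f := f) i; omega : plat f i = 0 ∨ plat f i = 1) with hp | hp
    · rw [hp] at h4 ⊢
      push_cast at h4 ⊢
      have : 2 * (L : ℝ) * (height f i - 1) ≤ ((L : ℝ) - 1) ^ 2 := by nlinarith
      nlinarith
    · rw [hp] at h4 ⊢
      push_cast at h4 ⊢
      have : 0 ≤ ((L : ℝ) - (2 * height f i + 1)) * (L * (2 * (height f i : ℝ) + 1) - 1) :=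
        mul_nonneg (by linarith) (by nlinarith)
      nlinarith
  have h6 := Finset.sum_le_sum h3
  rw [← Finset.mul_sum, ← Finset.mul_sum] at h6
  have h7 : ((L : ℝ) - 1) ^ 2 * ∑ i ∈ starts f, ((height f i : ℝ) * (1 + 1) + plat f i)
      ≤ ((L : ℝ) - 1) ^ 2 * L := mul_le_mul_of_nonneg_left h2 (sq_nonneg _)
  have h8 : L * (4 * ∑ i, c i) ≤ L * ((L : ℝ) - 1) ^ 2 := by
    have := mul_le_mul_of_nonneg_left h1 (by positivity : (0 : ℝ) ≤ 4 * L)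
    linarith
  exact le_of_mul_le_mul_left h8 hpos

end Local

end CyclicWalk

namespace CyclicWalk

open Finset

section RunInequality

lemma sum_coeff_mul (x p : ℝ) (k : ℕ) :
    ∑ r ∈ range k, (2 * (x - r) - 1 + p) * (2 * (r : ℝ) + 1)
      = k * (2 * x - 1 + p) + (2 * x - 2 + p) * (k * (k - 1))
        - 2 * (k * (k - 1) * (2 * k - 1)) / 3 := by
  induction k with
  | zero => simp
  | succ k ih => rw [Finset.sum_range_succ, ih]; push_cast; ring

lemma le_sum_interior (F c : ℕ → ℝ) (x p : ℝ) (hFc : ∀ r, F r + c r = x) (n : ℕ)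
    (hp : p = 0 ∨ p = 1) :
    x ^ 2 * ((n : ℝ) ^ 2 + p * n)
      ≤ 3 * ∑ r ∈ range n, ((2 * ((n : ℝ) - r) - 1 + p) * F r ^ 2 + (2 * (r : ℝ) + 1) * c r ^ 2) := by
  rcases n.eq_zero_or_pos with rfl | hn
  · simp
  have hn1 : (1 : ℝ) ≤ n := by exact_mod_cast hn
  have hp0 : 0 ≤ p := by rcases hp with rfl | rfl <;> norm_num
  have hq : 0 < 2 * (n : ℝ) + p := by linarith
  have h1 : ∀ r ∈ range n, x ^ 2 * ((2 * ((n : ℝ) - r) - 1 + p) * (2 * (r : ℝ) + 1))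
      ≤ (2 * n + p) * ((2 * ((n : ℝ) - r) - 1 + p) * F r ^ 2 + (2 * (r : ℝ) + 1) * c r ^ 2) := by
    intro r _
    rw [← hFc r]
    nlinarith [sq_nonneg ((2 * ((n : ℝ) - r) - 1 + p) * F r - (2 * (r : ℝ) + 1) * c r)]
  have h2 := Finset.sum_le_sum h1
  rw [← Finset.mul_sum, ← Finset.mul_sum, sum_coeff_mul] at h2
  refine le_of_mul_le_mul_left ?_ hq
  have h3 : (2 * n + p) * ((n : ℝ) ^ 2 + p * n) ≤ 3 * (n * (2 * n - 1 + p)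
      + (2 * n - 2 + p) * (n * (n - 1)) - 2 * (n * (n - 1) * (2 * (n : ℝ) - 1)) / 3) := by
    rcases hp with rfl | rfl <;> nlinarith
  nlinarith [mul_le_mul_of_nonneg_left h3 (sq_nonneg x)]

/-- The quadratic inequality behind the estimate of a single run of `h` drops. -/
lemma runBound_le_quadratic (F : ℕ → ℝ) {L : ℝ} (hL : 14 ≤ L) (hF0 : ∀ j, 0 ≤ F j)
    (hFL : ∀ j, F j ≤ L) (hmono : Monotone F) {h p : ℕ} (hh : 1 ≤ h) (hhL : 2 * h ≤ L)
    (hp : p ≤ 1) :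
    L * (L - 1) * runBound h p
      ≤ 3 * (∑ j ∈ range h, (2 * ((h : ℝ) - j) - 1 + p) * F j ^ 2
          + ∑ j ∈ range h, (2 * (j : ℝ) + 1) * (L - F (j + 2)) ^ 2)
        + (2 * h + p) * (L ^ 2 / 2 - 3 / 2 * L) - h / 2
        + L * (F (h + 1) - F 1) + p * (L * (F (h + 1) - F h)) + 3 / 2 * L * (F h - F 0) := by
  have hp' : (p : ℝ) = 0 ∨ (p : ℝ) = 1 := by
    rcases (by omega : p = 0 ∨ p = 1) with rfl | rfl <;> simp
  rcases hh.eq_or_lt with h1 | h1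
  · subst h1
    have m01 := hmono (Nat.zero_le 1)
    have m12 := hmono (Nat.le_succ 1)
    have a0 := hF0 0
    have b2 := hFL 2
    simp only [runBound, if_pos, Finset.sum_range_one]
    norm_num only [Nat.cast_one, Nat.cast_zero]
    rcases hp' with hp' | hp' <;> rw [hp']
    · have : 0 ≤ (L * (F 2 - F 1)) := by apply mul_nonneg <;> linarith
      have : 0 ≤ (L * (F 1 - F 0)) := by apply mul_nonneg <;> linarith
      nlinarith [sq_nonneg (F 0), sq_nonneg (L - F 2)]
    · have hL0 : 0 ≤ L * (F 2 - F 1) := by apply mul_nonneg <;> linarith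
      have : 0 ≤ L * (L - 14) := by apply mul_nonneg <;> linarith
      linarith [sq_nonneg (F 0 - L / 8), sq_nonneg (L - F 2 - L / 4)]
  · obtain ⟨n, rfl⟩ : ∃ n, h = n + 2 := ⟨h - 2, by omega⟩
    have hint := le_sum_interior (fun r => F (r + 2)) (fun r => L - F (r + 2)) L p
      (fun r => by ring) n hp'
    rw [Finset.sum_add_distrib] at hint
    have e1 : ∑ j ∈ range (n + 2), (2 * (((n + 2 : ℕ) : ℝ) - j) - 1 + p) * F j ^ 2
        = ∑ r ∈ range n, (2 * ((n : ℝ) - r) - 1 + p) * F (r + 2) ^ 2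
          + (2 * (n : ℝ) + 1 + p) * F 1 ^ 2 + (2 * n + 3 + p) * F 0 ^ 2 := by
      rw [Finset.sum_range_succ', Finset.sum_range_succ']
      have : ∀ r : ℕ, (2 * (((n + 2 : ℕ) : ℝ) - ((r + 1 + 1 : ℕ) : ℝ)) - 1 + p)
          = (2 * ((n : ℝ) - r) - 1 + p) := by intro r; push_cast; ring
      simp only [this]
      push_cast
      ring
    rw [e1, Finset.sum_range_succ, Finset.sum_range_succ]
    have hrb : runBound (n + 2) p = (n : ℝ) ^ 2 + n + 3 + p * (n + 3 / 2) := by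
      unfold runBound
      rw [if_neg (by omega)]
      push_cast
      ring
    rw [hrb]
    push_cast at hhL ⊢
    have a0 := hF0 0
    have a1 := hF0 1
    have a2 := hFL (n + 2)
    have a3 := hFL (n + 3)
    rw [show n + 1 + 2 = n + 3 by ring, show n + 2 + 1 = n + 3 by ring]
    generalize F 0 = u at *
    generalize F 1 = v at *
    obtain ⟨y, hy⟩ : ∃ y, F (n + 2) = L - y := ⟨L - F (n + 2), by ring⟩
    obtain ⟨z, hz⟩ : ∃ z, F (n + 3) = L - z := ⟨L - F (n + 3), by ring⟩
    rw [hy, hz] at *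
    have hn : (0 : ℝ) ≤ n := Nat.cast_nonneg n
    have q0 : 0 ≤ (n : ℝ) * u ^ 2 := by positivity
    have q1 : 0 ≤ (n : ℝ) * v ^ 2 := by positivity
    have q2 : 0 ≤ (n : ℝ) * y ^ 2 := by positivity
    have q3 : 0 ≤ (n : ℝ) * z ^ 2 := by positivity
    rcases hp' with hp' | hp' <;> rw [hp'] at hint ⊢
    · have hn2 : 0 ≤ L * ((n : ℝ) - 1) ^ 2 := mul_nonneg (by linarith) (sq_nonneg _)
      have hLL : 0 ≤ L * (L - 14) := by apply mul_nonneg <;> linarith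
      linarith [sq_nonneg (u - L / 12), sq_nonneg (v - L / 6), sq_nonneg (y - L / 4),
        sq_nonneg (z - L / 18)]
    · have hn2 : 0 ≤ L * ((n : ℝ) * (n - 1)) := by
        refine mul_nonneg (by linarith) ?_
        rcases n.eq_zero_or_pos with h | h
        · simp [h]
        · have : (1 : ℝ) ≤ n := by exact_mod_cast h
          exact mul_nonneg hn (by linarith)
      have hLL : 0 ≤ L * (L - 14) := by apply mul_nonneg <;> linarith
      linarith [sq_nonneg (u - L / 16), sq_nonneg (v - L / 12), sq_nonneg (y - L / 12),
        sq_nonneg (z - L / 9)]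

lemma le_sum_partial_sums (g : ℕ → ℝ) (hg : ∀ s, 0 ≤ g s) (B h : ℕ) {p : ℝ} (hp : 0 ≤ p) :
    ∑ j ∈ range h, (2 * ((h : ℝ) - j) - 1 + p) * g (B + j)
      ≤ ∑ r ∈ range h, (∑ s ∈ range (B + 1 + r), g s + ∑ s ∈ range (B + r), g s)
        + p * ∑ s ∈ range (B + h), g s := by
  have hB : 0 ≤ ∑ s ∈ range B, g s := Finset.sum_nonneg (fun s _ => hg s)
  induction h with
  | zero => simpa using mul_nonneg hp hB
  | succ h ih =>
    have e1 : ∀ n, ∑ s ∈ range (B + n), g s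
        = ∑ s ∈ range B, g s + ∑ j ∈ range n, g (B + j) := fun n => Finset.sum_range_add _ _ _
    have e2 : ∑ j ∈ range h, (2 * (((h + 1 : ℕ) : ℝ) - j) - 1 + p) * g (B + j)
        = ∑ j ∈ range h, (2 * ((h : ℝ) - j) - 1 + p) * g (B + j)
          + 2 * ∑ j ∈ range h, g (B + j) := by
      rw [Finset.mul_sum, ← Finset.sum_add_distrib]
      refine Finset.sum_congr rfl (fun j _ => ?_)
      push_cast
      ring
    rw [Finset.sum_range_succ, Finset.sum_range_succ _ h, e2,
      show B + 1 + h = B + (h + 1) by ring, e1 (h + 1), e1 h, Finset.sum_range_succ _ h]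
    rw [e1 h] at ih
    push_cast
    linarith

lemma le_sum_tail_sums (g : ℕ → ℝ) (hg : ∀ s, 0 ≤ g s) (B h K : ℕ) (hK : B + h + 1 < K) :
    ∑ j ∈ range h, (2 * (j : ℝ) + 1) * g (B + j + 2)
      ≤ ∑ r ∈ range h, (∑ s ∈ Ico (B + 1 + r + 2) K, g s + ∑ s ∈ Ico (B + r + 2) K, g s) := by
  induction h generalizing K with
  | zero => simp
  | succ h ih =>
    have key : ∀ k ≤ B + h + 2, ∑ s ∈ Ico k (B + h + 2), g s + g (B + h + 2)
        ≤ ∑ s ∈ Ico k K, g s := by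
      intro k hk
      rw [← Finset.sum_Ico_succ_top hk]
      exact Finset.sum_le_sum_of_subset_of_nonneg (Finset.Ico_subset_Ico le_rfl (by omega))
        (fun s _ _ => hg s)
    have h1 := ih (B + h + 2) (by omega)
    have h2 : ∑ r ∈ range h, (∑ s ∈ Ico (B + 1 + r + 2) (B + h + 2), g s
          + ∑ s ∈ Ico (B + r + 2) (B + h + 2), g s) + h * (2 * g (B + h + 2))
        ≤ ∑ r ∈ range h, (∑ s ∈ Ico (B + 1 + r + 2) K, g s + ∑ s ∈ Ico (B + r + 2) K, g s) := by
      have : (h : ℝ) * (2 * g (B + h + 2)) = ∑ r ∈ range h, 2 * g (B + h + 2) := by simp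
      rw [this, ← Finset.sum_add_distrib]
      refine Finset.sum_le_sum (fun r hr => ?_)
      have hr' := Finset.mem_range.1 hr
      have := key (B + 1 + r + 2) (by omega)
      have := key (B + r + 2) (by omega)
      linarith
    have h3 := key (B + h + 2) le_rfl
    have h4 : 0 ≤ ∑ s ∈ Ico (B + 1 + h + 2) K, g s := Finset.sum_nonneg (fun s _ => hg s)
    simp only [Finset.Ico_self, Finset.sum_empty] at h3
    rw [Finset.sum_range_succ, Finset.sum_range_succ _ h]
    linarith

end RunInequality

section Potential

variable {L : ℕ} [NeZero L] {f : ZMod L → ℕ}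

lemma below_mono : Monotone (below f) := by
  intro s t hst
  unfold below
  exact_mod_cast Finset.card_le_card (fun i hi => by simp at hi ⊢; omega)

lemma below_le (s : ℕ) : below f s ≤ L := by
  unfold below
  have := Finset.card_le_univ ({i | f i < s} : Finset (ZMod L))
  rw [ZMod.card] at this
  exact_mod_cast this

lemma below_zero : below f 0 = 0 := by simp [below]

lemma below_eq_of_bound {K : ℕ} (hK : ∀ i, f i < K) : below f K = L := by
  simp [below, hK, ZMod.card]

lemma level_le (t : ℕ) : level f t ≤ L := by
  have h1 := below_succ (f := f) t
  have h2 := below_le (f := f) (t + 1)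
  have h3 := below_nonneg (f := f) t
  linarith

lemma one_le_level (i : ZMod L) : 1 ≤ level f (f i) := by
  unfold level
  exact_mod_cast Finset.card_pos.2 ⟨i, by simp⟩

variable (f) in
/-- The common part of the potentials attached to the steps of the walk. -/
noncomputable def potential (K k : ℕ) : ℝ :=
  3 * ∑ s ∈ range k, below f s ^ 2 + 3 * ∑ s ∈ Ico (k + 2) K, ((L : ℝ) - below f s) ^ 2
    + (L : ℝ) ^ 2 / 2 - 3 / 2 * L

lemma potential_nonneg (hL : 3 ≤ L) (K k : ℕ) : 0 ≤ potential f K k := by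
  have : (3 : ℝ) ≤ L := by exact_mod_cast hL
  unfold potential
  have h1 : 0 ≤ ∑ s ∈ range k, below f s ^ 2 := Finset.sum_nonneg (fun s _ => sq_nonneg _)
  have h2 : 0 ≤ ∑ s ∈ Ico (k + 2) K, ((L : ℝ) - below f s) ^ 2 :=
    Finset.sum_nonneg (fun s _ => sq_nonneg _)
  nlinarith

lemma sum_potential {K : ℕ} (hK : ∀ i, f i + 1 < K) :
    ∑ i, (potential f K (f i) + 3 / 2 * L * level f (f i) - 1 / 2 * level f (f i) ^ 2)
      = 3 / 2 * (L : ℝ) ^ 2 * (L - 1) + 3 * (L * ∑ s ∈ range K, below f s * ((L : ℝ) - below f s))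
        - 9 / 2 * ∑ t ∈ range K, level f t * (below f t * (2 * L - below f (t + 1))) := by
  have h1 : ∀ i, potential f K (f i)
      = 3 * ∑ s ∈ range K, (if s ≤ f i then below f s ^ 2 else ((L : ℝ) - below f s) ^ 2)
        - 3 * below f (f i) ^ 2 - 3 * ((L : ℝ) - below f (f i + 1)) ^ 2
        + (L : ℝ) ^ 2 / 2 - 3 / 2 * L := by
    intro i
    have hi := hK i
    rw [Finset.range_eq_Ico, ← Finset.sum_Ico_consecutive _ (Nat.zero_le (f i + 1)) (by omega),
      ← Finset.range_eq_Ico, Finset.sum_range_succ, Finset.sum_eq_sum_Ico_succ_bot (by omega)]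
    have e1 : ∑ s ∈ range (f i), (if s ≤ f i then below f s ^ 2 else ((L : ℝ) - below f s) ^ 2)
        = ∑ s ∈ range (f i), below f s ^ 2 :=
      Finset.sum_congr rfl (fun s hs => if_pos (Finset.mem_range.1 hs).le)
    have e2 : ∑ s ∈ Ico (f i + 1 + 1) K,
          (if s ≤ f i then below f s ^ 2 else ((L : ℝ) - below f s) ^ 2)
        = ∑ s ∈ Ico (f i + 1 + 1) K, ((L : ℝ) - below f s) ^ 2 :=
      Finset.sum_congr rfl (fun s hs => if_neg (by have := (Finset.mem_Ico.1 hs).1; omega))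
    rw [e1, e2, if_pos le_rfl, if_neg (by omega)]
    unfold potential
    ring
  have h2 : ∑ i, ∑ s ∈ range K, (if s ≤ f i then below f s ^ 2 else ((L : ℝ) - below f s) ^ 2)
      = L * ∑ s ∈ range K, below f s * ((L : ℝ) - below f s) := by
    rw [Finset.sum_comm, Finset.mul_sum]
    refine Finset.sum_congr rfl (fun s _ => ?_)
    have e : ∀ i, (if s ≤ f i then below f s ^ 2 else ((L : ℝ) - below f s) ^ 2)
        = below f s ^ 2 * (if s ≤ f i then 1 else 0)
          + ((L : ℝ) - below f s) ^ 2 * (if f i < s then 1 else 0) := by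
      intro i
      rcases le_or_gt s (f i) with h | h
      · simp [h, not_lt.2 h]
      · simp [h, not_le.2 h]
    simp only [e]
    rw [Finset.sum_add_distrib, ← Finset.mul_sum, ← Finset.mul_sum, ← below_eq_sum,
      ← sub_below_eq_sum]
    ring
  set q : ℕ → ℝ := fun t => - 3 * below f t ^ 2 - 3 * ((L : ℝ) - below f (t + 1)) ^ 2
        + (L : ℝ) ^ 2 / 2 - 3 / 2 * L + 3 / 2 * L * level f t - 1 / 2 * level f t ^ 2 with hq
  have h3 : ∑ i, (potential f K (f i) + 3 / 2 * L * level f (f i) - 1 / 2 * level f (f i) ^ 2)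
      = 3 * (L * ∑ s ∈ range K, below f s * ((L : ℝ) - below f s))
        + ∑ t ∈ range K, level f t * q t := by
    rw [← h2, ← sum_level q hK, Finset.mul_sum, ← Finset.sum_add_distrib]
    refine Finset.sum_congr rfl (fun i _ => ?_)
    rw [h1 i, hq]
    ring
  set Q : ℝ → ℝ := fun x => -(7 / 2) * x ^ 3 + 15 / 2 * x ^ 2 * L - 5 / 2 * (L : ℝ) ^ 2 * x
    - 3 / 2 * L * x with hQ
  have h4 : ∑ t ∈ range K, (Q (below f (t + 1)) - Q (below f t))
      = 3 / 2 * (L : ℝ) ^ 2 * (L - 1) := by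
    rw [Finset.sum_range_sub (fun t => Q (below f t)), below_zero,
      below_eq_of_bound (fun i => by have := hK i; omega), hQ]
    ring
  rw [h3, ← h4, Finset.mul_sum]
  have h5 : ∑ t ∈ range K, level f t * q t = ∑ t ∈ range K, (Q (below f (t + 1)) - Q (below f t))
      - ∑ t ∈ range K, 9 / 2 * (level f t * (below f t * (2 * L - below f (t + 1)))) := by
    rw [← Finset.sum_sub_distrib]
    refine Finset.sum_congr rfl (fun t _ => ?_)
    rw [hq, hQ]
    simp only [below_succ]
    ring
  rw [h5, ← Finset.mul_sum, ← Finset.mul_sum]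
  ring

lemma runBound_le_sum_potential (hL : 14 ≤ L) (hf : UnitSteps f) {K : ℕ}
    (hK : ∀ i, f i + 1 < K) {i : ZMod L} (hi : i ∈ starts f) :
    (L : ℝ) * (L - 1) * runBound (height f i) (plat f i)
      ≤ ∑ t ∈ range (height f i), ((potential f K (f i - t) + L * level f (f i - t))
          + (potential f K (f i - t - 1) + 3 / 2 * L * level f (f i - t - 1) - 1 / 2))
        + (plat f i : ℝ) * (potential f K (f i) + L * level f (f i)) := by
  obtain ⟨B, hB⟩ : ∃ B, f i = B + height f i := ⟨f i - height f i, by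
    have := height_le hf i; omega⟩
  have hh := height_pos (mem_starts.1 hi).1
  have hp := plat_le_one (f := f) i
  have hhL := two_mul_height_le hf hi
  have hKi := hK i
  set h := height f i with hhdef
  set p := plat f i with hpdef
  have e1 : ∑ t ∈ range h, ((potential f K (f i - t) + L * level f (f i - t))
          + (potential f K (f i - t - 1) + 3 / 2 * L * level f (f i - t - 1) - 1 / 2))
      = ∑ r ∈ range h, ((potential f K (B + 1 + r) + L * level f (B + 1 + r))
          + (potential f K (B + r) + 3 / 2 * L * level f (B + r) - 1 / 2)) := by
    rw [← Finset.sum_range_reflect]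
    refine Finset.sum_congr rfl (fun r hr => ?_)
    have hr' := Finset.mem_range.1 hr
    rw [show f i - (h - 1 - r) = B + 1 + r by omega, show B + 1 + r - 1 = B + r by omega]
  have hlev : ∀ t, level f t = below f (t + 1) - below f t := fun t => by
    rw [below_succ]; ring
  have e2 : ∑ r ∈ range h, level f (B + r) = below f (B + h) - below f B := by
    have := Finset.sum_range_sub (fun r => below f (B + r)) h
    simpa [hlev, add_assoc] using this
  have e3 : ∑ r ∈ range h, level f (B + 1 + r) = below f (B + h + 1) - below f (B + 1) := by
    have := Finset.sum_range_sub (fun r => below f (B + 1 + r)) h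
    rw [show B + h + 1 = B + 1 + h by ring]
    simpa [hlev, add_assoc] using this
  have hlow := le_sum_partial_sums (fun s => below f s ^ 2) (fun s => sq_nonneg _) B h
    (p := (p : ℝ)) (Nat.cast_nonneg _)
  have hhigh := le_sum_tail_sums (fun s => ((L : ℝ) - below f s) ^ 2) (fun s => sq_nonneg _) B h K
    (by omega)
  have htop : 0 ≤ (p : ℝ) * ∑ s ∈ Ico (B + h + 2) K, ((L : ℝ) - below f s) ^ 2 :=
    mul_nonneg (Nat.cast_nonneg _) (Finset.sum_nonneg (fun s _ => sq_nonneg _))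
  have hmain := runBound_le_quadratic (fun j => below f (B + j)) (L := L)
    (by exact_mod_cast hL) (fun j => below_nonneg _) (fun j => below_le _)
    (fun a b hab => below_mono (by omega)) hh (by exact_mod_cast (by omega : 2 * h ≤ L)) hp
  refine hmain.trans ?_
  rw [e1, hB, hlev (B + h)]
  have e4 : ∑ r ∈ range h, ((potential f K (B + 1 + r) + L * level f (B + 1 + r))
          + (potential f K (B + r) + 3 / 2 * L * level f (B + r) - 1 / 2))
      = 3 * ∑ r ∈ range h, (∑ s ∈ range (B + 1 + r), below f s ^ 2
            + ∑ s ∈ range (B + r), below f s ^ 2)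
        + 3 * ∑ r ∈ range h, (∑ s ∈ Ico (B + 1 + r + 2) K, ((L : ℝ) - below f s) ^ 2
            + ∑ s ∈ Ico (B + r + 2) K, ((L : ℝ) - below f s) ^ 2)
        + h * ((L : ℝ) ^ 2 - 3 * L - 1 / 2)
        + L * ∑ r ∈ range h, level f (B + 1 + r) + 3 / 2 * L * ∑ r ∈ range h, level f (B + r) := by
    have : (h : ℝ) * ((L : ℝ) ^ 2 - 3 * L - 1 / 2)
        = ∑ r ∈ range h, ((L : ℝ) ^ 2 - 3 * L - 1 / 2) := by
      rw [Finset.sum_const, Finset.card_range, nsmul_eq_mul]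
    rw [this]
    simp only [Finset.mul_sum, ← Finset.sum_add_distrib]
    refine Finset.sum_congr rfl (fun r _ => ?_)
    simp only [potential, Finset.mul_sum, mul_add]
    ring
  rw [e4, e2, e3]
  simp only [← add_assoc] at hlow hhigh ⊢
  simp only [potential, add_zero]
  linarith

lemma exists_bound (f : ZMod L → ℕ) : ∃ K, ∀ i, f i + 1 < K :=
  ⟨univ.sup f + 2, fun i => by
    have := Finset.le_sup (f := f) (Finset.mem_univ i)
    omega⟩

lemma sum_runBound_le (hL : 14 ≤ L) (hf : UnitSteps f) {K : ℕ} (hK : ∀ i, f i + 1 < K) :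
    (L : ℝ) * (L - 1) * ∑ i ∈ starts f, runBound (height f i) (plat f i)
      ≤ 3 / 2 * (L : ℝ) ^ 2 * (L - 1) + 3 * (L * ∑ s ∈ range K, below f s * ((L : ℝ) - below f s))
        - 9 / 2 * ∑ t ∈ range K, level f t * (below f t * (2 * L - below f (t + 1)))
        + 3 / 2 * ∑ t ∈ range K, rises f t * (level f t * (level f t - 1)) := by
  have hL0 : (0 : ℝ) ≤ L := Nat.cast_nonneg _
  rw [← sum_potential hK, ← sum_rises_level (fun t => level f t * (level f t - 1)) hK,
    sum_by_steps (f := f), Finset.mul_sum]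
  refine (Finset.sum_le_sum (fun i hi => runBound_le_sum_potential hL hf hK hi)).trans ?_
  refine (sum_runs_le hf (fun k => potential f K k + L * level f k)
    (fun k => potential f K k + 3 / 2 * L * level f k - 1 / 2)
    (fun k => potential f K k + L * level f k) (fun i => ?_)).trans ?_
  · have := potential_nonneg (f := f) (by omega) K (f i)
    have := mul_nonneg hL0 (zero_le_one.trans (one_le_level (f := f) i))
    linarith
  have hlow : ∀ i, potential f K (f i) + L * level f (f i)
      ≤ potential f K (f i) + 3 / 2 * L * level f (f i) - 1 / 2 * level f (f i) ^ 2 := by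
    intro i
    nlinarith [one_le_level (f := f) i, level_le (f := f) (f i)]
  have h1 := Finset.sum_le_sum (s := {i | f (i + 1) < f i}) (fun i _ => hlow i)
  have h2 := Finset.sum_le_sum (s := {i | f (i + 1) = f i}) (fun i _ => hlow i)
  have h3 : ∑ i with f i < f (i + 1), (potential f K (f i) + 3 / 2 * L * level f (f i) - 1 / 2)
      ≤ ∑ i with f i < f (i + 1), (potential f K (f i) + 3 / 2 * L * level f (f i)
          - 1 / 2 * level f (f i) ^ 2)
        + 3 / 2 * ∑ i with f i < f (i + 1), level f (f i) * (level f (f i) - 1) := by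
    rw [Finset.mul_sum, ← Finset.sum_add_distrib]
    refine Finset.sum_le_sum (fun i _ => ?_)
    nlinarith [mul_nonneg (sub_nonneg.2 (one_le_level (f := f) i))
      (by linarith [one_le_level (f := f) i] : 0 ≤ level f (f i) - 1 / 2)]
  linarith

/-- The bound for the combined moves, as seen from an arbitrary vertex. -/
theorem sum_local_add_sum_weight_le (hL : 14 ≤ L) (hf : UnitSteps f)
    {ℓ : ZMod L → ZMod L → ℝ} {c : ZMod L → ℝ} (hℓ : IsLossBound f ℓ)
    (hc : ∀ i, f (i + 1) < f i → c i ≤ cap f i) (hc0 : ∀ i, f i ≤ f (i + 1) → c i ≤ 0) :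
    (L : ℝ) * (L - 1) * ∑ i, (c i + ℓ i (i + 2) + 1 / 2 * ℓ i (i + 3))
      + 12 * ∑ i, ∑ j, weight i j * ℓ i j ≤ 3 * (L : ℝ) ^ 2 * (L - 1) := by
  obtain ⟨K, hK⟩ := exists_bound f
  have h1 : (1 : ℝ) ≤ L := by exact_mod_cast (by omega : 1 ≤ L)
  have h2 := mul_le_mul_of_nonneg_left (sum_local_le (by omega) hf hℓ hc hc0)
    (mul_nonneg (by linarith) (by linarith) : 0 ≤ (L : ℝ) * (L - 1))
  have h3 := sum_runBound_le hL hf hK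
  have h4 := four_mul_sum_weight_loss_le (by omega) hf hℓ hK
  have h5 := descent_le hK
  have h6 := le_ties hK
  linarith

end Potential

end CyclicWalk

namespace CyclicWalk

open Finset

section CyclicDistance

variable {L : ℕ} [NeZero L] {f : ZMod L → ℕ}

lemma mul_runBound_le {a q h p : ℕ} (ha : 6 ≤ a) (hq : q ≤ 1) (hh : 1 ≤ h) (hp : p ≤ 1)
    (hx : 2 * h + p ≤ 2 * a + 2 + q) :
    (2 * (a : ℝ) + 2 + q) * runBound h p
      ≤ (2 * h + p) * ((2 * (a : ℝ) + 2 + q) ^ 2 / 4 - 3 / 2 * (2 * (a : ℝ) + 2 + q) + 5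
        + 3 / 4 * q) := by
  have ha' : (6 : ℝ) ≤ a := by exact_mod_cast ha
  have hq0 : (0 : ℝ) ≤ q := Nat.cast_nonneg _
  set M : ℝ := 2 * (a : ℝ) + 2 + q with hM
  have hM14 : 14 ≤ M := by linarith
  have hh' : (1 : ℝ) ≤ h := by exact_mod_cast hh
  have hxM : (2 * (h : ℝ) + p) ≤ M := by rw [hM]; exact_mod_cast hx
  rcases (by omega : p = 0 ∨ p = 1) with rfl | rfl
  · rcases hh.eq_or_lt with h1 | h1
    · rw [← h1]
      simp only [runBound, if_pos]
      push_cast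
      nlinarith
    · have h2 : (2 : ℝ) ≤ h := by exact_mod_cast h1
      rw [runBound, if_neg (by omega)]
      push_cast at hxM ⊢
      have e1 : 0 ≤ (M - 2 * h) * (2 * h * M / 4 - 5) := mul_nonneg (by linarith) (by nlinarith)
      have e2 : 0 ≤ (h : ℝ) * q := by positivity
      nlinarith
  · have key : M * ((2 * (h : ℝ) + 1) ^ 2 / 4 - 3 / 2 * (2 * h + 1) + 23 / 4)
        ≤ (2 * h + 1) * (M ^ 2 / 4 - 3 / 2 * M + 5 + 3 / 4 * q) := by
      push_cast at hxM
      have e0 : 0 ≤ (2 * (h : ℝ) + 1) * M / 4 - 23 / 4 - 3 / 4 * (2 * h + 1) := by nlinarith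
      rcases (by omega : q = 0 ∨ q = 1) with rfl | rfl
      · have hx1 : (2 * (h : ℝ) + 1) + 1 ≤ M := by
          rw [hM]
          exact_mod_cast (by omega : 2 * h + 1 + 1 ≤ 2 * a + 2 + 0)
        have e1 : 0 ≤ (M - (2 * h + 1) - 1) * ((2 * (h : ℝ) + 1) * M / 4 - 23 / 4) :=
          mul_nonneg (by linarith) (by linarith)
        push_cast
        nlinarith
      · have e1 : 0 ≤ (M - (2 * h + 1)) * ((2 * (h : ℝ) + 1) * M / 4 - 23 / 4) :=
          mul_nonneg (by linarith) (by linarith)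
        push_cast
        nlinarith
    refine le_trans (mul_le_mul_of_nonneg_left ?_ (by linarith)) (by push_cast; exact key)
    rcases hh.eq_or_lt with h1 | h1
    · rw [← h1]
      simp only [runBound, if_pos]
      norm_num
    · rw [runBound, if_neg (by omega)]
      push_cast
      linarith

lemma sum_runBound_le_of_length {a q : ℕ} (ha : 6 ≤ a) (hq : q ≤ 1) (hL : L = 2 * a + 2 + q)
    (hf : UnitSteps f) :
    ∑ i ∈ starts f, runBound (height f i) (plat f i)
      ≤ (L : ℝ) ^ 2 / 4 - 3 / 2 * L + 5 + 3 / 4 * q := by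
  have hL' : (L : ℝ) = 2 * (a : ℝ) + 2 + q := by rw [hL]; push_cast; ring
  have ha' : (6 : ℝ) ≤ a := by exact_mod_cast ha
  have hq0 : (0 : ℝ) ≤ q := Nat.cast_nonneg _
  have hpos : (0 : ℝ) < L := by linarith
  set R : ℝ := (L : ℝ) ^ 2 / 4 - 3 / 2 * L + 5 + 3 / 4 * q with hR
  have hR0 : 0 ≤ R := by nlinarith
  have h2 := sum_runs_le hf (fun _ => 1) (fun _ => 1) (fun _ => 1) (fun _ => zero_le_one)
  rw [← sum_by_steps (f := f) (fun _ => (1 : ℝ))] at h2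
  simp only [Finset.sum_const, Finset.card_univ, ZMod.card, nsmul_eq_mul, mul_one,
    Finset.card_range] at h2
  have h3 : ∀ i ∈ starts f, L * runBound (height f i) (plat f i)
      ≤ ((height f i : ℝ) * (1 + 1) + plat f i) * R := by
    intro i hi
    have := mul_runBound_le ha hq (height_pos (mem_starts.1 hi).1) (plat_le_one (f := f) i)
      (hL ▸ two_mul_height_le hf hi)
    rw [← hL'] at this
    rw [hR]
    linarith
  have h4 := Finset.sum_le_sum h3
  rw [← Finset.mul_sum, ← Finset.sum_mul] at h4
  have h5 := mul_le_mul_of_nonneg_right h2 hR0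
  exact le_of_mul_le_mul_left (h4.trans h5) hpos

lemma below_cyclic_dist {k : ZMod L} (hf : ∀ i, f i = min (i - k).val (k - i).val) {s : ℕ}
    (hs : 1 ≤ s) (hsL : 2 * s ≤ L + 1) : below f s = 2 * s - 1 := by
  have hpos := NeZero.pos L
  have h1 : below f s = ∑ d : ZMod L,
      (fun x : ℕ => if x < s ∨ L - x < s then (1 : ℝ) else 0) d.val := by
    rw [below_eq_sum, ← Equiv.sum_comp (Equiv.addLeft k)]
    refine Finset.sum_congr rfl (fun d _ => ?_)
    have e : f (k + d) = min d.val (-d).val := by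
      rw [hf]
      congr 2 <;> ring
    simp only [Equiv.coe_addLeft, e]
    congr 1
    rw [ZMod.neg_val]
    have := ZMod.val_lt d
    split_ifs with h
    · subst h
      simp
      omega
    · simp only [min_lt_iff]
  have h2 : ({x ∈ range L | x < s ∨ L - x < s} : Finset ℕ) = range s ∪ Ico (L - s + 1) L := by
    ext x
    simp only [Finset.mem_filter, Finset.mem_range, Finset.mem_union, Finset.mem_Ico]
    omega
  have h3 : Disjoint (range s) (Ico (L - s + 1) L) := by
    rw [Finset.disjoint_left]
    intro x hx hx'
    simp only [Finset.mem_range, Finset.mem_Ico] at hx hx'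
    omega
  rw [h1, sum_val (fun x : ℕ => if x < s ∨ L - x < s then (1 : ℝ) else 0), Finset.sum_boole, h2,
    Finset.card_union_of_disjoint h3, Finset.card_range, Nat.card_Ico]
  have : s + (L - (L - s + 1)) + 1 = 2 * s := by omega
  have h4 : ((s + (L - (L - s + 1)) : ℕ) : ℝ) + 1 = 2 * s := by exact_mod_cast this
  linarith

/-- The bound for the combined moves, as seen from a vertex of the cycle itself. -/
theorem sum_local_add_sum_weight_le_cyclic_dist (hL : 14 ≤ L) {k : ZMod L}
    (hfk : ∀ i, f i = min (i - k).val (k - i).val) (hf : UnitSteps f)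
    {ℓ : ZMod L → ZMod L → ℝ} {c : ZMod L → ℝ} (hℓ : IsLossBound f ℓ)
    (hc : ∀ i, f (i + 1) < f i → c i ≤ cap f i) (hc0 : ∀ i, f i ≤ f (i + 1) → c i ≤ 0) :
    (L : ℝ) * (L - 1) * ∑ i, (c i + ℓ i (i + 2) + 1 / 2 * ℓ i (i + 3))
      + 12 * ∑ i, ∑ j, weight i j * ℓ i j ≤ 3 * (L : ℝ) ^ 2 * (L - 1) - 3 * (L * (L - 1)) := by
  obtain ⟨a, q, ha, hq, hLa⟩ : ∃ a q, 6 ≤ a ∧ q ≤ 1 ∧ L = 2 * a + 2 + q :=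
    ⟨L / 2 - 1, L % 2, by omega, by omega, by omega⟩
  have hL' : (L : ℝ) = 2 * (a : ℝ) + 2 + q := by rw [hLa]; push_cast; ring
  have ha' : (6 : ℝ) ≤ a := by exact_mod_cast ha
  have hq0 : (0 : ℝ) ≤ q := Nat.cast_nonneg _
  have hfle : ∀ i, f i ≤ a + 1 := by
    intro i
    rw [hfk i]
    have e : k - i = -(i - k) := by ring
    rw [e, ZMod.neg_val]
    have := ZMod.val_lt (i - k)
    split_ifs <;> omega
  have hK : ∀ i, f i + 1 < a + 3 := fun i => by have := hfle i; omega
  have hN : ∀ r : ℕ, r ≤ a → below f (r + 1) = 2 * r + 1 := by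
    intro r hr
    rw [below_cyclic_dist hfk (by omega) (by omega)]
    push_cast
    ring
  have hNtop : ∀ s, a + 2 ≤ s → below f s = L := fun s hs =>
    below_eq_of_bound (fun i => by have := hfle i; omega)
  have hlev : ∀ t, level f t = below f (t + 1) - below f t := fun t => by
    rw [below_succ]; ring
  have hS : ∑ s ∈ range (a + 3), below f s * ((L : ℝ) - below f s)
      = ∑ r ∈ range (a + 1), (2 * (r : ℝ) + 1) * (L - (2 * r + 1)) := by
    rw [Finset.sum_range_succ, Finset.sum_range_succ', below_zero, hNtop (a + 2) le_rfl]
    rw [sub_self, mul_zero, zero_mul, add_zero, add_zero]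
    refine Finset.sum_congr rfl (fun r hr => ?_)
    rw [hN r (by have := Finset.mem_range.1 hr; omega)]
  have hM : ∑ t ∈ range (a + 3), level f t * (below f t * (2 * L - below f (t + 1)))
      = ∑ r ∈ range a, 2 * ((2 * (r : ℝ) + 1) * (2 * L - (2 * r + 3)))
        + (L - (2 * a + 1)) * ((2 * a + 1) * L) := by
    rw [Finset.sum_range_succ, Finset.sum_range_succ', below_zero, Finset.sum_range_succ,
      hlev (a + 1), hlev (a + 2), hNtop (a + 2) le_rfl, hNtop (a + 2 + 1) (by omega), hN a le_rfl]
    have : ∀ r ∈ range a, level f (r + 1) * (below f (r + 1) * (2 * L - below f (r + 1 + 1)))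
        = 2 * ((2 * (r : ℝ) + 1) * (2 * L - (2 * r + 3))) := by
      intro r hr
      have hr' := Finset.mem_range.1 hr
      rw [hlev, hN r (by omega), hN (r + 1) (by omega)]
      push_cast
      ring
    rw [Finset.sum_congr rfl this]
    ring
  have c1 : ∀ (n : ℕ) (x : ℝ), ∑ r ∈ range n, (2 * (r : ℝ) + 1) * (x - (2 * r + 1))
      = x * n ^ 2 - n * (4 * n ^ 2 - 1) / 3 := by
    intro n x
    induction n with
    | zero => simp
    | succ n ih => rw [Finset.sum_range_succ, ih]; push_cast; ring
  have c2 : ∀ (n : ℕ) (x : ℝ), ∑ r ∈ range n, 2 * ((2 * (r : ℝ) + 1) * (2 * x - (2 * r + 3)))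
      = 4 * x * n ^ 2 - 2 * (n * (4 * n ^ 2 - 1) / 3) - 4 * n ^ 2 := by
    intro n x
    induction n with
    | zero => simp
    | succ n ih => rw [Finset.sum_range_succ, ih]; push_cast; ring
  rw [c1] at hS
  rw [c2] at hM
  have h1 : (1 : ℝ) ≤ L := by linarith
  have h2 := mul_le_mul_of_nonneg_left ((sum_local_le (by omega) hf hℓ hc hc0).trans
    (sum_runBound_le_of_length ha hq hLa hf))
    (mul_nonneg (by linarith) (by linarith) : 0 ≤ (L : ℝ) * (L - 1))
  have h4 := four_mul_sum_weight_loss_le (by omega) hf hℓ hK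
  have h5 := descent_le hK
  have h6 := le_ties hK
  have h7 : 0 ≤ ∑ t ∈ range (a + 3), rises f t * (level f t * (level f t - 1)) := by
    rw [← sum_rises_level (fun t => level f t * (level f t - 1)) hK]
    refine Finset.sum_nonneg (fun i _ => ?_)
    have := one_le_level (f := f) i
    exact mul_nonneg (by linarith) (by linarith)
  rw [hS] at h4
  rw [hM] at h5
  push_cast at h4 h5
  have h8 : (L : ℝ) * (L - 1) * ((L : ℝ) ^ 2 / 4 - 3 / 2 * L + 5 + 3 / 4 * q)
      - 3 * (L * (L * ((a : ℝ) + 1) ^ 2 - (a + 1) * (4 * (a + 1) ^ 2 - 1) / 3))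
      + 9 / 2 * (4 * L * (a : ℝ) ^ 2 - 2 * (a * (4 * a ^ 2 - 1) / 3) - 4 * a ^ 2
        + (L - (2 * a + 1)) * ((2 * a + 1) * L))
      ≤ 3 / 2 * (L : ℝ) ^ 2 * (L - 1) - 3 * (L * (L - 1)) := by
    rw [hL']
    obtain ⟨b, hb⟩ : ∃ b : ℝ, (a : ℝ) = b + 6 := ⟨a - 6, by ring⟩
    have hb0 : 0 ≤ b := by linarith
    rw [hb]
    have p2 := pow_nonneg hb0 2
    have p3 := pow_nonneg hb0 3
    rcases (by omega : q = 0 ∨ q = 1) with rfl | rfl <;> push_cast <;> nlinarith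
  linarith

end CyclicDistance

end CyclicWalk

namespace NetworkCreation

open Finset

section Deviation

variable {V : Type*}

lemma graph_adj {S : Profile V} {a b : V} :
    (graph S).Adj a b ↔ (∃ v, s(a, b) ∈ (S v).1) ∧ a ≠ b := by
  simp [graph]

lemma exists_owner {S : Profile V} {a b : V} (h : (graph S).Adj a b) :
    s(a, b) ∈ (S a).1 ∨ s(a, b) ∈ (S b).1 := by
  obtain ⟨⟨v, hv⟩, _⟩ := graph_adj.1 h
  have := ((S v).2 _ hv).1
  rcases Sym2.mem_iff.1 this with rfl | rfl
  · exact Or.inl hv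
  · exact Or.inr hv

/-- The graph obtained by removing the edges in `R` and adding the edges in `A`. -/
abbrev rewire (G : SimpleGraph V) (R A : Finset (Sym2 V)) : SimpleGraph V :=
  G.deleteEdges R ⊔ SimpleGraph.fromEdgeSet A

variable [Fintype V] [DecidableEq V]

omit [Fintype V] in
lemma rewire_le_graph_update (S : Profile V) (z : V) (R A : Finset (Sym2 V)) (T : Strategy z)
    (hT : T.1 = ((S z).1 \ R) ∪ A) :
    rewire (graph S) R A ≤ graph (Function.update S z T) := by
  rw [SimpleGraph.le_iff_adj]
  intro a b hab
  rw [SimpleGraph.sup_adj, SimpleGraph.deleteEdges_adj, SimpleGraph.fromEdgeSet_adj] at hab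
  rcases hab with ⟨h1, h2⟩ | ⟨h1, h2⟩
  · obtain ⟨⟨v, hv⟩, hne⟩ := graph_adj.1 h1
    refine graph_adj.2 ⟨⟨v, ?_⟩, hne⟩
    by_cases hvz : v = z
    · subst hvz
      rw [Function.update_self, hT]
      exact Finset.mem_union_left _ (Finset.mem_sdiff.2 ⟨hv, by simpa using h2⟩)
    · rwa [Function.update_of_ne hvz]
  · refine graph_adj.2 ⟨⟨z, ?_⟩, h2⟩
    rw [Function.update_self, hT]
    exact Finset.mem_union_right _ (by simpa using h1)

lemma cost_le {α : ℝ} {S : Profile V} {z : V} (B : V → ℕ)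
    (h : ∀ u ≠ z, (graph S).edist u z ≤ B u) :
    cost α S z ≤ ((α * ((S z).1.card : ℝ) + ∑ u ∈ univ.erase z, (B u : ℝ) : ℝ) : EReal) := by
  have h1 : connectionCost (graph S) z ≤ ((∑ u ∈ univ.erase z, B u : ℕ) : ℕ∞) := by
    rw [Nat.cast_sum]
    exact Finset.sum_le_sum (fun u hu => h u (Finset.ne_of_mem_erase hu))
  have h2 : ((connectionCost (graph S) z : ENNReal) : EReal)
      ≤ ((∑ u ∈ univ.erase z, (B u : ℝ) : ℝ) : EReal) := by
    have h3 : (connectionCost (graph S) z : ENNReal)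
        ≤ (((∑ u ∈ univ.erase z, B u : ℕ) : ℕ∞) : ENNReal) := by exact_mod_cast h1
    refine (EReal.coe_ennreal_le_coe_ennreal_iff.2 h3).trans (le_of_eq ?_)
    rw [ENat.toENNReal_coe, ← Nat.cast_sum]
    rfl
  unfold cost
  rw [EReal.coe_add]
  exact add_le_add le_rfl h2

lemma cost_eq {α : ℝ} {S : Profile V} {z : V} (h : (graph S).Connected) :
    cost α S z = ((α * ((S z).1.card : ℝ) + ∑ u, ((graph S).dist u z : ℝ) : ℝ) : EReal) := by
  have h1 : connectionCost (graph S) z = ((∑ u, (graph S).dist u z : ℕ) : ℕ∞) := by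
    rw [← Finset.sum_erase univ (f := fun u => (graph S).dist u z) (a := z) SimpleGraph.dist_self,
      Nat.cast_sum]
    exact Finset.sum_congr rfl (fun u _ => ((h u z).coe_dist_eq_edist).symm)
  unfold cost
  rw [h1, EReal.coe_add, ENat.toENNReal_coe, ← Nat.cast_sum]
  rfl

lemma cost_eq_top {α : ℝ} {S : Profile V} {u z : V} (h : ¬ (graph S).Reachable u z) :
    cost α S z = ⊤ := by
  have huz : u ≠ z := fun e => h (e ▸ SimpleGraph.Reachable.refl _)
  have h1 : connectionCost (graph S) z = ⊤ :=
    WithTop.sum_eq_top.2 ⟨u, by simpa using huz, SimpleGraph.edist_eq_top_of_not_reachable h⟩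
  unfold cost
  rw [h1]
  exact EReal.coe_add_top _

/-- The strategy of buying the edges to all other vertices. -/
def buyAll (z : V) : Strategy z :=
  ⟨(univ.erase z).image (fun u => s(u, z)), by
    intro e he
    obtain ⟨u, hu, rfl⟩ := Finset.mem_image.1 he
    exact ⟨by simp, by simpa using Finset.ne_of_mem_erase hu⟩⟩

lemma IsNash.connected [Nonempty V] {α : ℝ} {S : Profile V} (hS : IsNash α S) :
    (graph S).Connected := by
  rw [SimpleGraph.connected_iff]
  refine ⟨fun u z => ?_, inferInstance⟩
  by_contra h
  have h1 := hS z (buyAll z)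
  rw [cost_eq_top h] at h1
  have h2 := cost_le (α := α) (S := Function.update S z (buyAll z)) (z := z) (fun _ => 1)
    (fun w hw => by
      refine SimpleGraph.edist_le_one_iff_adj_or_eq.2 (Or.inl (graph_adj.2 ⟨⟨z, ?_⟩, hw⟩))
      rw [Function.update_self]
      exact Finset.mem_image.2 ⟨w, by simpa using hw, rfl⟩)
  exact absurd (h1.trans h2) (not_le.2 (EReal.coe_lt_top _))

/-- What the equilibrium condition says about replacing the bought edges `R` by the edges `A`. -/
lemma IsNash.deviation [Nonempty V] {α : ℝ} {S : Profile V} (hS : IsNash α S) (hα : 0 ≤ α) {z : V}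
    {R A : Finset (Sym2 V)} (hR : R ⊆ (S z).1) (hA : ∀ e ∈ A, z ∈ e ∧ ¬ e.IsDiag)
    (hreach : ∀ u, (rewire (graph S) R A).Reachable u z) :
    α * (#R : ℝ) + ∑ u, ((graph S).dist u z : ℝ)
      ≤ α * (#A : ℝ) + ∑ u, ((rewire (graph S) R A).dist u z : ℝ) := by
  set T : Strategy z := ⟨((S z).1 \ R) ∪ A, by
    intro e he
    rcases Finset.mem_union.1 he with h | h
    · exact (S z).2 e (Finset.mem_sdiff.1 h).1
    · exact hA e h⟩ with hT
  have h1 := hS z T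
  have h2 := cost_le (α := α) (S := Function.update S z T) (z := z)
    (fun u => (rewire (graph S) R A).dist u z) (fun u _ => by
      rw [(hreach u).coe_dist_eq_edist]
      exact SimpleGraph.edist_anti (rewire_le_graph_update S z R A T rfl))
  rw [cost_eq hS.connected] at h1
  have h3 := EReal.coe_le_coe_iff.1 (h1.trans h2)
  rw [Function.update_self] at h3
  have h4 : (#(T.1) : ℝ) + #R ≤ #((S z).1) + #A := by
    have e1 := Finset.card_union_le ((S z).1 \ R) A
    have e2 := Finset.card_sdiff_add_card_eq_card hR
    have : #(T.1) + #R ≤ #((S z).1) + #A := by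
      rw [hT]
      simp only
      omega
    exact_mod_cast this
  have h5 : ∑ u ∈ univ.erase z, ((rewire (graph S) R A).dist u z : ℝ)
      = ∑ u, ((rewire (graph S) R A).dist u z : ℝ) :=
    Finset.sum_erase univ (by simp)
  rw [h5] at h3
  have h6 := mul_le_mul_of_nonneg_left h4 hα
  linarith

end Deviation

section Walks

variable {V : Type*} {G : SimpleGraph V}

lemma dist_le_of_mem_edges (hG : G.Connected) {a b x u : V} (p : G.Walk x u)
    (h : s(a, b) ∈ p.edges) :
    G.dist x a + 1 + G.dist b u ≤ p.length ∨ G.dist x b + 1 + G.dist a u ≤ p.length := by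
  induction p with
  | nil => simp at h
  | @cons x y w hxy p ih =>
    rw [SimpleGraph.Walk.edges_cons, List.mem_cons] at h
    rw [SimpleGraph.Walk.length_cons]
    have hp := SimpleGraph.dist_le p
    rcases h with h | h
    · rcases Sym2.eq_iff.1 h with ⟨rfl, rfl⟩ | ⟨rfl, rfl⟩
      · left
        rw [SimpleGraph.dist_self]
        omega
      · right
        rw [SimpleGraph.dist_self]
        omega
    · have h1 := SimpleGraph.dist_eq_one_iff_adj.2 hxy
      have h2 := hG.dist_triangle (u := x) (v := y) (w := a)
      have h3 := hG.dist_triangle (u := x) (v := y) (w := b)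
      rcases ih h with h | h
      · left; omega
      · right; omega

/-- A shortest walk survives the removal of an edge that it cannot use. -/
lemma exists_walk_deleteEdges (hG : G.Connected) {a b x u : V}
    (h1 : G.dist x u < G.dist x a + 1 + G.dist b u)
    (h2 : G.dist x u < G.dist x b + 1 + G.dist a u) :
    ∃ p : (G.deleteEdges {s(a, b)}).Walk x u, p.length = G.dist x u := by
  obtain ⟨p, hp⟩ := hG.exists_walk_length_eq_dist x u
  have hab : ∀ e ∈ p.edges, e ∉ ({s(a, b)} : Set (Sym2 V)) := by
    intro e he hab
    rw [Set.mem_singleton_iff] at hab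
    subst hab
    rcases dist_le_of_mem_edges hG p he with h | h <;> omega
  exact ⟨p.toDeleteEdges _ hab, by simp [hp]⟩

lemma exists_walk_avoiding_of_dist (hG : G.Connected) {x u z : V}
    (h : G.dist x u < G.dist x z + G.dist z u) :
    ∃ p : G.Walk x u, p.length = G.dist x u ∧ z ∉ p.support := by
  classical
  obtain ⟨p, hp⟩ := hG.exists_walk_length_eq_dist x u
  refine ⟨p, hp, fun hz => ?_⟩
  have h1 := SimpleGraph.dist_le (p.takeUntil z hz)
  have h2 := SimpleGraph.dist_le (p.dropUntil z hz)
  have h3 := congrArg SimpleGraph.Walk.length (p.take_spec hz)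
  rw [SimpleGraph.Walk.length_append] at h3
  omega

variable [DecidableEq V]

omit [DecidableEq V] in
lemma exists_rewire_walk {R A : Finset (Sym2 V)} {x y z : V} (hR : ∀ e ∈ R, z ∈ e)
    (p : G.Walk x y) (hz : z ∉ p.support) :
    ∃ p' : (rewire G R A).Walk x y, p'.length = p.length := by
  have h : ∀ e ∈ p.edges, e ∈ (rewire G R A).edgeSet := by
    intro e he
    have h1 := p.edges_subset_edgeSet he
    induction e with
    | h a b =>
      rw [SimpleGraph.mem_edgeSet, SimpleGraph.sup_adj, SimpleGraph.deleteEdges_adj]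
      refine Or.inl ⟨h1, fun hab => hz ?_⟩
      rcases Sym2.mem_iff.1 (hR _ (by simpa using hab)) with rfl | rfl
      · exact p.fst_mem_support_of_mem_edges he
      · exact p.snd_mem_support_of_mem_edges he
  exact ⟨p.transfer _ h, by simp⟩

/-- After `z` exchanges some of its edges for an edge to `x`, the distances from `z` are at most
one more than the distances from `x`, provided that the lost neighbours can be reached. -/
lemma exists_walk_rewire (hG : G.Connected) {R : Finset (Sym2 V)} {x z : V} (hxz : z ≠ x)
    (hR : ∀ e ∈ R, z ∈ e)
    (harc : ∀ y, s(z, y) ∈ R → ∃ p : G.Walk x y, z ∉ p.support ∧ p.length ≤ G.dist x z + 1)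
    (u : V) :
    ∃ p : (rewire G R {s(z, x)}).Walk z u, p.length ≤ 1 + G.dist x u := by
  have hadj : (rewire G R {s(z, x)}).Adj z x := by
    rw [SimpleGraph.sup_adj, SimpleGraph.fromEdgeSet_adj]
    exact Or.inr ⟨by simp, hxz⟩
  rcases lt_or_ge (G.dist x u) (G.dist x z + G.dist z u) with h | h
  · obtain ⟨p, hp, hz⟩ := exists_walk_avoiding_of_dist hG h
    obtain ⟨p', hp'⟩ := exists_rewire_walk (A := {s(z, x)}) hR p hz
    exact ⟨SimpleGraph.Walk.cons hadj p', by simp; omega⟩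
  · obtain ⟨q, hq⟩ := hG.exists_walk_length_eq_dist z u
    cases q with
    | nil => exact ⟨SimpleGraph.Walk.nil, by simp⟩
    | @cons _ y _ hzy q =>
      rw [SimpleGraph.Walk.length_cons] at hq
      have hzq : z ∉ q.support := by
        intro hz
        have h1 := SimpleGraph.dist_le (q.dropUntil z hz)
        have h2 := q.length_dropUntil_le_length hz
        omega
      obtain ⟨q', hq'⟩ := exists_rewire_walk (A := {s(z, x)}) hR q hzq
      by_cases hy : s(z, y) ∈ R
      · obtain ⟨r, hr, hrl⟩ := harc y hy
        obtain ⟨r', hr'⟩ := exists_rewire_walk (A := {s(z, x)}) hR r hr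
        refine ⟨SimpleGraph.Walk.cons hadj (r'.append q'), ?_⟩
        rw [SimpleGraph.Walk.length_cons, SimpleGraph.Walk.length_append]
        omega
      · have hadj' : (rewire G R {s(z, x)}).Adj z y := by
          rw [SimpleGraph.sup_adj, SimpleGraph.deleteEdges_adj]
          exact Or.inl ⟨hzy, by simpa using hy⟩
        refine ⟨SimpleGraph.Walk.cons hadj' q', ?_⟩
        rw [SimpleGraph.Walk.length_cons]
        omega

end Walks

end NetworkCreation

namespace NetworkCreation

open Finset

section Cycle

variable {V : Type*} {G : SimpleGraph V} {L : ℕ} [NeZero L]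

/-- A closed walk around which the distances in the graph are the distances along the walk. -/
structure IsIsometricCycle (G : SimpleGraph V) (v : ZMod L → V) : Prop where
  adj : ∀ i, G.Adj (v i) (v (i + 1))
  dist : ∀ i j, G.dist (v i) (v j) = min (j - i).val (i - j).val

omit [NeZero L] in
lemma exists_arc {v : ZMod L → V} (hv : ∀ i, G.Adj (v i) (v (i + 1))) (i : ZMod L) (n : ℕ) :
    ∃ p : G.Walk (v i) (v (i + n)), p.length = n ∧ (∀ x ∈ p.support, ∃ t ≤ n, x = v (i + t)) ∧
      ∀ e ∈ p.edges, ∃ t < n, e = s(v (i + t), v (i + t + 1)) := by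
  induction n with
  | zero =>
    rw [Nat.cast_zero, add_zero]
    exact ⟨SimpleGraph.Walk.nil, rfl, fun x hx => ⟨0, le_rfl, by simpa using hx⟩, by simp⟩
  | succ n ih =>
    obtain ⟨p, hp, hs, he⟩ := ih
    have e : i + ((n + 1 : ℕ) : ZMod L) = i + n + 1 := by push_cast; ring
    rw [e]
    refine ⟨p.concat (hv _), by simp [hp], fun x hx => ?_, fun x hx => ?_⟩
    · rw [SimpleGraph.Walk.support_concat, List.mem_append,
        List.mem_singleton] at hx
      rcases hx with hx | rfl
      · obtain ⟨t, ht, rfl⟩ := hs x hx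
        exact ⟨t, by omega, rfl⟩
      · exact ⟨n + 1, le_rfl, by rw [e]⟩
    · rw [SimpleGraph.Walk.edges_concat, List.concat_eq_append, List.mem_append,
        List.mem_singleton] at hx
      rcases hx with hx | rfl
      · obtain ⟨t, ht, rfl⟩ := he x hx
        exact ⟨t, by omega, rfl⟩
      · exact ⟨n, by omega, rfl⟩

lemma add_val_sub (i j : ZMod L) : i + ((j - i).val : ZMod L) = j := by simp

omit [NeZero L] in
lemma natCast_injOn {s t : ℕ} (hs : s < L) (ht : t < L) (h : (s : ZMod L) = t) : s = t := by
  rw [ZMod.natCast_eq_natCast_iff', Nat.mod_eq_of_lt hs, Nat.mod_eq_of_lt ht] at h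
  exact h

omit [NeZero L] in
lemma cycle_edge_injective (hL : 3 ≤ L) {v : ZMod L → V} (hv : Function.Injective v) {a b : ZMod L}
    (h : s(v a, v (a + 1)) = s(v b, v (b + 1))) : a = b := by
  rcases Sym2.eq_iff.1 h with ⟨h1, _⟩ | ⟨h1, h2⟩
  · exact hv h1
  · have h1 := hv h1
    have h2 := hv h2
    exfalso
    have h3 : ((2 : ℕ) : ZMod L) = ((0 : ℕ) : ZMod L) := by
      rw [h1] at h2
      push_cast
      linear_combination h2
    exact absurd (natCast_injOn (by omega) (by omega) h3) (by norm_num)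

lemma exists_isometricCycle (hG : G.Connected) (hc : ¬ G.IsAcyclic) :
    ∃ (L : ℕ) (_ : NeZero L) (v : ZMod L → V), 3 ≤ L ∧ IsIsometricCycle G v := by
  classical
  have hex : ∃ m, ∃ (a b : V) (q : G.Walk a b), G.Adj a b ∧ s(a, b) ∉ q.edges ∧ q.length = m := by
    rw [SimpleGraph.isAcyclic_iff_forall_adj_isBridge] at hc
    push Not at hc
    obtain ⟨a, b, hab, h⟩ := hc
    rw [SimpleGraph.isBridge_iff_forall_walk_mem_edges] at h
    push Not at h
    obtain ⟨q, hq⟩ := h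
    exact ⟨_, a, b, q, hab, hq, rfl⟩
  obtain ⟨m, ⟨a, b, q₀, hab, hq₀, hm₀⟩, hmin⟩ :
      ∃ m, (∃ (a b : V) (q : G.Walk a b), G.Adj a b ∧ s(a, b) ∉ q.edges ∧ q.length = m) ∧
        ∀ (a b : V) (q : G.Walk a b), G.Adj a b → s(a, b) ∉ q.edges → m ≤ q.length :=
    ⟨Nat.find hex, Nat.find_spec hex, fun a b q h1 h2 => Nat.find_min' hex ⟨a, b, q, h1, h2, rfl⟩⟩
  obtain ⟨q, hpath, hq, hm⟩ : ∃ q : G.Walk a b, q.IsPath ∧ s(a, b) ∉ q.edges ∧ q.length = m := by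
    have h1 : s(a, b) ∉ q₀.bypass.edges := fun h => hq₀ (q₀.edges_bypass_subset_edges h)
    have h2 := hmin a b q₀.bypass hab h1
    have h3 := q₀.length_bypass_le_length
    exact ⟨q₀.bypass, q₀.bypass_isPath, h1, by omega⟩
  have hm2 : 2 ≤ m := by
    rcases q with _ | ⟨h, q⟩
    · exact absurd hab (G.irrefl)
    · rcases q with _ | ⟨h', q⟩
      · simp at hq
      · simp at hm
        omega
  have hL : 3 ≤ m + 1 := by omega
  set v : ZMod (m + 1) → V := fun i => q.getVert i.val with hvdef
  have hlt : ∀ i : ZMod (m + 1), i.val ≤ m := fun i => Nat.lt_succ_iff.1 (ZMod.val_lt i)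
  have hinj : Function.Injective v := by
    intro i j hij
    exact ZMod.val_injective _ (hpath.getVert_injOn (by simpa [hm] using hlt i)
      (by simpa [hm] using hlt j) hij)
  have hadj : ∀ i, G.Adj (v i) (v (i + 1)) := by
    intro i
    rcases (hlt i).lt_or_eq with h | h
    · have e : (i + 1).val = i.val + 1 := by
        rw [ZMod.val_add_of_lt]
        · rw [ZMod.val_one'' (by omega)]
        · rw [ZMod.val_one'' (by omega)]; omega
      simp only [hvdef, e]
      exact q.adj_getVert_succ (by omega)
    · have e : i + 1 = 0 := by
        rw [← ZMod.natCast_zmod_val i, h]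
        exact_mod_cast ZMod.natCast_self (m + 1)
      simp only [hvdef, e, h, ZMod.val_zero, SimpleGraph.Walk.getVert_zero]
      rw [← hm, SimpleGraph.Walk.getVert_length]
      exact hab.symm
  refine ⟨m + 1, inferInstance, v, hL, hadj, fun i j => le_antisymm (le_min ?_ ?_) ?_⟩
  · have := exists_arc hadj i (j - i).val
    rw [add_val_sub] at this
    obtain ⟨p, hp, _⟩ := this
    rw [← hp]
    exact SimpleGraph.dist_le p
  · have := exists_arc hadj j (i - j).val
    rw [add_val_sub] at this
    obtain ⟨p, hp, _⟩ := this
    rw [← hp, SimpleGraph.dist_comm]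
    exact SimpleGraph.dist_le p
  · by_contra! hlt'
    obtain ⟨p, hp⟩ := hG.exists_walk_length_eq_dist (v i) (v j)
    rw [← hp, lt_min_iff] at hlt'
    set n := (j - i).val with hn
    have hnn : n + (i - j).val = m + 1 := by
      rw [← neg_sub j i, ZMod.neg_val, if_neg (fun h => by rw [hn, h] at hlt'; simp at hlt')]
      have := ZMod.val_lt (j - i)
      omega
    have hnL : n < m + 1 := ZMod.val_lt (j - i)
    obtain ⟨t, ht, hte⟩ : ∃ t < n, s(v (i + t), v (i + t + 1)) ∉ p.edges := by
      by_contra! hall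
      have h1 : ((range n).image (fun t : ℕ => s(v (i + t), v (i + t + 1)))) ⊆ p.edges.toFinset := by
        intro e he
        obtain ⟨t, ht, rfl⟩ := Finset.mem_image.1 he
        exact List.mem_toFinset.2 (hall t (Finset.mem_range.1 ht))
      have h2 := Finset.card_le_card h1
      rw [Finset.card_image_of_injOn, Finset.card_range] at h2
      · have h3 := List.toFinset_card_le p.edges
        rw [SimpleGraph.Walk.length_edges] at h3
        omega
      · intro s hs t ht hst
        have hs' := Finset.mem_range.1 hs
        have ht' := Finset.mem_range.1 ht
        exact natCast_injOn (by omega) (by omega)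
          (add_left_cancel (cycle_edge_injective hL hinj hst))
    obtain ⟨p1, hp1, _, he1⟩ := exists_arc hadj i t
    have h2 := exists_arc hadj (i + t + 1) (n - t - 1)
    have e2 : i + t + 1 + ((n - t - 1 : ℕ) : ZMod (m + 1)) = j := by
      have e3 : n = t + 1 + (n - t - 1) := by omega
      rw [← add_val_sub i j, ← hn]
      conv_rhs => rw [e3]
      push_cast
      ring
    rw [e2] at h2
    obtain ⟨p2, hp2, _, he2⟩ := h2
    have h3 := hmin _ _ (p1.reverse.append (p.append p2.reverse)) (hadj (i + t)) (by
      simp only [SimpleGraph.Walk.edges_append, SimpleGraph.Walk.edges_reverse, List.mem_append,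
        List.mem_reverse, not_or]
      refine ⟨fun h => ?_, hte, fun h => ?_⟩
      · obtain ⟨r, hr, hre⟩ := he1 _ h
        have := natCast_injOn (by omega) (by omega)
          (add_left_cancel (cycle_edge_injective hL hinj hre))
        omega
      · obtain ⟨r, hr, hre⟩ := he2 _ h
        have h4 := cycle_edge_injective hL hinj hre
        have h5 : ((t : ℕ) : ZMod (m + 1)) = ((t + 1 + r : ℕ) : ZMod (m + 1)) := by
          push_cast
          linear_combination h4
        have := natCast_injOn (by omega) (by omega) h5
        omega)
    simp only [SimpleGraph.Walk.length_append, SimpleGraph.Walk.length_reverse] at h3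
    omega

namespace IsIsometricCycle

variable {v : ZMod L → V}

omit [NeZero L] in
lemma injective (hv : IsIsometricCycle G v) : Function.Injective v := by
  intro i j hij
  have h := hv.dist i j
  rw [hij, SimpleGraph.dist_self] at h
  have h0 : (j - i).val = 0 ∨ (i - j).val = 0 := by omega
  rcases h0 with h | h
  · exact (sub_eq_zero.1 ((ZMod.val_eq_zero _).1 h)).symm
  · exact sub_eq_zero.1 ((ZMod.val_eq_zero _).1 h)

omit [NeZero L] in
lemma reflect (hv : IsIsometricCycle G v) : IsIsometricCycle G (fun i => v (-i)) where
  adj i := by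
    have := (hv.adj (-(i + 1))).symm
    have e : -(i + 1) + 1 = -i := by ring
    rwa [e] at this
  dist i j := by
    rw [hv.dist, min_comm]
    congr 2 <;> ring

lemma dist_add (hv : IsIsometricCycle G v) (i : ZMod L) {m : ℕ} (h1 : 1 ≤ m) (h2 : m < L) :
    G.dist (v i) (v (i + m)) = min m (L - m) := by
  rw [hv.dist, add_sub_cancel_left, ZMod.val_cast_of_lt h2, sub_add_cancel_left, ZMod.neg_val,
    if_neg, ZMod.val_cast_of_lt h2]
  intro h
  have := natCast_injOn (s := m) (t := 0) h2 (by omega) (by simpa using h)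
  omega

omit [NeZero L] in
lemma add_ne (hv : IsIsometricCycle G v) (i : ZMod L) {m : ℕ} (h1 : 1 ≤ m)
    (h2 : m < L) : v i ≠ v (i + m) := by
  intro h
  have h3 := hv.injective h
  have := natCast_injOn (s := m) (t := 0) h2 (by omega) (by simpa using h3)
  omega

omit [NeZero L] in
lemma exists_walk_succ (hv : IsIsometricCycle G v) (i : ZMod L) {m : ℕ}
    (h1 : 1 ≤ m) (h2 : m < L) :
    ∃ p : G.Walk (v (i + m)) (v (i + 1)), v i ∉ p.support ∧ p.length = m - 1 := by
  have h := exists_arc hv.adj (i + 1) (m - 1)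
  have e : i + 1 + ((m - 1 : ℕ) : ZMod L) = i + m := by
    rw [Nat.cast_sub h1]; push_cast; ring
  rw [e] at h
  obtain ⟨p, hp, hs, _⟩ := h
  refine ⟨p.reverse, fun hi => ?_, by simpa using hp⟩
  rw [SimpleGraph.Walk.support_reverse, List.mem_reverse] at hi
  obtain ⟨t, ht, hti⟩ := hs _ hi
  refine hv.add_ne i (m := t + 1) (by omega) (by omega) ?_
  rw [hti]
  push_cast
  congr 1
  ring

omit [NeZero L] in
lemma exists_walk_pred (hv : IsIsometricCycle G v) (i : ZMod L) {m : ℕ}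
    (h1 : 1 ≤ m) (h2 : m < L) :
    ∃ p : G.Walk (v (i + m)) (v (i - 1)), v i ∉ p.support ∧ p.length = L - m - 1 := by
  have h := exists_arc hv.adj (i + m) (L - m - 1)
  have e : i + m + ((L - m - 1 : ℕ) : ZMod L) = i - 1 := by
    rw [Nat.sub_sub, Nat.cast_sub (by omega)]; simp; ring
  rw [e] at h
  obtain ⟨p, hp, hs, _⟩ := h
  refine ⟨p, fun hi => ?_, hp⟩
  obtain ⟨t, ht, hti⟩ := hs _ hi
  refine hv.add_ne i (m := m + t) (by omega) (by omega) ?_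
  rw [hti]
  push_cast
  congr 1
  ring

end IsIsometricCycle

end Cycle

section Orientation

variable {V : Type*} [Fintype V] [DecidableEq V] [Nonempty V] {α : ℝ} {S : Profile V}

lemma IsNash.swap (hS : IsNash α S) (hα : 0 ≤ α) {x z : V} (hxz : z ≠ x) {R : Finset (Sym2 V)}
    (hR : R ⊆ (S z).1)
    (harc : ∀ y, s(z, y) ∈ R →
      ∃ p : (graph S).Walk x y, z ∉ p.support ∧ p.length ≤ (graph S).dist x z + 1) :
    α * (#R : ℝ) + ∑ u, ((graph S).dist u z : ℝ)
      ≤ α + ((Fintype.card V : ℝ) - 1) + ∑ u, ((graph S).dist u x : ℝ) := by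
  have hw := exists_walk_rewire hS.connected hxz (fun e he => ((S z).2 e (hR he)).1) harc
  have h1 := hS.deviation (A := {s(z, x)}) hα hR (by simp [hxz])
    (fun u => by obtain ⟨p, _⟩ := hw u; exact ⟨p.reverse⟩)
  have h2 : ∑ u, ((rewire (graph S) R {s(z, x)}).dist u z : ℝ)
      ≤ ∑ u ∈ univ.erase z, (1 + ((graph S).dist u x : ℝ)) := by
    rw [← Finset.sum_erase univ (a := z)
      (f := fun u => ((rewire (graph S) R {s(z, x)}).dist u z : ℝ)) (by simp)]
    refine Finset.sum_le_sum (fun u _ => ?_)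
    obtain ⟨p, hp⟩ := hw u
    have h3 := (SimpleGraph.dist_le p).trans hp
    rw [SimpleGraph.dist_comm, SimpleGraph.dist_comm (v := u)] at h3
    exact_mod_cast h3
  rw [Finset.sum_add_distrib, Finset.sum_const, Finset.card_erase_of_mem (Finset.mem_univ _),
    Finset.card_univ, nsmul_eq_mul, mul_one, Nat.cast_sub Fintype.card_pos, Nat.cast_one] at h2
  have h4 : ∑ u ∈ univ.erase z, ((graph S).dist u x : ℝ) ≤ ∑ u, ((graph S).dist u x : ℝ) :=
    Finset.sum_le_sum_of_subset_of_nonneg (Finset.erase_subset _ _) (fun _ _ _ => Nat.cast_nonneg _)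
  rw [Finset.card_singleton, Nat.cast_one, mul_one] at h1
  linarith

variable {L : ℕ} [NeZero L] {v : ZMod L → V}

/-- If `v i` buys both of its edges in the cycle, then an agent on the opposite side of the cycle
buys none of its own. -/
lemma IsNash.not_buy_opposite (hS : IsNash α S) (hα0 : 0 ≤ α)
    (hα : 2 * ((Fintype.card V : ℝ) - 1) < α) (hL : 3 ≤ L)
    (hv : IsIsometricCycle (graph S) v) {i : ZMod L} (h1 : s(v i, v (i + 1)) ∈ (S (v i)).1)
    (h2 : s(v i, v (i - 1)) ∈ (S (v i)).1) {m : ℕ} (hm : 1 ≤ m) (hmL : m < L)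
    (hm1 : 2 * m ≤ L + 2) (hm2 : L ≤ 2 * m + 2) {y : V}
    (hy : y = v (i + m + 1) ∨ y = v (i + m - 1)) : s(v (i + m), y) ∉ (S (v (i + m))).1 := by
  intro hmem
  have hG := hS.connected
  have hd := hv.dist_add i hm hmL
  have hne := hv.add_ne i hm hmL
  have hinj := hv.injective
  have e1 := hS.swap hα0 hne (R := {s(v i, v (i + 1)), s(v i, v (i - 1))})
    (by intro e he; rcases Finset.mem_insert.1 he with rfl | he
        · exact h1
        · rw [Finset.mem_singleton.1 he]; exact h2)
    (by
      intro y hy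
      rw [SimpleGraph.dist_comm, hd]
      rcases Finset.mem_insert.1 hy with hy | hy
      · rw [Sym2.congr_right.1 hy]
        obtain ⟨p, hp, hpl⟩ := hv.exists_walk_succ i hm hmL
        exact ⟨p, hp, by omega⟩
      · rw [Sym2.congr_right.1 (Finset.mem_singleton.1 hy)]
        obtain ⟨p, hp, hpl⟩ := hv.exists_walk_pred i hm hmL
        exact ⟨p, hp, by omega⟩)
  have hback : i + (m : ZMod L) + ((L - m : ℕ) : ZMod L) = i := by
    rw [Nat.cast_sub hmL.le]; simp
  have e2 := hS.swap hα0 hne.symm (R := {s(v (i + m), y)}) (by simpa using hmem)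
    (by
      intro y' hy'
      rw [Sym2.congr_right.1 (Finset.mem_singleton.1 hy'), hd]
      rcases hy with rfl | rfl
      · have := hv.exists_walk_succ (i + m) (m := L - m) (by omega) (by omega)
        rw [hback] at this
        obtain ⟨p, hp, hpl⟩ := this
        exact ⟨p, hp, by omega⟩
      · have := hv.exists_walk_pred (i + m) (m := L - m) (by omega) (by omega)
        rw [hback] at this
        obtain ⟨p, hp, hpl⟩ := this
        exact ⟨p, hp, by omega⟩)
  have hcard : #({s(v i, v (i + 1)), s(v i, v (i - 1))} : Finset (Sym2 V)) = 2 := by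
    refine Finset.card_pair (fun h => ?_)
    have h3 := hinj (Sym2.congr_right.1 h)
    have h4 : ((2 : ℕ) : ZMod L) = ((0 : ℕ) : ZMod L) := by
      push_cast
      linear_combination h3
    exact absurd (natCast_injOn (by omega) (by omega) h4) (by norm_num)
  rw [hcard] at e1
  rw [Finset.card_singleton] at e2
  push_cast at e1 e2
  linarith

lemma IsNash.not_buy_both (hS : IsNash α S) (hα0 : 0 ≤ α)
    (hα : 2 * ((Fintype.card V : ℝ) - 1) < α) (hL : 3 ≤ L)
    (hv : IsIsometricCycle (graph S) v) {i : ZMod L} (h1 : s(v i, v (i + 1)) ∈ (S (v i)).1) :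
    s(v i, v (i - 1)) ∉ (S (v i)).1 := by
  intro h2
  have hm : ∀ m : ℕ, L ≤ 2 * m + 2 → 1 ≤ m → m < L → 2 * m ≤ L + 2 → ∀ y : V,
      y = v (i + m + 1) ∨ y = v (i + m - 1) → s(v (i + m), y) ∉ (S (v (i + m))).1 :=
    fun m a b c d y hy => hS.not_buy_opposite hα0 hα hL hv h1 h2 b c d a hy
  rcases exists_owner (hv.adj (i + (L / 2 : ℕ))) with h | h
  · exact hm (L / 2) (by omega) (by omega) (by omega) (by omega) _ (Or.inl rfl) h
  · refine hm (L / 2 + 1) (by omega) (by omega) (by omega) (by omega) (v (i + (L / 2 : ℕ)))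
      (Or.inr ?_) ?_
    · congr 1; push_cast; ring
    · have e : i + ((L / 2 + 1 : ℕ) : ZMod L) = i + ((L / 2 : ℕ) : ZMod L) + 1 := by push_cast; ring
      rw [e, Sym2.eq_swap]
      exact h

/-- Up to reflection, every agent on an isometric cycle buys the edge to its successor. -/
lemma IsNash.exists_oriented (hS : IsNash α S) (hα0 : 0 ≤ α)
    (hα : 2 * ((Fintype.card V : ℝ) - 1) < α) (hL : 3 ≤ L)
    (hv : IsIsometricCycle (graph S) v) :
    ∃ w : ZMod L → V, IsIsometricCycle (graph S) w ∧ ∀ i, s(w i, w (i + 1)) ∈ (S (w i)).1 := by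
  by_cases hex : ∃ i₀, s(v i₀, v (i₀ + 1)) ∈ (S (v i₀)).1
  · obtain ⟨i₀, hi₀⟩ := hex
    have h : ∀ n : ℕ, s(v (i₀ - n), v (i₀ - n + 1)) ∈ (S (v (i₀ - n))).1 := by
      intro n
      induction n with
      | zero => rwa [Nat.cast_zero, sub_zero]
      | succ n ih =>
        have h1 := hS.not_buy_both hα0 hα hL hv ih
        have e : i₀ - (n : ZMod L) - 1 = i₀ - ((n + 1 : ℕ) : ZMod L) := by push_cast; ring
        have e' : i₀ - ((n + 1 : ℕ) : ZMod L) + 1 = i₀ - n := by push_cast; ring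
        rcases exists_owner (hv.adj (i₀ - ((n + 1 : ℕ) : ZMod L))) with h | h
        · exact h
        · rw [e', Sym2.eq_swap, ← e] at h
          exact absurd h h1
    refine ⟨v, hv, fun i => ?_⟩
    have := h (i₀ - i).val
    rwa [ZMod.natCast_zmod_val, sub_sub_cancel] at this
  · push Not at hex
    refine ⟨fun i => v (-i), hv.reflect, fun i => ?_⟩
    have h := (exists_owner (hv.adj (-(i + 1)))).resolve_left (hex _)
    have e : -(i + 1) + 1 = -i := by ring
    rw [e, Sym2.eq_swap] at h
    exact h

end Orientation

end NetworkCreation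

namespace NetworkCreation

open Finset CyclicWalk

section Losses

variable {V : Type*} {G : SimpleGraph V} {L : ℕ} [NeZero L] {v : ZMod L → V}

omit [NeZero L] in
lemma unitSteps_dist (hG : G.Connected) (hv : IsIsometricCycle G v) (u : V) :
    UnitSteps (fun i => G.dist (v i) u) := by
  intro i
  have h := SimpleGraph.dist_eq_one_iff_adj.2 (hv.adj i)
  have h1 := hG.dist_triangle (u := v i) (v := v (i + 1)) (w := u)
  have h2 := hG.dist_triangle (u := v (i + 1)) (v := v i) (w := u)
  rw [SimpleGraph.dist_comm (u := v (i + 1)) (v := v i)] at h2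
  simp only
  omega

/-- The graph without the `i`-th edge of the cycle. -/
abbrev cut (G : SimpleGraph V) (v : ZMod L → V) (i : ZMod L) : SimpleGraph V :=
  G.deleteEdges {s(v i, v (i + 1))}

omit [NeZero L] in
lemma exists_walk_cut (hL : 3 ≤ L) (hv : IsIsometricCycle G v) (i : ZMod L) {a b : ℕ} (hab : a ≤ b)
    (hb : b < L) : ∃ p : (cut G v i).Walk (v (i - b)) (v (i - a)), p.length = b - a := by
  have h := exists_arc hv.adj (i - b) (b - a)
  have e : i - b + ((b - a : ℕ) : ZMod L) = i - a := by
    rw [Nat.cast_sub hab]; ring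
  rw [e] at h
  obtain ⟨p, hp, _, he⟩ := h
  refine ⟨p.toDeleteEdges _ (fun x hx hxi => ?_), by simpa using hp⟩
  obtain ⟨t, ht, rfl⟩ := he x hx
  have h1 := cycle_edge_injective hL hv.injective hxi
  have h2 : ((t : ℕ) : ZMod L) = (b : ℕ) := by linear_combination h1
  have := natCast_injOn (by omega) hb h2
  omega

omit [NeZero L] in
lemma dist_cut_arc_le (hL : 3 ≤ L) (hv : IsIsometricCycle G v) (i : ZMod L) {a b : ℕ} (hab : a ≤ b)
    (hb : b < L) : (cut G v i).dist (v (i - a)) (v (i - b)) ≤ b - a := by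
  obtain ⟨p, hp⟩ := exists_walk_cut hL hv i hab hb
  rw [SimpleGraph.dist_comm, ← hp]
  exact SimpleGraph.dist_le p

omit [NeZero L] in
lemma connected_cut (hG : G.Connected) (hL : 3 ≤ L) (hv : IsIsometricCycle G v) (i : ZMod L) :
    (cut G v i).Connected := by
  refine hG.connected_delete_edge_of_not_isBridge ?_
  rw [SimpleGraph.isBridge_iff, not_not]
  obtain ⟨p, _⟩ := exists_walk_cut hL hv i (a := 0) (b := L - 1) (by omega) (by omega)
  have e : i - ((L - 1 : ℕ) : ZMod L) = i + 1 := by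
    rw [Nat.cast_sub (by omega)]; simp
  rw [e, Nat.cast_zero, sub_zero] at p
  exact ⟨p.reverse⟩

omit [NeZero L] in
lemma dist_cut_le (hG : G.Connected) {i : ZMod L} {x u : V}
    (h1 : G.dist x u < G.dist x (v i) + 1 + G.dist (v (i + 1)) u)
    (h2 : G.dist x u < G.dist x (v (i + 1)) + 1 + G.dist (v i) u) :
    (cut G v i).dist x u ≤ G.dist x u := by
  obtain ⟨p, hp⟩ := exists_walk_deleteEdges hG h1 h2
  rw [← hp]
  exact SimpleGraph.dist_le p

omit [NeZero L] in
lemma dist_cut_le_of_not_drop (hG : G.Connected) {i : ZMod L} {u : V}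
    (h : G.dist (v i) u ≤ G.dist (v (i + 1)) u) : (cut G v i).dist (v i) u ≤ G.dist (v i) u :=
  dist_cut_le hG (by omega) (by omega)

lemma two_mul_depth_add_two_le {f : ZMod L → ℕ} (hf : UnitSteps f) {i : ZMod L}
    (hi : f (i + 1) < f i) : 2 * (depth f i + 1) ≤ L := by
  have h1 := two_mul_height_le hf (sub_depth_mem_starts hi)
  have h2 := depth_lt_height hi
  omega

lemma apply_pred_add_one {f : ZMod L → ℕ} (hf : UnitSteps f) (i : ZMod L) :
    f (i - ((depth f i + 1 : ℕ) : ZMod L)) + 1 = f i + depth f i + plat f i := by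
  have h1 := apply_sub_of_le_depth hf (le_refl (depth f i))
  have h2 := depth_spec (f := f) i
  have h3 := (hf (i - depth f i - 1)).2
  have h4 := (hf (i - depth f i - 1)).1
  rw [sub_add_cancel] at h3 h4
  have e : i - ((depth f i + 1 : ℕ) : ZMod L) = i - depth f i - 1 := by push_cast; ring
  rw [e]
  unfold plat
  split_ifs <;> omega

lemma dist_cut_pred_le (hG : G.Connected) (hL : 3 ≤ L) (hv : IsIsometricCycle G v) {i : ZMod L}
    {u : V} {f : ZMod L → ℕ} (hfu : ∀ j, f j = G.dist (v j) u) (hf : UnitSteps f)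
    (hi : f (i + 1) < f i) {a : ℕ} (ha : a ≤ depth f i + 1) :
    (cut G v i).dist (v (i - a)) u + a ≤ f i + cap f i := by
  have h2 := two_mul_depth_add_two_le hf hi
  have h3 := apply_pred_add_one hf i
  have h4 := plat_le_one (f := f) i
  set t := depth f i with ht
  have h5 := hv.dist_add (i - ((t + 1 : ℕ) : ZMod L)) (m := t + 1) (by omega) (by omega)
  rw [sub_add_cancel] at h5
  have h6 := hG.dist_triangle (u := v (i - ((t + 1 : ℕ) : ZMod L))) (v := v (i + 1)) (w := v i)
  have h7 := SimpleGraph.dist_eq_one_iff_adj.2 (hv.adj i).symm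
  have h8 := (hf i).2
  have h9 : (cut G v i).dist (v (i - ((t + 1 : ℕ) : ZMod L))) u
      ≤ G.dist (v (i - ((t + 1 : ℕ) : ZMod L))) u := by
    refine dist_cut_le hG ?_ ?_ <;> rw [← hfu, ← hfu] <;> omega
  rw [← hfu] at h9
  have h10 := (connected_cut hG hL hv i).dist_triangle (u := v (i - a))
    (v := v (i - ((t + 1 : ℕ) : ZMod L))) (w := u)
  have h11 := dist_cut_arc_le hL hv i ha (by omega)
  unfold cap
  omega

omit [NeZero L] in
lemma le_apply_add {f : ZMod L → ℕ} (hf : UnitSteps f) (i : ZMod L) (n : ℕ) :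
    f i ≤ f (i + n) + n := by
  induction n with
  | zero => simp
  | succ n ih =>
    have := (hf (i + n)).2
    have e : i + ((n + 1 : ℕ) : ZMod L) = i + n + 1 := by push_cast; ring
    rw [e]
    omega

lemma le_depth_of_apply_sub {f : ZMod L → ℕ} (hf : UnitSteps f) {i : ZMod L} {e : ℕ}
    (h : f i + e ≤ f (i - e)) : e ≤ depth f i := by
  by_contra! hlt
  refine depth_spec (f := f) i ?_
  set t := depth f i with ht
  have h1 := le_apply_add hf (i - e) (e - t - 1)
  have e1 : i - (e : ZMod L) + ((e - t - 1 : ℕ) : ZMod L) = i - t - 1 := by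
    rw [Nat.sub_sub, Nat.cast_sub (by omega)]; push_cast; ring
  have h2 := le_apply_add hf (i - t) t
  rw [sub_add_cancel] at h2
  rw [e1] at h1
  omega

variable (G v) in
/-- The increase of the distance from `v i` to `u` when the `i`-th edge of the cycle is removed. -/
noncomputable def sellLoss (u : V) (i : ZMod L) : ℝ :=
  (cut G v i).dist u (v i) - G.dist u (v i)

variable (G v) in
/-- The increase of the distance from `v i` to `u` when the `i`-th edge of the cycle is replaced
by an edge to `v j`. -/
noncomputable def swapLoss (u : V) (i j : ZMod L) : ℝ :=
  if i = j then 0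
  else (rewire G {s(v i, v (i + 1))} {s(v i, v j)}).dist u (v i) - G.dist u (v i)

omit [NeZero L] in
lemma cut_le_rewire (i : ZMod L) (A : Finset (Sym2 V)) :
    cut G v i ≤ rewire G {s(v i, v (i + 1))} A := by
  rw [rewire, Finset.coe_singleton]
  exact le_sup_left

omit [NeZero L] in
lemma dist_rewire_le (hG : G.Connected) (hL : 3 ≤ L) (hv : IsIsometricCycle G v) (i : ZMod L)
    (A : Finset (Sym2 V)) (x y : V) :
    (rewire G {s(v i, v (i + 1))} A).dist x y ≤ (cut G v i).dist x y :=
  (connected_cut hG hL hv i x y).dist_anti (cut_le_rewire i A)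

omit [NeZero L] in
lemma sellLoss_le_zero (hG : G.Connected) {u : V} {i : ZMod L}
    (h : G.dist (v i) u ≤ G.dist (v (i + 1)) u) : sellLoss G v u i ≤ 0 := by
  have h1 := dist_cut_le_of_not_drop hG h
  unfold sellLoss
  rw [SimpleGraph.dist_comm, SimpleGraph.dist_comm (u := u)]
  have : ((cut G v i).dist (v i) u : ℝ) ≤ G.dist (v i) u := by exact_mod_cast h1
  linarith

lemma sellLoss_le_cap (hG : G.Connected) (hL : 3 ≤ L) (hv : IsIsometricCycle G v) {i : ZMod L}
    {u : V} {f : ZMod L → ℕ} (hfu : ∀ j, f j = G.dist (v j) u) (hi : f (i + 1) < f i) :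
    sellLoss G v u i ≤ cap f i := by
  have hf : UnitSteps f := by
    have := unitSteps_dist hG hv u
    rwa [← funext hfu] at this
  have h1 := dist_cut_pred_le hG hL hv hfu hf hi (a := 0) (by omega)
  rw [Nat.cast_zero, sub_zero, add_zero] at h1
  unfold sellLoss
  rw [SimpleGraph.dist_comm, SimpleGraph.dist_comm (u := u), ← hfu]
  have : ((cut G v i).dist (v i) u : ℝ) ≤ f i + cap f i := by exact_mod_cast h1
  linarith

omit [NeZero L] in
lemma swapLoss_le_sellLoss (hG : G.Connected) (hL : 3 ≤ L) (hv : IsIsometricCycle G v)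
    {i j : ZMod L} (hij : i ≠ j) (u : V) : swapLoss G v u i j ≤ sellLoss G v u i := by
  unfold swapLoss sellLoss
  rw [if_neg hij]
  have := dist_rewire_le hG hL hv i {s(v i, v j)} u (v i)
  have : ((rewire G {s(v i, v (i + 1))} {s(v i, v j)}).dist u (v i) : ℝ)
    ≤ (cut G v i).dist u (v i) := by exact_mod_cast this
  linarith

omit [NeZero L] in
lemma swapLoss_le_jump (hG : G.Connected) (hL : 3 ≤ L) (hv : IsIsometricCycle G v)
    {i j : ZMod L} (hij : i ≠ j) (u : V) :
    swapLoss G v u i j ≤ 1 + (cut G v i).dist (v j) u - G.dist (v i) u := by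
  unfold swapLoss
  rw [if_neg hij]
  have hc := (connected_cut hG hL hv i).mono (cut_le_rewire i {s(v i, v j)})
  have hadj : (rewire G {s(v i, v (i + 1))} {s(v i, v j)}).Adj (v i) (v j) := by
    rw [SimpleGraph.sup_adj, SimpleGraph.fromEdgeSet_adj]
    exact Or.inr ⟨by simp, hv.injective.ne hij⟩
  have h1 := hc.dist_triangle (u := v i) (v := v j) (w := u)
  rw [SimpleGraph.dist_eq_one_iff_adj.2 hadj] at h1
  have h2 := h1.trans (add_le_add_right (dist_rewire_le hG hL hv i {s(v i, v j)} (v j) u) 1)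
  rw [SimpleGraph.dist_comm, SimpleGraph.dist_comm (u := u)]
  have : ((rewire G {s(v i, v (i + 1))} {s(v i, v j)}).dist (v i) u : ℝ)
    ≤ 1 + (cut G v i).dist (v j) u := by exact_mod_cast h2
  linarith

lemma isLossBound_swapLoss (hG : G.Connected) (hL : 3 ≤ L) (hv : IsIsometricCycle G v) {u : V}
    {f : ZMod L → ℕ} (hfu : ∀ j, f j = G.dist (v j) u) :
    IsLossBound f (swapLoss G v u) := by
  have hf : UnitSteps f := by
    have := unitSteps_dist hG hv u
    rwa [← funext hfu] at this
  have hself : ∀ i, swapLoss G v u i i = 0 := fun i => by simp [swapLoss]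
  have hnonpos : ∀ i j, f i ≤ f (i + 1) → swapLoss G v u i j ≤ 0 := by
    intro i j h
    rcases eq_or_ne i j with rfl | hij
    · exact (hself i).le
    · exact (swapLoss_le_sellLoss hG hL hv hij u).trans
        (sellLoss_le_zero hG (by rwa [← hfu, ← hfu]))
  have htri : ∀ i j : ZMod L, f j ≤ G.dist (v j) (v i) + f i := by
    intro i j
    rw [hfu, hfu]
    exact hG.dist_triangle
  have hjump : ∀ i j, i ≠ j → f j < G.dist (v j) (v i) + 1 + f (i + 1) →
      f j < G.dist (v j) (v (i + 1)) + 1 + f i → swapLoss G v u i j ≤ 1 + f j - f i := by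
    intro i j hij h1 h2
    refine (swapLoss_le_jump hG hL hv hij u).trans ?_
    rw [hfu, hfu] at h1 h2
    have := dist_cut_le hG h1 h2
    rw [← hfu, ← hfu] at *
    have : ((cut G v i).dist (v j) u : ℝ) ≤ f j := by exact_mod_cast this
    linarith
  refine ⟨hnonpos, fun i j h => ?_, fun i j h => ?_, fun i h e he1 he2 => ?_, fun i j h hrun => ?_⟩
  · rcases eq_or_ne i j with rfl | hij
    · rw [hself]; linarith
    · have h1 := htri i j
      rcases lt_or_ge (f j) (G.dist (v j) (v (i + 1)) + 1 + f i) with h2 | h2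
      · exact hjump i j hij (by omega) h2
      · refine (hnonpos i j h).trans ?_
        have : (f i : ℝ) ≤ f j := by exact_mod_cast (by omega : f i ≤ f j)
        linarith
  · rcases eq_or_ne i j with rfl | hij
    · rw [hself]; positivity
    · exact (swapLoss_le_sellLoss hG hL hv hij u).trans (sellLoss_le_cap hG hL hv hfu h)
  · have hlt := two_mul_depth_add_two_le hf h
    have hij : i ≠ i - e := by
      intro h1
      have h2 : ((e : ℕ) : ZMod L) = ((0 : ℕ) : ZMod L) := by
        push_cast
        linear_combination h1
      have := natCast_injOn (by omega) (by omega) h2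
      omega
    refine (swapLoss_le_jump hG hL hv hij u).trans ?_
    have h1 := dist_cut_pred_le hG hL hv hfu hf h (a := e) (by omega)
    have : ((cut G v i).dist (v (i - e)) u : ℝ) + e ≤ f i + cap f i := by exact_mod_cast h1
    rw [← hfu]
    linarith
  · rcases eq_or_ne i j with rfl | hij
    · rw [hself]; linarith
    · have h1 := htri (i + 1) j
      have h2 := (hf i).2
      rcases lt_or_ge (f j) (G.dist (v j) (v i) + 1 + f (i + 1)) with h3 | h3
      · exact hjump i j hij h3 (by omega)
      · exfalso
        have h4 : 0 < G.dist (v j) (v i) := hG.pos_dist_of_ne (hv.injective.ne hij.symm)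
        have h5 := hv.dist j i
        rcases le_total (i - j).val (j - i).val with h6 | h6
        · rw [min_eq_left h6] at h5
          have ej : j = i - (((i - j).val : ℕ) : ZMod L) := by simp
          have h7 := le_depth_of_apply_sub hf (i := i) (e := (i - j).val) (by rw [← ej]; omega)
          exact hrun _ (by omega) h7 ej
        · rw [min_eq_right h6] at h5
          have h7 := apply_add_le hf (i + 1) ((j - i).val - 1)
          have ej : i + 1 + (((j - i).val - 1 : ℕ) : ZMod L) = j := by
            rw [Nat.cast_sub (by omega)]; simp
          rw [ej] at h7
          omega

end Losses

end NetworkCreation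

namespace NetworkCreation

open Finset CyclicWalk

section Bound

variable {V : Type*} [Fintype V] [DecidableEq V] [Nonempty V] {α : ℝ} {S : Profile V}
  {L : ℕ} [NeZero L] {v : ZMod L → V}

omit [NeZero L] in
lemma IsNash.le_sum_sellLoss (hS : IsNash α S) (hα : 0 ≤ α) (hL : 3 ≤ L)
    (hv : IsIsometricCycle (graph S) v) {i : ZMod L} (hi : s(v i, v (i + 1)) ∈ (S (v i)).1) :
    α ≤ ∑ u, sellLoss (graph S) v u i := by
  have h1 := hS.deviation hα (R := {s(v i, v (i + 1))}) (A := ∅) (by simpa using hi) (by simp)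
    (fun u => (connected_cut hS.connected hL hv i u (v i)).mono (cut_le_rewire i ∅))
  have h2 : ∑ u, ((rewire (graph S) {s(v i, v (i + 1))} ∅).dist u (v i) : ℝ)
      ≤ ∑ u, ((cut (graph S) v i).dist u (v i) : ℝ) :=
    Finset.sum_le_sum (fun u _ => by exact_mod_cast dist_rewire_le hS.connected hL hv i ∅ u (v i))
  simp only [sellLoss, Finset.sum_sub_distrib]
  rw [Finset.card_singleton, Finset.card_empty, Nat.cast_one, Nat.cast_zero] at h1
  linarith

omit [NeZero L] in
lemma IsNash.sum_swapLoss_nonneg (hS : IsNash α S) (hα : 0 ≤ α) (hL : 3 ≤ L)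
    (hv : IsIsometricCycle (graph S) v) {i : ZMod L} (hi : s(v i, v (i + 1)) ∈ (S (v i)).1)
    (j : ZMod L) : 0 ≤ ∑ u, swapLoss (graph S) v u i j := by
  rcases eq_or_ne i j with rfl | hij
  · simp [swapLoss]
  have hne := hv.injective.ne hij
  have h1 := hS.deviation hα (R := {s(v i, v (i + 1))}) (A := {s(v i, v j)}) (by simpa using hi)
    (by simp [hne])
    (fun u => (connected_cut hS.connected hL hv i u (v i)).mono (cut_le_rewire i _))
  simp only [swapLoss, if_neg hij, Finset.sum_sub_distrib]
  rw [Finset.card_singleton, Finset.card_singleton] at h1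
  linarith

lemma IsNash.price_le_of_short_cycle (hS : IsNash α S) (hα : 0 ≤ α) (hL : 3 ≤ L) (hL' : L ≤ 13)
    (hv : IsIsometricCycle (graph S) v) (hown : ∀ i, s(v i, v (i + 1)) ∈ (S (v i)).1) :
    α ≤ 3 * ((Fintype.card V : ℝ) - 1) := by
  have hG := hS.connected
  have hn : (L : ℝ) ≤ Fintype.card V := by
    have := Fintype.card_le_of_injective v hv.injective
    rw [ZMod.card] at this
    exact_mod_cast this
  have h3 : (3 : ℝ) ≤ L := by exact_mod_cast hL
  have h13 : (L : ℝ) ≤ 13 := by exact_mod_cast hL'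
  have h1 : (L : ℝ) * α ≤ ∑ u, ∑ i, sellLoss (graph S) v u i := by
    rw [Finset.sum_comm]
    have := Finset.sum_le_sum (s := univ) (fun i (_ : i ∈ univ) =>
      hS.le_sum_sellLoss hα hL hv (hown i))
    simpa [ZMod.card] using this
  have h2 : ∀ u ∈ univ, 4 * ∑ i, sellLoss (graph S) v u i ≤ ((L : ℝ) - 1) ^ 2 := fun u _ =>
    sum_cap_le (unitSteps_dist hG hv u) (fun i hi => sellLoss_le_cap hG hL hv (fun _ => rfl) hi)
      (fun i hi => sellLoss_le_zero hG hi)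
  have h4 := Finset.sum_le_sum h2
  rw [← Finset.mul_sum, Finset.sum_const, Finset.card_univ, nsmul_eq_mul] at h4
  set n : ℝ := (Fintype.card V : ℝ) with hndef
  have h5 : n * ((L : ℝ) - 1) ^ 2 ≤ n * (12 * (L - 1)) :=
    mul_le_mul_of_nonneg_left (by nlinarith) (by linarith)
  have h6 : (L : ℝ) * α ≤ L * (3 * (n - 1)) := by linarith
  exact le_of_mul_le_mul_left h6 (by linarith)

lemma IsNash.price_le_of_long_cycle (hS : IsNash α S) (hα : 0 ≤ α) (hL : 14 ≤ L)
    (hv : IsIsometricCycle (graph S) v) (hown : ∀ i, s(v i, v (i + 1)) ∈ (S (v i)).1) :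
    α ≤ 3 * ((Fintype.card V : ℝ) - 1) := by
  have hG := hS.connected
  have hL3 : 3 ≤ L := by omega
  have hLr : (14 : ℝ) ≤ L := by exact_mod_cast hL
  set c : V → ZMod L → ℝ := sellLoss (graph S) v with hc
  set ℓ : V → ZMod L → ZMod L → ℝ := swapLoss (graph S) v with hℓ
  set W : V → ℝ := fun u => (L : ℝ) * (L - 1) * ∑ i, (c u i + ℓ u i (i + 2)
      + 1 / 2 * ℓ u i (i + 3)) + 12 * ∑ i, ∑ j, weight i j * ℓ u i j with hW
  have hlow : (L : ℝ) * (L - 1) * (L * α) ≤ ∑ u, W u := by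
    have hpos := fun i j => hS.sum_swapLoss_nonneg hα hL3 hv (hown i) j
    have e1 : ∑ u, W u = (L : ℝ) * (L - 1) * ∑ i, (∑ u, c u i + ∑ u, ℓ u i (i + 2)
        + 1 / 2 * ∑ u, ℓ u i (i + 3)) + 12 * ∑ i, ∑ j, weight i j * ∑ u, ℓ u i j := by
      simp only [hW]
      rw [Finset.sum_add_distrib, ← Finset.mul_sum, ← Finset.mul_sum, Finset.sum_comm]
      congr 2
      · refine Finset.sum_congr rfl (fun i _ => ?_)
        rw [Finset.sum_add_distrib, Finset.sum_add_distrib, Finset.mul_sum]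
      · rw [Finset.sum_comm]
        refine Finset.sum_congr rfl (fun i _ => ?_)
        rw [Finset.sum_comm]
        exact Finset.sum_congr rfl (fun j _ => (Finset.mul_sum _ _ _).symm)
    have e2 : (L : ℝ) * α ≤ ∑ i, (∑ u, c u i + ∑ u, ℓ u i (i + 2)
        + 1 / 2 * ∑ u, ℓ u i (i + 3)) := by
      have : (L : ℝ) * α = ∑ i : ZMod L, α := by simp [ZMod.card]
      rw [this]
      refine Finset.sum_le_sum (fun i _ => ?_)
      have h1 := hS.le_sum_sellLoss hα hL3 hv (hown i)
      have h2 := hpos i (i + 2)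
      have h3 := hpos i (i + 3)
      linarith
    have e3 : 0 ≤ ∑ i, ∑ j, weight i j * ∑ u, ℓ u i j :=
      Finset.sum_nonneg (fun i _ => Finset.sum_nonneg (fun j _ =>
        mul_nonneg (weight_nonneg i j) (hpos i j)))
    have e4 := mul_le_mul_of_nonneg_left e2
      (mul_nonneg (by linarith) (by linarith) : 0 ≤ (L : ℝ) * (L - 1))
    rw [e1]
    linarith
  have hup : ∀ u ∈ univ, W u ≤ 3 * (L : ℝ) ^ 2 * (L - 1)
      - if u ∈ univ.image v then 3 * ((L : ℝ) * (L - 1)) else 0 := by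
    intro u _
    have hf := unitSteps_dist hG hv u
    have hl := isLossBound_swapLoss hG hL3 hv (u := u) (fun _ => rfl)
    have h1 : ∀ i, (graph S).dist (v (i + 1)) u < (graph S).dist (v i) u → c u i
        ≤ cap (fun i => (graph S).dist (v i) u) i :=
      fun i hi => sellLoss_le_cap hG hL3 hv (fun _ => rfl) hi
    have h2 : ∀ i, (graph S).dist (v i) u ≤ (graph S).dist (v (i + 1)) u → c u i ≤ 0 :=
      fun i hi => sellLoss_le_zero hG hi
    split_ifs with hu
    · obtain ⟨k, _, rfl⟩ := Finset.mem_image.1 hu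
      exact sum_local_add_sum_weight_le_cyclic_dist hL (k := k)
        (fun i => by rw [hv.dist, min_comm]) hf hl h1 h2
    · rw [sub_zero]
      exact sum_local_add_sum_weight_le hL hf hl h1 h2
  have hsum := hlow.trans (Finset.sum_le_sum hup)
  rw [Finset.sum_sub_distrib, Finset.sum_const, Finset.card_univ, nsmul_eq_mul, ← Finset.sum_filter,
    Finset.sum_const, Finset.filter_mem_eq_inter, Finset.univ_inter,
    Finset.card_image_of_injective _ hv.injective, Finset.card_univ, ZMod.card,
    nsmul_eq_mul] at hsum
  have hpos : (0 : ℝ) < L * (L - 1) * L := by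
    apply mul_pos (mul_pos _ _) <;> linarith
  refine le_of_mul_le_mul_left ?_ hpos
  linarith

end Bound

end NetworkCreation

theorem mainTheorem1 {V : Type*} [Fintype V] [DecidableEq V] [Nonempty V]
    (α : ℝ) (hα : 3 * ((Fintype.card V : ℝ) - 1) < α)
    (S : NetworkCreation.Profile V) (hS : NetworkCreation.IsNash α S) :
    (NetworkCreation.graph S).IsTree := by
  have hG := hS.connected
  refine (SimpleGraph.isTree_iff _).2 ⟨hG, ?_⟩
  by_contra hc
  have hn : (1 : ℝ) ≤ Fintype.card V := by exact_mod_cast Fintype.card_pos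
  have hα0 : 0 ≤ α := by linarith
  obtain ⟨L, _, v, hL, hv⟩ := NetworkCreation.exists_isometricCycle hG hc
  obtain ⟨w, hw, hown⟩ := hS.exists_oriented hα0 (by linarith) hL hv
  rcases Nat.lt_or_ge L 14 with h | h
  · exact absurd (hS.price_le_of_short_cycle hα0 hL (by omega) hw hown) (not_le.2 hα)
  · exact absurd (hS.price_le_of_long_cycle hα0 h hw hown) (not_le.2 hα)
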